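/- Throughout, a system is a set $\mathcal F$ of formulas of second-order arithmetic (its axioms, read universally closed), $\mathcal F\vdash\varphi$ means that $\varphi$ is a logical consequence of $\mathcal F$ (equivalently, derivable from it), and $\mathrm{RCA}_0$ is the usual system: the basic axioms of arithmetic, $\Sigma^0_1$ induction and $\Delta^0_1$ comprehension. Let $\mathrm{Def}(\mathcal F)$ be the class of sets $A\subseteq\mathbb N$ for which there is a formula $\varphi(x)$ with no other free variables such that $\mathcal F\vdash\exists X\,\forall x\,(x\in X\leftrightarrow\varphi(x))$ and $\varphi$ defines $A$ in every $\omega$-model of $\mathcal F$. A real belongs to $\mathrm{Def}(\mathcal F)$ if the binary expansion of its fractional part does. A set $S\subseteq\mathbb R$ is computably enumerable within $\mathcal F$ if $S=\{r_i: i\in\mathbb N\}$ for some sequence of reals and some $q:\mathbb N^2\to\mathbb Q$ with $|r_i-q(i,k)|\le 2^{-k}$ for all $i,k$, such that the (coded) graph of $q$ is in $\mathrm{Def}(\mathcal F)$. A set $S\subseteq\mathbb R$ is fractally countable relative to $\mathcal F_0$, through systems $(\mathcal F_n)_{n\in\mathbb N}$ beginning with $\mathcal F_0$ and sets $(S_n)_{n\in\mathbb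 N}$ of reals, if: each $\mathcal F_{n+1}$ extends $\mathcal F_n$ and is conservative over it for arithmetical sentences; $S_n$ is the set of reals in $\mathrm{Def}(\mathcal F_n)$ and is countable; $S=\bigcup_n S_n$; for no $k$ do all elements of $S$ belong to $\mathrm{Def}(\mathcal F_k)$; for no $k$ is $S$ computably enumerable within $\mathcal F_k$; and each $\mathcal F_n$ has a recursively enumerable set of axioms and does not prove the $\Pi^1_1$ comprehension scheme. **Theorem.** Let $\mathcal F_0=\mathrm{RCA}_0$. There are systems $(\mathcal F_n)_{n\in\mathbb N}$ beginning with $\mathcal F_0$ and a set $S^\infty=\bigcup_n S_n\subseteq\mathbb R$, where $S_n$ is the set of reals whose binary expansion is recursive in the $n$-th Turing jump $\emptyset^{(n)}$, such that $S^\infty$ is fractally countable relative to $\mathcal F_0$ through $(\mathcal F_n)$ and $(S_n)$, and $S^\infty$ is not computably enumerable within any finite stage $\mathcal F_k$, nor within the union $\mathcal F_\omega=\bigcup_{n<\omega}\mathcal F_n$. -/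

import Mathlib

/-! ### Relative computability and the Turing jump -/

namespace Frac

open Classical in
/-- The characteristic function of a set of natural numbers, as an oracle. -/
noncomputable def charFun (A : Set ℕ) : ℕ →. ℕ :=
  fun n => Part.some (if n ∈ A then 1 else 0)

/-- `A` is recursive in (Turing reducible to) `B`. -/
def RecIn (A B : Set ℕ) : Prop := Nat.RecursiveIn {charFun B} (charFun A)

/-- Programs with an oracle. -/
inductive OCode : Type
  | zero : OCode
  | succ : OCode
  | left : OCode
  | right : OCode
  | oracle : OCode
  | pair : OCode → OCode → OCode
  | comp : OCode → OCode → OCode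
  | prec : OCode → OCode → OCode
  | rfind : OCode → OCode

namespace OCode

/-- The index of a program. -/
def index : OCode → ℕ
  | zero => 0
  | succ => 1
  | left => 2
  | right => 3
  | oracle => 4
  | pair c d => 4 * Nat.pair c.index d.index + 5
  | comp c d => 4 * Nat.pair c.index d.index + 6
  | prec c d => 4 * Nat.pair c.index d.index + 7
  | rfind c => 4 * c.index + 8

/-- The partial function computed by a program with oracle `A`. -/
noncomputable def eval (A : Set ℕ) : OCode → ℕ →. ℕ
  | zero => fun _ => Part.some 0
  | succ => fun n => Part.some (n + 1)
  | left => fun n => Part.some (Nat.unpair n).1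
  | right => fun n => Part.some (Nat.unpair n).2
  | oracle => charFun A
  | pair c d => fun n => Nat.pair <$> eval A c n <*> eval A d n
  | comp c d => fun n => eval A d n >>= eval A c
  | prec c d => fun p =>
      let (a, n) := Nat.unpair p
      n.rec (eval A c a) fun y IH => do
        let i ← IH
        eval A d (Nat.pair a (Nat.pair y i))
  | rfind c => fun a => Nat.rfind fun n => (fun m => m = 0) <$> eval A c (Nat.pair a n)

theorem index_injective : Function.Injective index := by
  intro c
  induction c with
  | pair a b iha ihb =>
    intro d h
    cases d <;> simp only [index] at h <;> first | omega | skip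
    have h' := Nat.pair_eq_pair.1 (Nat.eq_of_mul_eq_mul_left (by norm_num) (Nat.add_right_cancel h))
    rw [iha h'.1, ihb h'.2]
  | comp a b iha ihb =>
    intro d h
    cases d <;> simp only [index] at h <;> first | omega | skip
    have h' := Nat.pair_eq_pair.1 (Nat.eq_of_mul_eq_mul_left (by norm_num) (Nat.add_right_cancel h))
    rw [iha h'.1, ihb h'.2]
  | prec a b iha ihb =>
    intro d h
    cases d <;> simp only [index] at h <;> first | omega | skip
    have h' := Nat.pair_eq_pair.1 (Nat.eq_of_mul_eq_mul_left (by norm_num) (Nat.add_right_cancel h))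
    rw [iha h'.1, ihb h'.2]
  | rfind a iha =>
    intro d h
    cases d <;> simp only [index] at h <;> first | omega | skip
    rw [iha (Nat.eq_of_mul_eq_mul_left (by norm_num) (Nat.add_right_cancel h))]
  | _ =>
    intro d h
    cases d <;> simp only [index] at h <;> first | omega | rfl

/-- The programs with oracle `A` compute exactly the partial functions recursive in `A`. -/
theorem exists_eval_iff (A : Set ℕ) (f : ℕ →. ℕ) :
    (∃ c : OCode, c.eval A = f) ↔ Nat.RecursiveIn {charFun A} f := by
  constructor
  · rintro ⟨c, rfl⟩
    induction c with
    | zero => exact .zero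
    | succ => exact .succ
    | left => exact .left
    | right => exact .right
    | oracle => exact .oracle _ rfl
    | pair _ _ h k => exact .pair h k
    | comp _ _ h k => exact .comp h k
    | prec _ _ h k => exact .prec h k
    | rfind _ h => exact .rfind h
  · intro h
    induction h with
    | zero => exact ⟨.zero, rfl⟩
    | succ => exact ⟨.succ, rfl⟩
    | left => exact ⟨.left, rfl⟩
    | right => exact ⟨.right, rfl⟩
    | oracle g hg => exact ⟨.oracle, hg.symm⟩
    | pair _ _ h k =>
      obtain ⟨c, rfl⟩ := h
      obtain ⟨d, rfl⟩ := k
      exact ⟨.pair c d, rfl⟩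
    | comp _ _ h k =>
      obtain ⟨c, rfl⟩ := h
      obtain ⟨d, rfl⟩ := k
      exact ⟨.comp c d, rfl⟩
    | prec _ _ h k =>
      obtain ⟨c, rfl⟩ := h
      obtain ⟨d, rfl⟩ := k
      exact ⟨.prec c d, rfl⟩
    | rfind _ h =>
      obtain ⟨c, rfl⟩ := h
      exact ⟨.rfind c, rfl⟩

end OCode

/-- The Turing jump of `A`: the indices of the programs that halt on their own index. -/
def jump (A : Set ℕ) : Set ℕ := {e | ∃ c : OCode, c.index = e ∧ (c.eval A e).Dom}

/-- The `n`-th Turing jump of the empty set. -/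
def emptyJump : ℕ → Set ℕ
  | 0 => ∅
  | n + 1 => jump (emptyJump n)

/-- The binary expansion of the fractional part of `x`, as the set of the positions of its
ones: position `n` carries the digit of weight `2 ^ (-(n + 1))`. -/
def binaryExpansion (x : ℝ) : Set ℕ := {n | Odd ⌊x * 2 ^ (n + 1)⌋}

/-- The reals whose binary expansion is recursive in the `n`-th Turing jump of `∅`. -/
def realsRecInJump (n : ℕ) : Set ℝ := {x | RecIn (binaryExpansion x) (emptyJump n)}

/-! ### The language of second-order arithmetic -/

/-- Number terms; `var i` is the `i`-th number variable. -/
inductive Term : Type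
  | zero : Term
  | one : Term
  | var : ℕ → Term
  | add : Term → Term → Term
  | mul : Term → Term → Term

/-- Formulas. Number variables and set variables are both named by natural numbers;
`mem t X` says that `t` belongs to the `X`-th set variable. -/
inductive Formula : Type
  | fls : Formula
  | eq : Term → Term → Formula
  | lt : Term → Term → Formula
  | mem : Term → ℕ → Formula
  | imp : Formula → Formula → Formula
  | allNum : ℕ → Formula → Formula
  | allSet : ℕ → Formula → Formula

namespace Term

/-- The number variables of a term. -/
def vars : Term → Finset ℕ
  | zero => ∅
  | one => ∅
  | var i => {i}
  | add t s => t.vars ∪ s.vars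
  | mul t s => t.vars ∪ s.vars

/-- Gödel numbers of terms. -/
def code : Term → ℕ
  | zero => 0
  | one => 1
  | var i => 3 * i + 2
  | add t s => 3 * Nat.pair t.code s.code + 3
  | mul t s => 3 * Nat.pair t.code s.code + 4

theorem code_injective : Function.Injective code := by
  intro t
  induction t with
  | add a b iha ihb =>
    intro d h
    cases d <;> simp only [code] at h <;> first | omega | skip
    have h' := Nat.pair_eq_pair.1 (Nat.eq_of_mul_eq_mul_left (by norm_num) (Nat.add_right_cancel h))
    rw [iha h'.1, ihb h'.2]
  | mul a b iha ihb =>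
    intro d h
    cases d <;> simp only [code] at h <;> first | omega | skip
    have h' := Nat.pair_eq_pair.1 (Nat.eq_of_mul_eq_mul_left (by norm_num) (Nat.add_right_cancel h))
    rw [iha h'.1, ihb h'.2]
  | _ =>
    intro d h
    cases d <;> simp only [code] at h <;> first | omega | rfl | (congr 1; omega)

end Term

namespace Formula

/-- Negation. -/
def neg (φ : Formula) : Formula := imp φ fls

/-- Conjunction. -/
def and (φ ψ : Formula) : Formula := neg (imp φ (neg ψ))

/-- Disjunction. -/
def or (φ ψ : Formula) : Formula := imp (neg φ) ψ

/-- Equivalence. -/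
def iff (φ ψ : Formula) : Formula := and (imp φ ψ) (imp ψ φ)

/-- Existential number quantifier. -/
def exNum (x : ℕ) (φ : Formula) : Formula := neg (allNum x (neg φ))

/-- Existential set quantifier. -/
def exSet (X : ℕ) (φ : Formula) : Formula := neg (allSet X (neg φ))

/-- The free number variables of a formula. -/
def freeNum : Formula → Finset ℕ
  | fls => ∅
  | eq t s => t.vars ∪ s.vars
  | lt t s => t.vars ∪ s.vars
  | mem t _ => t.vars
  | imp φ ψ => φ.freeNum ∪ ψ.freeNum
  | allNum x φ => φ.freeNum.erase x
  | allSet _ φ => φ.freeNum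

/-- The free set variables of a formula. -/
def freeSet : Formula → Finset ℕ
  | fls => ∅
  | eq _ _ => ∅
  | lt _ _ => ∅
  | mem _ X => {X}
  | imp φ ψ => φ.freeSet ∪ ψ.freeSet
  | allNum _ φ => φ.freeSet
  | allSet X φ => φ.freeSet.erase X

/-- Gödel numbers of formulas. -/
def code : Formula → ℕ
  | fls => 0
  | eq t s => 6 * Nat.pair t.code s.code + 1
  | lt t s => 6 * Nat.pair t.code s.code + 2
  | mem t X => 6 * Nat.pair t.code X + 3
  | imp φ ψ => 6 * Nat.pair φ.code ψ.code + 4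
  | allNum x φ => 6 * Nat.pair x φ.code + 5
  | allSet X φ => 6 * Nat.pair X φ.code + 6

theorem code_injective : Function.Injective code := by
  intro φ
  induction φ with
  | fls =>
    intro d h
    cases d <;> simp only [code] at h <;> first | omega | rfl
  | eq a b =>
    intro d h
    cases d <;> simp only [code] at h <;> first | omega | skip
    have h' := Nat.pair_eq_pair.1 (Nat.eq_of_mul_eq_mul_left (by norm_num) (Nat.add_right_cancel h))
    rw [Term.code_injective h'.1, Term.code_injective h'.2]
  | lt a b =>
    intro d h
    cases d <;> simp only [code] at h <;> first | omega | skip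
    have h' := Nat.pair_eq_pair.1 (Nat.eq_of_mul_eq_mul_left (by norm_num) (Nat.add_right_cancel h))
    rw [Term.code_injective h'.1, Term.code_injective h'.2]
  | mem a b =>
    intro d h
    cases d <;> simp only [code] at h <;> first | omega | skip
    have h' := Nat.pair_eq_pair.1 (Nat.eq_of_mul_eq_mul_left (by norm_num) (Nat.add_right_cancel h))
    rw [Term.code_injective h'.1, h'.2]
  | imp a b iha ihb =>
    intro d h
    cases d <;> simp only [code] at h <;> first | omega | skip
    have h' := Nat.pair_eq_pair.1 (Nat.eq_of_mul_eq_mul_left (by norm_num) (Nat.add_right_cancel h))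
    rw [iha h'.1, ihb h'.2]
  | allNum a b ihb =>
    intro d h
    cases d <;> simp only [code] at h <;> first | omega | skip
    have h' := Nat.pair_eq_pair.1 (Nat.eq_of_mul_eq_mul_left (by norm_num) (Nat.add_right_cancel h))
    rw [h'.1, ihb h'.2]
  | allSet a b ihb =>
    intro d h
    cases d <;> simp only [code] at h <;> first | omega | skip
    have h' := Nat.pair_eq_pair.1 (Nat.eq_of_mul_eq_mul_left (by norm_num) (Nat.add_right_cancel h))
    rw [h'.1, ihb h'.2]

/-- Formulas without set quantifiers. -/
def NoSetQuant : Formula → Prop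
  | fls => True
  | eq _ _ => True
  | lt _ _ => True
  | mem _ _ => True
  | imp φ ψ => φ.NoSetQuant ∧ ψ.NoSetQuant
  | allNum _ φ => φ.NoSetQuant
  | allSet _ _ => False

/-- Arithmetical sentences: no set quantifiers and no free variables of either sort. -/
def IsArithSentence (φ : Formula) : Prop :=
  φ.NoSetQuant ∧ φ.freeNum = ∅ ∧ φ.freeSet = ∅

/-- Bounded quantifier formulas: all quantifiers are of the form `∀ x (x < t → ⬝)` (or, through
negation, `∃ x (x < t ∧ ⬝)`) with a term `t` that does not contain `x`. -/
inductive IsBounded : Formula → Prop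
  | fls : IsBounded fls
  | eq (t s : Term) : IsBounded (eq t s)
  | lt (t s : Term) : IsBounded (lt t s)
  | mem (t : Term) (X : ℕ) : IsBounded (mem t X)
  | imp {φ ψ : Formula} : IsBounded φ → IsBounded ψ → IsBounded (imp φ ψ)
  | ball {x : ℕ} {t : Term} {φ : Formula} : x ∉ t.vars → IsBounded φ →
      IsBounded (allNum x (imp (lt (.var x) t) φ))

/-- `Σ⁰₁` formulas (number and set parameters allowed). -/
def IsSigma01 (φ : Formula) : Prop := ∃ x θ, IsBounded θ ∧ φ = exNum x θ

/-- `Π⁰₁` formulas (number and set parameters allowed). -/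
def IsPi01 (φ : Formula) : Prop := ∃ x θ, IsBounded θ ∧ φ = allNum x θ

/-- `Π¹₁` formulas (number and set parameters allowed). -/
def IsPi11 (φ : Formula) : Prop := ∃ X θ, NoSetQuant θ ∧ φ = allSet X θ

/-- `∃ X ∀ x (x ∈ X ↔ φ(x))`. -/
def comprehension (x X : ℕ) (φ : Formula) : Formula :=
  exSet X (allNum x (iff (mem (.var x) X) φ))

/-- `(φ(0) ∧ ∀ x (φ(x) → φ(x + 1))) → ∀ x φ(x)`, where `φ(0)` is written `∀ x (x = 0 → φ(x))`
and `φ(x + 1)` is written `∀ y (y = x + 1 → ∀ x (x = y → φ(x)))`, for `y` different from `x` and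
not free in `φ`. -/
def induction (x y : ℕ) (φ : Formula) : Formula :=
  imp
    (and (allNum x (imp (eq (.var x) .zero) φ))
      (allNum x (imp φ (allNum y (imp (eq (.var y) (.add (.var x) .one))
        (allNum x (imp (eq (.var x) (.var y)) φ)))))))
    (allNum x φ)

end Formula

/-! ### Structures and consequence -/

/-- A (Henkin) structure for second-order arithmetic: set variables range over a nonempty family
of subsets of the number domain. -/
structure Model2 where
  Num : Type
  zero : Num
  one : Num
  add : Num → Num → Num
  mul : Num → Num → Num
  lt : Num → Num → Prop
  sets : Set (Set Num)
  sets_nonempty : sets.Nonempty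

/-- The value of a term. -/
def Term.val (M : Model2) (v : ℕ → M.Num) : Term → M.Num
  | .zero => M.zero
  | .one => M.one
  | .var i => v i
  | .add t s => M.add (t.val M v) (s.val M v)
  | .mul t s => M.mul (t.val M v) (s.val M v)

/-- Satisfaction of a formula under an assignment `v` of numbers and `V` of sets. -/
def Formula.Sat (M : Model2) : (ℕ → M.Num) → (ℕ → Set M.Num) → Formula → Prop
  | _, _, .fls => False
  | v, _, .eq t s => t.val M v = s.val M v
  | v, _, .lt t s => M.lt (t.val M v) (s.val M v)
  | v, V, .mem t X => t.val M v ∈ V X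
  | v, V, .imp φ ψ => φ.Sat M v V → ψ.Sat M v V
  | v, V, .allNum x φ => ∀ a : M.Num, φ.Sat M (Function.update v x a) V
  | v, V, .allSet X φ => ∀ A ∈ M.sets, φ.Sat M v (Function.update V X A)

/-- `φ` is true in `M`, free variables being read as universally quantified. -/
def Formula.True (M : Model2) (φ : Formula) : Prop :=
  ∀ (v : ℕ → M.Num) (V : ℕ → Set M.Num), (∀ X, V X ∈ M.sets) → φ.Sat M v V

/-- A theory: the set of its axioms, free variables being read as universally quantified. -/
abbrev Theory2 := Set Formula

/-- `M` is a model of `T`. -/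
def Theory2.HasModel (T : Theory2) (M : Model2) : Prop := ∀ φ ∈ T, φ.True M

/-- `φ` is a theorem of `T`: it is a logical consequence of the axioms. By the completeness
theorem this is derivability in two-sorted first-order logic. -/
def Theory2.Proves (T : Theory2) (φ : Formula) : Prop :=
  ∀ M : Model2, T.HasModel M → φ.True M

/-- The `ω`-structure with set part `𝒮`. -/
abbrev omegaModel (𝒮 : Set (Set ℕ)) (h : 𝒮.Nonempty) : Model2 where
  Num := ℕ
  zero := 0
  one := 1
  add := (· + ·)
  mul := (· * ·)
  lt := (· < ·)
  sets := 𝒮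
  sets_nonempty := h

/-- `T` is recursively axiomatized: its set of axioms is recursively enumerable. -/
def Theory2.IsRE (T : Theory2) : Prop := REPred fun n : ℕ => ∃ φ ∈ T, φ.code = n

/-! ### The system `RCA₀` -/

open Formula Term in
/-- The basic axioms of arithmetic. -/
def basicAxioms : Theory2 :=
  {neg (eq (add (var 0) one) zero),
   imp (eq (add (var 0) one) (add (var 1) one)) (eq (var 0) (var 1)),
   eq (add (var 0) zero) (var 0),
   eq (add (var 0) (add (var 1) one)) (add (add (var 0) (var 1)) one),
   eq (mul (var 0) zero) zero,
   eq (mul (var 0) (add (var 1) one)) (add (mul (var 0) (var 1)) (var 0)),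
   neg (lt (var 0) zero),
   iff (lt (var 0) (add (var 1) one)) (or (lt (var 0) (var 1)) (eq (var 0) (var 1)))}

/-- `Σ⁰₁` induction. -/
def sigma01Induction : Theory2 :=
  {χ | ∃ x y φ, Formula.IsSigma01 φ ∧ y ≠ x ∧ y ∉ φ.freeNum ∧ χ = Formula.induction x y φ}

/-- `Δ⁰₁` comprehension. -/
def delta01Comprehension : Theory2 :=
  {χ | ∃ x X φ ψ, Formula.IsSigma01 φ ∧ Formula.IsPi01 ψ ∧ X ∉ φ.freeSet ∧
    χ = .imp (.allNum x (Formula.iff φ ψ)) (Formula.comprehension x X φ)}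

/-- The system `RCA₀`. -/
def RCA0 : Theory2 := basicAxioms ∪ sigma01Induction ∪ delta01Comprehension

/-- The `Π¹₁` comprehension scheme. -/
def pi11Comprehension : Theory2 :=
  {χ | ∃ x X φ, Formula.IsPi11 φ ∧ X ∉ φ.freeSet ∧ χ = Formula.comprehension x X φ}

/-! ### Definability and enumerability within a system -/

/-- `Def(T)`: the sets `A` of natural numbers for which there is a formula `φ(x)` without
further free variables such that `T` proves that the set `{x | φ(x)}` exists, and `φ` defines
`A` in every `ω`-model of `T`. -/
def Theory2.DefSets (T : Theory2) : Set (Set ℕ) :=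
  {A | ∃ (x X : ℕ) (φ : Formula), φ.freeNum ⊆ {x} ∧ φ.freeSet = ∅ ∧
    T.Proves (φ.comprehension x X) ∧
    ∀ (𝒮 : Set (Set ℕ)) (h : 𝒮.Nonempty), T.HasModel (omegaModel 𝒮 h) →
      ∀ (v : ℕ → ℕ) (V : ℕ → Set ℕ), (∀ Y, V Y ∈ 𝒮) →
        ∀ n : ℕ, n ∈ A ↔ φ.Sat (omegaModel 𝒮 h) (Function.update v x n) V}

/-- The reals definable in `T`: those whose binary expansion is in `Def(T)`. -/
def Theory2.DefReals (T : Theory2) : Set ℝ := {x | binaryExpansion x ∈ T.DefSets}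

/-- The rational number coded by `m`; every rational has a code. -/
def ratOfCode (m : ℕ) : ℚ :=
  ((m.unpair.1 : ℚ) - m.unpair.2.unpair.1) / (m.unpair.2.unpair.2 + 1)

/-- `S` is enumerable within `T`: it is the range of a sequence of reals `r 0, r 1, …` which is
given, uniformly, by rapidly converging sequences of (codes of) rational approximations `g i k`,
the graph of `g` being a set in `Def(T)`. -/
def Theory2.Enumerates (T : Theory2) (S : Set ℝ) : Prop :=
  ∃ (r : ℕ → ℝ) (g : ℕ → ℕ → ℕ),
    (∀ i k, |r i - (ratOfCode (g i k) : ℝ)| ≤ (1 / 2) ^ k) ∧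
    {m | ∃ i k, m = Nat.pair (Nat.pair i k) (g i k)} ∈ T.DefSets ∧
    Set.range r = S

/-- `T'` extends `T` and is conservative over `T` for arithmetical sentences. -/
def Theory2.IsArithConservativeExt (T T' : Theory2) : Prop :=
  T ⊆ T' ∧ ∀ σ : Formula, σ.IsArithSentence → T'.Proves σ → T.Proves σ

/-- `T` is constructive: it is recursively axiomatized, and it does not prove all
instances of `Π¹₁` comprehension (hence not full second-order comprehension either). -/
def Theory2.IsConstructive (T : Theory2) : Prop :=
  T.IsRE ∧ ¬ ∀ χ ∈ pi11Comprehension, T.Proves χ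

/-- `S` is fractally countable relative to `F₀`, through the systems `F n` and the stages
`Sₙ = St n`. -/
structure IsFractallyCountableVia (F₀ : Theory2) (F : ℕ → Theory2) (St : ℕ → Set ℝ)
    (S : Set ℝ) : Prop where
  base : F 0 = F₀
  conservative : ∀ n, (F n).IsArithConservativeExt (F (n + 1))
  stage : ∀ n, St n = (F n).DefReals
  stage_countable : ∀ n, (St n).Countable
  union : S = ⋃ n, St n
  not_definable : ∀ k, ¬ S ⊆ (F k).DefReals
  not_enumerable : ∀ k, ¬ (F k).Enumerates S
  constructive : ∀ n, (F n).IsConstructive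

end Frac

/-!
The systems are obtained from `RCA₀` by adding axioms for the existence of the Turing jumps of the
empty set, but only under a hypothesis which makes the additions conservative. A structure is called
good (`Model2.Good`) if it satisfies finitely many conditions, all of them true in every
`ω`-structure: facts about order and pairing, a bounding principle for convergent approximations,
and an induction principle for limits. Goodness is expressed by a sentence, and the `i`-th new axiom
(`jumpAxiom`) says that if the structure is good, then the `i`-th jump of the empty set exists;
`system J n` is `RCA₀` with the axioms for the jumps `1, …, n`.

*Conservativity* (`system_conservative`). A model that is not good satisfies all the new axioms. To
the sets of a good model `M` of `RCA₀` one adds all limits of approximations `Z ∈ M.sets`, which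
changes neither the numbers nor the truth of arithmetical sentences. The result is a model of
`RCA₀` (`limModel_RCA0`): the truth of a bounded formula at limit sets is the limit of its truth
along the stages (`sat_stage`), which yields `Σ⁰₁` induction, and a `Δ⁰₁` definition is turned into
one convergent approximation by asking which of the witness and the refutation comes first. Since a
`Σ⁰₁` set of `M` is a limit (`sigma01_mem_limSets`), the next jump exists in the new model.

*Definable sets* (`defSets_system`). All `ω`-structures are good, so the `ω`-models of `system J n`
are the `ω`-models of `RCA₀` that contain the first `n` jumps. The sets recursive in the `n`-th jump
form one of these (`system_hasModel_jumpIdeal`), hence contain all sets definable within the system.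
Conversely, one formula defines the `n`-th jump implicitly in all of them, and the same holds for
each set recursive in it (`mem_defSets_of_recIn`). This requires one `Σ⁰₁` formula that defines the jump in
all `ω`-structures (`exists_isJumpFormula`), which is Kleene's normal form: a program has a value
if there is a finite derivation of that value (`mem_eval_iff_run`), and finite sets are coded by
divisibility. The same `ω`-model omits the next jump, so that `Π¹₁` comprehension is not
provable (`system_not_pi11`).

*Reals*. Bits placed at the even positions of a binary expansion, with zeros in between, determine
a real without ambiguity (`exists_real_of_bits`). With the bits of the next jump this gives a real
outside a given stage. An enumeration of reals by approximations with an arithmetical graph is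
diagonalized by a real whose bits are computed from that graph (`exists_real_not_mem_range`), and
this real belongs to the stage of the oracle that computes the graph. The arithmetical sets form an
`ω`-model of the union of the systems, so that the same argument covers the union.
-/

namespace Frac

/-! ### Satisfaction and free variables -/

namespace Formula

variable {M : Model2} {v v' : ℕ → M.Num} {V V' : ℕ → Set M.Num}

@[simp] theorem sat_fls : fls.Sat M v V ↔ False := Iff.rfl

@[simp] theorem sat_eq {t s : Term} : (eq t s).Sat M v V ↔ t.val M v = s.val M v := Iff.rfl

@[simp] theorem sat_lt {t s : Term} : (lt t s).Sat M v V ↔ M.lt (t.val M v) (s.val M v) := Iff.rfl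

@[simp] theorem sat_mem {t : Term} {X : ℕ} : (mem t X).Sat M v V ↔ t.val M v ∈ V X := Iff.rfl

@[simp] theorem sat_imp {φ ψ : Formula} :
    (imp φ ψ).Sat M v V ↔ (φ.Sat M v V → ψ.Sat M v V) := Iff.rfl

@[simp] theorem sat_allNum {x : ℕ} {φ : Formula} :
    (allNum x φ).Sat M v V ↔ ∀ a, φ.Sat M (Function.update v x a) V := Iff.rfl

@[simp] theorem sat_allSet {X : ℕ} {φ : Formula} :
    (allSet X φ).Sat M v V ↔ ∀ A ∈ M.sets, φ.Sat M v (Function.update V X A) := Iff.rfl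

@[simp] theorem sat_neg {φ : Formula} : (neg φ).Sat M v V ↔ ¬ φ.Sat M v V := Iff.rfl

@[simp] theorem sat_and {φ ψ : Formula} :
    (and φ ψ).Sat M v V ↔ φ.Sat M v V ∧ ψ.Sat M v V := by
  simp [and]

@[simp] theorem sat_or {φ ψ : Formula} :
    (or φ ψ).Sat M v V ↔ φ.Sat M v V ∨ ψ.Sat M v V := by
  simp only [or, sat_imp, sat_neg]; tauto

@[simp] theorem sat_iff {φ ψ : Formula} :
    (iff φ ψ).Sat M v V ↔ (φ.Sat M v V ↔ ψ.Sat M v V) := by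
  simp only [iff, sat_and, sat_imp]; tauto

@[simp] theorem sat_exNum {x : ℕ} {φ : Formula} :
    (exNum x φ).Sat M v V ↔ ∃ a, φ.Sat M (Function.update v x a) V := by
  simp [exNum]

@[simp] theorem sat_exSet {X : ℕ} {φ : Formula} :
    (exSet X φ).Sat M v V ↔ ∃ A ∈ M.sets, φ.Sat M v (Function.update V X A) := by
  simp [exSet]

theorem sat_comprehension {x X : ℕ} {φ : Formula} :
    (φ.comprehension x X).Sat M v V ↔ ∃ A ∈ M.sets, ∀ a,
      a ∈ A ↔ φ.Sat M (Function.update v x a) (Function.update V X A) := by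
  simp [comprehension, Term.val]

end Formula

theorem Term.val_congr {M : Model2} {v v' : ℕ → M.Num} {t : Term}
    (h : ∀ i ∈ t.vars, v i = v' i) : t.val M v = t.val M v' := by
  induction t with
  | zero => rfl
  | one => rfl
  | var i => exact h i (by simp [Term.vars])
  | add t s iht ihs =>
    simp only [Term.vars, Finset.mem_union] at h
    simp only [Term.val]
    rw [iht fun i hi => h i (.inl hi), ihs fun i hi => h i (.inr hi)]
  | mul t s iht ihs =>
    simp only [Term.vars, Finset.mem_union] at h
    simp only [Term.val]
    rw [iht fun i hi => h i (.inl hi), ihs fun i hi => h i (.inr hi)]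

theorem Term.val_update {M : Model2} {v : ℕ → M.Num} {t : Term} {x : ℕ} (h : x ∉ t.vars)
    (a : M.Num) : t.val M (Function.update v x a) = t.val M v :=
  Term.val_congr fun i hi => Function.update_of_ne (by rintro rfl; exact h hi) _ _

theorem Formula.sat_congr {M : Model2} {φ : Formula} {v v' : ℕ → M.Num} {V V' : ℕ → Set M.Num}
    (h : ∀ i ∈ φ.freeNum, v i = v' i) (H : ∀ X ∈ φ.freeSet, V X = V' X) :
    φ.Sat M v V ↔ φ.Sat M v' V' := by
  induction φ generalizing v v' V V' with
  | fls => rfl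
  | eq t s =>
    simp only [freeNum, Finset.mem_union] at h
    simp only [sat_eq]
    rw [Term.val_congr fun i hi => h i (.inl hi), Term.val_congr fun i hi => h i (.inr hi)]
  | lt t s =>
    simp only [freeNum, Finset.mem_union] at h
    simp only [sat_lt]
    rw [Term.val_congr fun i hi => h i (.inl hi), Term.val_congr fun i hi => h i (.inr hi)]
  | mem t X =>
    simp only [sat_mem]
    rw [Term.val_congr h, H X (by simp [freeSet])]
  | imp φ ψ ihφ ihψ =>
    simp only [freeNum, freeSet, Finset.mem_union] at h H
    simp only [sat_imp]
    rw [ihφ (fun i hi => h i (.inl hi)) (fun i hi => H i (.inl hi)),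
      ihψ (fun i hi => h i (.inr hi)) (fun i hi => H i (.inr hi))]
  | allNum x φ ih =>
    simp only [freeNum, freeSet, Finset.mem_erase] at h H
    refine forall_congr' fun a => ih (fun i hi => ?_) H
    by_cases hx : i = x
    · subst hx; simp
    · simpa [hx] using h i ⟨hx, hi⟩
  | allSet X φ ih =>
    simp only [freeNum, freeSet, Finset.mem_erase] at h H
    refine forall₂_congr fun A _ => ih h (fun i hi => ?_)
    by_cases hx : i = X
    · subst hx; simp
    · simpa [hx] using H i ⟨hx, hi⟩

theorem Formula.sat_update {M : Model2} {φ : Formula} {v : ℕ → M.Num} {V : ℕ → Set M.Num} {x : ℕ}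
    (h : x ∉ φ.freeNum) (a : M.Num) :
    φ.Sat M (Function.update v x a) V ↔ φ.Sat M v V :=
  sat_congr (fun i hi => Function.update_of_ne (by rintro rfl; exact h hi) _ _) fun _ _ => rfl

theorem Formula.sat_updateSet {M : Model2} {φ : Formula} {v : ℕ → M.Num} {V : ℕ → Set M.Num}
    {X : ℕ} (h : X ∉ φ.freeSet) (A : Set M.Num) :
    φ.Sat M v (Function.update V X A) ↔ φ.Sat M v V :=
  sat_congr (fun _ _ => rfl)
    fun i hi => Function.update_of_ne (by rintro rfl; exact h hi) _ _

/-- The structure with the same numbers as `M` and the family `𝒮` of sets. -/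
abbrev Model2.withSets (M : Model2) (𝒮 : Set (Set M.Num)) (h : 𝒮.Nonempty) : Model2 :=
  { M with sets := 𝒮, sets_nonempty := h }

theorem Term.val_withSets {M : Model2} {𝒮 : Set (Set M.Num)} {h : 𝒮.Nonempty} (t : Term)
    (v : ℕ → M.Num) : t.val (M.withSets 𝒮 h) v = t.val M v := by
  induction t with
  | zero => rfl
  | one => rfl
  | var i => rfl
  | add t s iht ihs => simp only [Term.val, iht, ihs]
  | mul t s iht ihs => simp only [Term.val, iht, ihs]

/-- The truth of a formula without set quantifiers depends only on the number part. -/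
theorem Formula.NoSetQuant.sat_withSets {M : Model2} {𝒮 : Set (Set M.Num)} {h : 𝒮.Nonempty}
    {φ : Formula} (hφ : φ.NoSetQuant) (v : ℕ → M.Num) (V : ℕ → Set M.Num) :
    φ.Sat (M.withSets 𝒮 h) v V ↔ φ.Sat M v V := by
  induction φ generalizing v V with
  | fls => rfl
  | eq t s => simp only [sat_eq, Term.val_withSets]
  | lt t s => simp only [sat_lt, Term.val_withSets]
  | mem t X => simp only [sat_mem, Term.val_withSets]
  | imp φ ψ ihφ ihψ => simp only [sat_imp, ihφ hφ.1, ihψ hφ.2]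
  | allNum x φ ih => exact forall_congr' fun a => ih hφ _ _
  | allSet => exact hφ.elim

theorem Formula.IsBounded.noSetQuant {φ : Formula} (h : φ.IsBounded) : φ.NoSetQuant := by
  induction h with
  | imp _ _ h1 h2 => exact ⟨h1, h2⟩
  | ball _ _ h => exact ⟨trivial, h⟩
  | _ => trivial

namespace Formula.IsBounded

theorem neg {φ : Formula} (h : φ.IsBounded) : φ.neg.IsBounded := .imp h .fls

theorem and {φ ψ : Formula} (h : φ.IsBounded) (k : ψ.IsBounded) : (φ.and ψ).IsBounded :=
  neg (.imp h (neg k))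

end Formula.IsBounded

/-- A strict upper bound for the indices of all variables, free or bound, of a term. -/
def Term.bd : Term → ℕ
  | .zero => 0
  | .one => 0
  | .var i => i + 1
  | .add t s => max t.bd s.bd
  | .mul t s => max t.bd s.bd

/-- A strict upper bound for the indices of all variables, free or bound, of a formula. -/
def Formula.bd : Formula → ℕ
  | .fls => 0
  | .eq t s => max t.bd s.bd
  | .lt t s => max t.bd s.bd
  | .mem t X => max t.bd (X + 1)
  | .imp φ ψ => max φ.bd ψ.bd
  | .allNum x φ => max (x + 1) φ.bd
  | .allSet X φ => max (X + 1) φ.bd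

theorem Term.lt_bd {t : Term} {i : ℕ} (h : i ∈ t.vars) : i < t.bd := by
  induction t with
  | zero => simp [vars] at h
  | one => simp [vars] at h
  | var j => simp only [vars, Finset.mem_singleton] at h; simp [bd, h]
  | add t s iht ihs =>
    simp only [vars, Finset.mem_union] at h
    simp only [bd, lt_max_iff]; exact h.imp iht ihs
  | mul t s iht ihs =>
    simp only [vars, Finset.mem_union] at h
    simp only [bd, lt_max_iff]; exact h.imp iht ihs

theorem Formula.freeNum_lt_bd {φ : Formula} {i : ℕ} (h : i ∈ φ.freeNum) : i < φ.bd := by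
  induction φ with
  | fls => simp [freeNum] at h
  | eq t s =>
    simp only [freeNum, Finset.mem_union] at h
    simp only [bd, lt_max_iff]; exact h.imp Term.lt_bd Term.lt_bd
  | lt t s =>
    simp only [freeNum, Finset.mem_union] at h
    simp only [bd, lt_max_iff]; exact h.imp Term.lt_bd Term.lt_bd
  | mem t X => simp only [bd, lt_max_iff]; exact .inl (Term.lt_bd h)
  | imp φ ψ ihφ ihψ =>
    simp only [freeNum, Finset.mem_union] at h
    simp only [bd, lt_max_iff]; exact h.imp ihφ ihψ
  | allNum x φ ih =>
    simp only [freeNum, Finset.mem_erase] at h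
    simp only [bd, lt_max_iff]; exact .inr (ih h.2)
  | allSet X φ ih => simp only [bd, lt_max_iff]; exact .inr (ih h)

theorem Formula.freeSet_lt_bd {φ : Formula} {i : ℕ} (h : i ∈ φ.freeSet) : i < φ.bd := by
  induction φ with
  | fls => simp [freeSet] at h
  | eq t s => simp [freeSet] at h
  | lt t s => simp [freeSet] at h
  | mem t X =>
    simp only [freeSet, Finset.mem_singleton] at h
    simp only [bd, lt_max_iff]; exact .inr (by omega)
  | imp φ ψ ihφ ihψ =>
    simp only [freeSet, Finset.mem_union] at h
    simp only [bd, lt_max_iff]; exact h.imp ihφ ihψ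
  | allNum x φ ih => simp only [bd, lt_max_iff]; exact .inr (ih h)
  | allSet X φ ih =>
    simp only [freeSet, Finset.mem_erase] at h
    simp only [bd, lt_max_iff]; exact .inr (ih h.2)

end Frac

namespace Frac

/-! ### Structures that admit limits -/

/-- The polynomial pairing `(t + s)² + t`; unlike Cantor's it is a term of the language. -/
def Term.pr (t s : Term) : Term := .add (.mul (.add t s) (.add t s)) t

/-- The value of the pairing term in a structure. -/
def Model2.pr (M : Model2) (a b : M.Num) : M.Num :=
  M.add (M.mul (M.add a b) (M.add a b)) a

/-- The regularity properties of a structure that make its family of limit sets a model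
of `RCA₀` again: elementary facts on order and pairing, uniform stabilization of bounded families
of convergent approximations, and induction for `∃ y ∃ s ∀ t > s, ⟨⟨x, y⟩, t⟩ ∈ Z`. They are
finitely many and hold in every `ω`-structure. -/
structure Model2.Good (M : Model2) : Prop where
  trans : ∀ a b c, M.lt a b → M.lt b c → M.lt a c
  trichotomy : ∀ a b, M.lt a b ∨ a = b ∨ M.lt b a
  lt_succ : ∀ a b, M.lt a (M.add b M.one) ↔ M.lt a b ∨ a = b
  pr_inj : ∀ a b c d, M.pr a b = M.pr c d → a = c ∧ b = d
  left_lt : ∀ a b, M.lt a (M.add (M.pr a b) M.one)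
  right_lt : ∀ a b, M.lt b (M.add (M.pr a b) M.one)
  stabilize : ∀ Z ∈ M.sets, ∀ b,
    (∀ a, M.lt a b → ∃ s, ∀ t, M.lt s t → (M.pr a t ∈ Z ↔ M.pr a s ∈ Z)) →
    ∃ c, ∀ a, M.lt a b → ∀ t, M.lt c t → (M.pr a t ∈ Z ↔ M.pr a c ∈ Z)
  induct : ∀ Z ∈ M.sets,
    (∃ y s, ∀ t, M.lt s t → M.pr (M.pr M.zero y) t ∈ Z) →
    (∀ x, (∃ y s, ∀ t, M.lt s t → M.pr (M.pr x y) t ∈ Z) →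
      ∃ y s, ∀ t, M.lt s t → M.pr (M.pr (M.add x M.one) y) t ∈ Z) →
    ∀ x, ∃ y s, ∀ t, M.lt s t → M.pr (M.pr x y) t ∈ Z

namespace Formula

/-- `∃ x (x < u + 1 ∧ φ)`, for number variables `x ≠ u`. -/
def bexLe (x u : ℕ) (φ : Formula) : Formula :=
  neg (allNum x (imp (lt (.var x) (.add (.var u) .one)) (neg φ)))

/-- `∀ x (x < u + 1 → φ)`, for number variables `x ≠ u`. -/
def ballLe (x u : ℕ) (φ : Formula) : Formula :=
  allNum x (imp (lt (.var x) (.add (.var u) .one)) φ)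

theorem IsBounded.bexLe {x u : ℕ} {φ : Formula} (hx : x ≠ u) (h : φ.IsBounded) :
    (φ.bexLe x u).IsBounded :=
  .neg (.ball (by simpa [Term.vars] using hx) h.neg)

theorem IsBounded.ballLe {x u : ℕ} {φ : Formula} (hx : x ≠ u) (h : φ.IsBounded) :
    (φ.ballLe x u).IsBounded :=
  .ball (by simpa [Term.vars] using hx) h

theorem sat_bexLe {M : Model2} {v : ℕ → M.Num} {V : ℕ → Set M.Num} {x u : ℕ} {φ : Formula}
    (hx : x ≠ u) : (φ.bexLe x u).Sat M v V ↔
      ∃ a, M.lt a (M.add (v u) M.one) ∧ φ.Sat M (Function.update v x a) V := by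
  simp [Formula.bexLe, Term.val, Function.update_of_ne hx.symm]

theorem sat_ballLe {M : Model2} {v : ℕ → M.Num} {V : ℕ → Set M.Num} {x u : ℕ} {φ : Formula}
    (hx : x ≠ u) : (φ.ballLe x u).Sat M v V ↔
      ∀ a, M.lt a (M.add (v u) M.one) → φ.Sat M (Function.update v x a) V := by
  simp [Formula.ballLe, Term.val, Function.update_of_ne hx.symm]

end Formula

open Formula

variable {M : Model2} {v : ℕ → M.Num} {V : ℕ → Set M.Num} {φ : Formula}

/-- `Δ⁰₁` comprehension for bounded formulas, with dummy unbounded quantifiers. -/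
theorem bounded_comprehension (hM : RCA0.HasModel M) (hV : ∀ X, V X ∈ M.sets)
    (hφ : φ.IsBounded) (v : ℕ → M.Num) (x : ℕ) :
    {a | φ.Sat M (Function.update v x a) V} ∈ M.sets := by
  have hw : φ.bd ∉ φ.freeNum := fun h => (freeNum_lt_bd h).ne rfl
  have hX : φ.bd ∉ φ.freeSet := fun h => (freeSet_lt_bd h).ne rfl
  have key := hM (.imp (.allNum x (Formula.iff (exNum φ.bd φ) (allNum φ.bd φ)))
    (Formula.comprehension x φ.bd (exNum φ.bd φ)))
    (.inr ⟨x, φ.bd, _, _, ⟨_, _, hφ, rfl⟩, ⟨_, _, hφ, rfl⟩, by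
      simpa [exNum, Formula.neg, freeSet] using hX, rfl⟩) v V hV
  simp only [sat_imp, sat_allNum, sat_iff, sat_comprehension, sat_exNum, sat_update hw,
    sat_updateSet hX] at key
  obtain ⟨A, hA, h⟩ := key fun a => ⟨fun ⟨_, h⟩ _ => h, fun h => ⟨M.zero, h M.zero⟩⟩
  convert hA
  ext a
  rw [h]
  exact ⟨fun h => ⟨M.zero, h⟩, fun ⟨_, h⟩ => h⟩

theorem exists_coded_pair (hG : M.Good) (hM : RCA0.HasModel M) (hV : ∀ X, V X ∈ M.sets)
    (hφ : φ.IsBounded) (v : ℕ → M.Num) {i j : ℕ} (hij : i ≠ j) :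
    ∃ Z ∈ M.sets, ∀ a b, M.pr a b ∈ Z ↔
      φ.Sat M (Function.update (Function.update v i a) j b) V := by
  set u := max φ.bd (max (i + 1) (j + 1)) with hu
  have hiu : i ≠ u := by omega
  have hju : j ≠ u := by omega
  have huφ : u ∉ φ.freeNum := fun h => by have := freeNum_lt_bd h; omega
  refine ⟨_, bounded_comprehension hM hV (φ := (((eq (.var u) (Term.pr (.var i) (.var j))).and
    φ).bexLe j u).bexLe i u) (.bexLe hiu (.bexLe hju (.and (.eq _ _) hφ))) v u, fun a b => ?_⟩
  simp only [Set.mem_ofPred_eq, sat_bexLe hiu, sat_bexLe hju, sat_and, sat_eq, Term.pr, Term.val,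
    Function.update_self, Function.update_of_ne hiu.symm, Function.update_of_ne hju.symm,
    Function.update_of_ne hij]
  have hupd : ∀ a' b' c, φ.Sat M (Function.update (Function.update (Function.update v u c) i a')
      j b') V ↔ φ.Sat M (Function.update (Function.update v i a') j b') V := fun a' b' c => by
    rw [Function.update_comm hiu.symm, Function.update_comm hju.symm, sat_update huφ]
  constructor
  · rintro ⟨a', -, b', -, h, h'⟩
    obtain ⟨rfl, rfl⟩ := hG.pr_inj _ _ _ _ h
    exact (hupd _ _ _).1 h'
  · intro h
    exact ⟨a, hG.left_lt a b, b, hG.right_lt a b, rfl, (hupd _ _ _).2 h⟩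

theorem Model2.Good.le_pr_left (hG : M.Good) {a b c : M.Num}
    (h : M.lt a (M.add b M.one)) : M.lt a (M.add (M.pr b c) M.one) := by
  rcases (hG.lt_succ _ _).1 h with h | rfl
  · exact hG.trans _ _ _ h (hG.left_lt _ _)
  · exact hG.left_lt _ _

theorem exists_coded_triple (hG : M.Good) (hM : RCA0.HasModel M) (hV : ∀ X, V X ∈ M.sets)
    (hφ : φ.IsBounded) (v : ℕ → M.Num) {x w t : ℕ} :
    ∃ Z ∈ M.sets, ∀ a b c, M.pr (M.pr a b) c ∈ Z ↔
      φ.Sat M (Function.update (Function.update (Function.update v t c) x a) w b) V := by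
  set u := max φ.bd (max (x + 1) (max (w + 1) (t + 1))) with hu
  -- `x` and `w` may coincide, so the components of the triple are first read into fresh variables.
  have hxp : x ≠ u + 1 := by omega
  have hwq : w ≠ u + 2 := by omega
  have hpu : u + 1 ≠ u := by omega
  have hqu : u + 2 ≠ u := by omega
  have htu : t ≠ u := by omega
  refine ⟨_, bounded_comprehension hM hV (φ := (((
    (eq (.var u) (Term.pr (Term.pr (.var (u + 1)) (.var (u + 2))) (.var t))).and
      (((eq (.var x) (.var (u + 1))).and
        (((eq (.var w) (.var (u + 2))).and φ).bexLe w (u + 2))).bexLe x (u + 1))).bexLe t u).bexLe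
      (u + 2) u).bexLe (u + 1) u)
    (.bexLe hpu (.bexLe hqu (.bexLe htu (.and (.eq _ _) (.bexLe hxp (.and (.eq _ _)
      (.bexLe hwq (.and (.eq _ _) hφ)))))))) v u, fun a b c => ?_⟩
  have e1 : u + 1 ≠ t := by omega
  have e2 : u + 2 ≠ t := by omega
  have e3 : u + 1 ≠ u + 2 := by omega
  have e4 : u + 2 ≠ x := by omega
  have e5 : u + 1 ≠ w := by omega
  simp only [Set.mem_ofPred_eq, sat_bexLe hpu, sat_bexLe hqu, sat_bexLe htu, sat_bexLe hxp,
    sat_bexLe hwq, sat_and, sat_eq, Term.pr, Term.val,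
    Function.update_self, Function.update_of_ne hpu.symm, Function.update_of_ne hqu.symm,
    Function.update_of_ne htu.symm, Function.update_of_ne e1, Function.update_of_ne e2,
    Function.update_of_ne e3, Function.update_of_ne e4, Function.update_of_ne hxp.symm,
    Function.update_of_ne hwq.symm]
  have hupd : ∀ d p q r,
      φ.Sat M (Function.update (Function.update (Function.update (Function.update (Function.update
        (Function.update v u d) (u + 1) p) (u + 2) q) t r) x p) w q) V ↔
      φ.Sat M (Function.update (Function.update (Function.update v t r) x p) w q) V := by
    intro d p q r
    refine sat_congr (fun i hi => ?_) fun _ _ => rfl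
    have := freeNum_lt_bd hi
    simp only [Function.update_apply]
    have h1 : i ≠ u := by omega
    have h2 : i ≠ u + 1 := by omega
    have h3 : i ≠ u + 2 := by omega
    simp only [h1, h2, h3, if_false]
  constructor
  · rintro ⟨a', -, b', -, c', -, h, _, -, rfl, _, -, rfl, h'⟩
    obtain ⟨h1, rfl⟩ := hG.pr_inj _ _ _ _ h
    obtain ⟨rfl, rfl⟩ := hG.pr_inj _ _ _ _ h1
    exact (hupd _ _ _ _).1 h'
  · intro h
    exact ⟨a, hG.le_pr_left (hG.left_lt a b), b, hG.le_pr_left (hG.right_lt a b), c,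
      hG.right_lt _ _, rfl, a, (hG.lt_succ _ _).2 (.inr rfl), rfl, b,
      (hG.lt_succ _ _).2 (.inr rfl), rfl, (hupd _ _ _ _).2 h⟩

/-! ### Adjoining the limits of all convergent approximations -/

/-- The columns of `Z` converge pointwise to `A`. -/
def Model2.Lim (M : Model2) (Z A : Set M.Num) : Prop :=
  ∀ x, ∃ s, ∀ t, M.lt s t → (M.pr x t ∈ Z ↔ x ∈ A)

/-- The sets that are limits of approximations belonging to `M`; by the limit lemma these are the
sets that are `Δ⁰₂` in the sets of `M`. -/
def Model2.limSets (M : Model2) : Set (Set M.Num) := {A | ∃ Z ∈ M.sets, M.Lim Z A}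

/-- The stage `t` of a formula: every set is replaced by its approximation at stage `t`. -/
def Formula.stage (t : ℕ) : Formula → Formula
  | fls => fls
  | eq s r => eq s r
  | lt s r => lt s r
  | mem s X => mem (Term.pr s (.var t)) X
  | imp φ ψ => imp (φ.stage t) (ψ.stage t)
  | allNum x φ => allNum x (φ.stage t)
  | allSet X φ => allSet X (φ.stage t)

theorem Formula.IsBounded.stage (t : ℕ) (h : φ.IsBounded) : (φ.stage t).IsBounded := by
  induction h with
  | fls => exact .fls
  | eq s r => exact .eq s r
  | lt s r => exact .lt s r
  | mem s X => exact .mem _ X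
  | imp _ _ h1 h2 => exact .imp h1 h2
  | ball hx _ h => exact .ball hx h

theorem Model2.Good.exists_gt (hG : M.Good) (a b : M.Num) : ∃ c, M.lt a c ∧ M.lt b c := by
  have hs : ∀ a, M.lt a (M.add a M.one) := fun a => (hG.lt_succ _ _).2 (.inr rfl)
  rcases hG.trichotomy a b with h | rfl | h
  · exact ⟨_, hG.trans _ _ _ h (hs b), hs b⟩
  · exact ⟨_, hs a, hs a⟩
  · exact ⟨_, hs a, hG.trans _ _ _ h (hs a)⟩

/-- Two eventual properties hold eventually together. -/
theorem Model2.Good.eventually_and (hG : M.Good) {P Q : M.Num → Prop}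
    (hP : ∃ s, ∀ t, M.lt s t → P t) (hQ : ∃ s, ∀ t, M.lt s t → Q t) :
    ∃ s, ∀ t, M.lt s t → P t ∧ Q t := by
  obtain ⟨s, hs⟩ := hP
  obtain ⟨r, hr⟩ := hQ
  obtain ⟨c, hsc, hrc⟩ := hG.exists_gt s r
  exact ⟨c, fun t ht => ⟨hs t (hG.trans _ _ _ hsc ht), hr t (hG.trans _ _ _ hrc ht)⟩⟩

/-- If a bounded formula, evaluated along stages, converges for every value of a variable, then it
converges uniformly below any bound. -/
theorem uniform_convergence (hG : M.Good) (hM : RCA0.HasModel M) (hV : ∀ X, V X ∈ M.sets)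
    (hφ : φ.IsBounded) (v : ℕ → M.Num) {x t : ℕ} (hx : x ≠ t) {P : M.Num → Prop}
    (h : ∀ a, ∃ s, ∀ r, M.lt s r →
      (φ.Sat M (Function.update (Function.update v x a) t r) V ↔ P a)) (b : M.Num) :
    ∃ s, ∀ r, M.lt s r → ∀ a, M.lt a b →
      (φ.Sat M (Function.update (Function.update v x a) t r) V ↔ P a) := by
  obtain ⟨W, hW, hWφ⟩ := exists_coded_pair hG hM hV hφ v hx
  simp only [← hWφ] at h ⊢
  obtain ⟨c, hc⟩ := hG.stabilize W hW b fun a _ => by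
    obtain ⟨s, hs⟩ := h a
    obtain ⟨s', hs', -⟩ := hG.exists_gt s s
    exact ⟨s', fun r hr => (hs r (hG.trans _ _ _ hs' hr)).trans (hs s' hs').symm⟩
  refine ⟨c, fun r hr a ha => ?_⟩
  obtain ⟨s, hs⟩ := h a
  obtain ⟨d, hcd, hsd⟩ := hG.exists_gt c s
  rw [hc a ha r hr, ← hc a ha d hcd, hs d hsd]

/-- Truth of a bounded formula at limit sets is the limit of its truth along the stages. -/
theorem sat_stage (hG : M.Good) (hM : RCA0.HasModel M) (hV : ∀ X, V X ∈ M.sets)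
    {V' : ℕ → Set M.Num} (hVV' : ∀ X, M.Lim (V X) (V' X)) (hφ : φ.IsBounded) {t : ℕ}
    (ht : φ.bd ≤ t) (v : ℕ → M.Num) :
    ∃ s, ∀ r, M.lt s r →
      ((φ.stage t).Sat M (Function.update v t r) V ↔ φ.Sat M v V') := by
  have hterm : ∀ (s : Term), s.bd ≤ t → ∀ (v : ℕ → M.Num) r,
      s.val M (Function.update v t r) = s.val M v := fun s hs v r =>
    Term.val_update (fun h => by have := Term.lt_bd h; omega) _
  induction hφ generalizing v with
  | fls => exact ⟨M.zero, fun _ _ => Iff.rfl⟩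
  | eq s r =>
    simp only [bd, max_le_iff] at ht
    exact ⟨M.zero, fun a _ => by simp only [stage, sat_eq, hterm _ ht.1, hterm _ ht.2]⟩
  | lt s r =>
    simp only [bd, max_le_iff] at ht
    exact ⟨M.zero, fun a _ => by simp only [stage, sat_lt, hterm _ ht.1, hterm _ ht.2]⟩
  | mem s X =>
    simp only [bd, max_le_iff] at ht
    obtain ⟨c, hc⟩ := hVV' X (s.val M v)
    refine ⟨c, fun a ha => ?_⟩
    simp only [stage, sat_mem, Term.pr, Term.val, hterm _ ht.1, Function.update_self]
    exact hc a ha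
  | imp _ _ h1 h2 =>
    simp only [bd, max_le_iff] at ht
    obtain ⟨c, hc⟩ := hG.eventually_and (h1 ht.1 v) (h2 ht.2 v)
    exact ⟨c, fun a ha => by simp only [stage, sat_imp, (hc a ha).1, (hc a ha).2]⟩
  | @ball x u φ hx hφ ih =>
    simp only [bd, max_le_iff] at ht
    have hxt : x ≠ t := by omega
    obtain ⟨c, hc⟩ := uniform_convergence hG hM hV (hφ.stage t) v hxt
      (fun a => ih ht.2.2 (Function.update v x a)) (u.val M v)
    refine ⟨c, fun a ha => ?_⟩
    simp only [stage, sat_allNum, sat_imp, sat_lt, Term.val, Function.update_self,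
      Term.val_update hx, hterm _ ht.2.1.2]
    refine forall₂_congr fun d hd => ?_
    rw [Function.update_comm hxt.symm]
    exact hc a ha d hd

theorem sets_subset_limSets (hG : M.Good) (hM : RCA0.HasModel M) : M.sets ⊆ M.limSets := by
  intro A hA
  obtain ⟨Z, hZ, h⟩ := exists_coded_pair hG hM (V := fun _ => A) (fun _ => hA)
    (φ := .mem (.var 0) 0) (.mem _ _) (fun _ => M.zero) (i := 0) (j := 1) (by decide)
  refine ⟨Z, hZ, fun x => ⟨M.zero, fun t _ => ?_⟩⟩
  rw [h]
  simp [Term.val]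

/-- The structure obtained from `M` by adjoining all limits. -/
abbrev Model2.limModel (M : Model2) (h : M.limSets.Nonempty) : Model2 := M.withSets M.limSets h

theorem Formula.sat_induction {x y : ℕ} (hyx : y ≠ x) (hy : y ∉ φ.freeNum) :
    (φ.induction x y).Sat M v V ↔
      (φ.Sat M (Function.update v x M.zero) V →
        (∀ a, φ.Sat M (Function.update v x a) V →
          φ.Sat M (Function.update v x (M.add a M.one)) V) →
        ∀ a, φ.Sat M (Function.update v x a) V) := by
  have h1 : ∀ a b c, φ.Sat M
      (Function.update (Function.update (Function.update v x a) y b) x c) V ↔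
      φ.Sat M (Function.update v x c) V := fun a b c => by
    rw [Function.update_comm hyx.symm, Function.update_idem, Function.update_comm hyx, sat_update hy]
  simp only [Formula.induction, sat_imp, sat_and, sat_allNum, sat_eq, Term.val,
    Function.update_self, forall_eq, Function.update_of_ne hyx, Function.update_of_ne hyx.symm, h1]
  tauto

theorem limModel_sigma01Induction (hG : M.Good) (hM : RCA0.HasModel M) (h : M.limSets.Nonempty) :
    Theory2.HasModel sigma01Induction (M.limModel h) := by
  rintro _ ⟨x, y, _, ⟨w, θ, hθ, rfl⟩, hyx, hy, rfl⟩ v V' hV'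
  choose V hV hVV' using hV'
  rw [sat_induction hyx hy]
  set t := max θ.bd (max (x + 1) (w + 1)) with ht
  have hs := fun v => sat_stage hG hM hV hVV' hθ (t := t) (by omega) v
  obtain ⟨Z, hZ, hZθ⟩ := exists_coded_triple hG hM hV (hθ.stage t) v (x := x) (w := w) (t := t)
  have key : ∀ a, (exNum w θ).Sat (M.limModel h) (Function.update v x a) V' ↔
      ∃ b s, ∀ r, M.lt s r → M.pr (M.pr a b) r ∈ Z := by
    intro a
    rw [sat_exNum]
    refine exists_congr fun b => ?_
    rw [hθ.noSetQuant.sat_withSets]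
    obtain ⟨s, hs⟩ := hs (Function.update (Function.update v x a) w b)
    have e : ∀ r, M.pr (M.pr a b) r ∈ Z ↔ (θ.stage t).Sat M
        (Function.update (Function.update (Function.update v x a) w b) t r) V := fun r => by
      rw [hZθ, Function.update_comm (show t ≠ x by omega),
        Function.update_comm (show t ≠ w by omega)]
    constructor
    · intro h
      exact ⟨s, fun r hr => (e r).2 ((hs r hr).2 h)⟩
    · rintro ⟨s', hs'⟩
      obtain ⟨r, h1, h2⟩ := hG.exists_gt s s'
      exact (hs r h1).1 ((e r).1 (hs' r h2))
  simp only [key]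
  exact hG.induct Z hZ

theorem limModel_delta01Comprehension (hG : M.Good) (hM : RCA0.HasModel M)
    (h : M.limSets.Nonempty) : Theory2.HasModel delta01Comprehension (M.limModel h) := by
  rintro _ ⟨x, X, _, _, ⟨w, θ, hθ, rfl⟩, ⟨z, η, hη, rfl⟩, hX, rfl⟩ v V' hV'
  choose V hV hVV' using hV'
  rw [sat_imp, sat_comprehension]
  simp only [sat_allNum, sat_iff, sat_updateSet hX, sat_exNum, hθ.noSetQuant.sat_withSets,
    hη.noSetQuant.sat_withSets]
  intro heq
  refine ⟨{a | ∃ b, θ.Sat M (Function.update (Function.update v x a) w b) V'}, ?_,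
    fun a => Iff.rfl⟩
  set t := max θ.bd (max η.bd (max (x + 1) (max (w + 1) (z + 1)))) with ht
  have hsθ := fun v => sat_stage hG hM hV hVV' hθ (t := t) (by omega) v
  have hsη := fun v => sat_stage hG hM hV hVV' hη (t := t) (by omega) v
  have hpt : t + 1 ≠ t := by omega
  have hwp : w ≠ t + 1 := by omega
  have hzp : z ≠ t + 1 := by omega
  have hxt : x ≠ t := by omega
  have hwt : w ≠ t := by omega
  have hzt : z ≠ t := by omega
  have hxp : x ≠ t + 1 := by omega
  -- At stage `t`, `x` is put into the set if some `p ≤ t` is at that stage a witness of the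
  -- `Σ⁰₁` definition, while no `z ≤ p` refutes the `Π⁰₁` definition.
  obtain ⟨Z, hZ, hZθ⟩ := exists_coded_pair hG hM hV (i := x) (j := t)
    (φ := ((((eq (.var w) (.var (t + 1))).and (θ.stage t)).bexLe w (t + 1)).and
      ((η.stage t).ballLe z (t + 1))).bexLe (t + 1) t)
    (.bexLe hpt (.and (.bexLe hwp (.and (.eq _ _) (hθ.stage t))) (.ballLe hzp (hη.stage t))))
    v hxt
  refine ⟨Z, hZ, fun a => ?_⟩
  -- Once the fresh variable is read off, the approximation at `a` and stage `r` takes this form.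
  have hZ' : ∀ r, M.pr a r ∈ Z ↔ ∃ p, M.lt p (M.add r M.one) ∧
      (θ.stage t).Sat M (Function.update (Function.update (Function.update v x a) w p) t r) V ∧
      ∀ c, M.lt c (M.add p M.one) → (η.stage t).Sat M
        (Function.update (Function.update (Function.update v x a) z c) t r) V := by
    intro r
    rw [hZθ]
    have hfree : ∀ {ψ : Formula}, ψ.bd ≤ t → t + 1 ∉ (ψ.stage t).freeNum := by
      intro ψ
      induction ψ with
      | fls => simp [stage, freeNum]
      | eq s r =>
        intro h hm
        have := freeNum_lt_bd hm; simp only [stage] at this; omega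
      | lt s r =>
        intro h hm
        have := freeNum_lt_bd hm; simp only [stage] at this; omega
      | mem s Y =>
        intro h hm
        simp only [bd, max_le_iff] at h
        simp only [stage, freeNum, Term.pr, Term.vars, Finset.mem_union,
          Finset.mem_singleton] at hm
        have : t + 1 ∉ s.vars := fun h' => by have := Term.lt_bd h'; omega
        simp [this] at hm
      | imp φ ψ h1 h2 =>
        intro h hm
        simp only [bd, max_le_iff] at h
        simp only [stage, freeNum, Finset.mem_union] at hm
        exact hm.elim (h1 h.1) (h2 h.2)
      | allNum y φ ih =>
        intro h hm
        simp only [bd, max_le_iff] at h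
        exact ih h.2 (Finset.mem_of_mem_erase hm)
      | allSet Y φ ih =>
        intro h hm
        simp only [bd, max_le_iff] at h
        exact ih h.2 hm
    have hfθ := hfree (show θ.bd ≤ t by omega)
    have hfη := hfree (show η.bd ≤ t by omega)
    simp only [sat_bexLe hpt, sat_and, sat_bexLe hwp, sat_ballLe hzp, sat_eq, Term.val,
      Function.update_self, Function.update_of_ne hwp.symm]
    refine exists_congr fun p => and_congr ?_ (and_congr ?_ (forall₂_congr fun c _ => ?_))
    · simp
    · constructor
      · rintro ⟨_, -, rfl, h⟩
        rw [Function.update_comm hwp.symm, sat_update hfθ, Function.update_comm hwt.symm] at h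
        exact h
      · intro h
        refine ⟨p, (hG.lt_succ _ _).2 (.inr rfl), rfl, ?_⟩
        rw [Function.update_comm hwp.symm, sat_update hfθ, Function.update_comm hwt.symm]
        exact h
    · rw [Function.update_comm hzp.symm, sat_update hfη, Function.update_comm hzt.symm]
  simp only [hZ']
  have hle : ∀ {c p : M.Num}, M.lt p c → M.lt p (M.add c M.one) := fun hp =>
    (hG.lt_succ _ _).2 (.inl hp)
  by_cases ha : ∃ b, θ.Sat M (Function.update (Function.update v x a) w b) V'
  · obtain ⟨b, hb⟩ := ha
    have hall := (heq a).1 ⟨b, hb⟩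
    obtain ⟨s1, h1⟩ := hsθ (Function.update (Function.update v x a) w b)
    obtain ⟨s2, h2⟩ := uniform_convergence hG hM hV (hη.stage t) (Function.update v x a) hzt
      (fun c => hsη (Function.update (Function.update v x a) z c)) (M.add b M.one)
    obtain ⟨s, hs⟩ := hG.eventually_and ⟨s1, h1⟩
      (hG.eventually_and ⟨s2, h2⟩ ⟨b, fun r hr => hle hr⟩)
    refine ⟨s, fun r hr => ?_⟩
    obtain ⟨k1, k2, k3⟩ := hs r hr
    exact iff_of_true ⟨b, k3, k1.2 hb, fun c hc => (k2 c hc).2 (hall c)⟩ ⟨b, hb⟩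
  · obtain ⟨c, hc⟩ := not_forall.1 fun hall => ha ((heq a).2 hall)
    obtain ⟨s1, h1⟩ := hsη (Function.update (Function.update v x a) z c)
    obtain ⟨s2, h2⟩ := uniform_convergence hG hM hV (hθ.stage t) (Function.update v x a) hwt
      (fun b => hsθ (Function.update (Function.update v x a) w b)) c
    obtain ⟨s, hs⟩ := hG.eventually_and ⟨s1, h1⟩ ⟨s2, h2⟩
    refine ⟨s, fun r hr => iff_of_false ?_ ha⟩
    rintro ⟨p, -, hp1, hp2⟩
    obtain ⟨k1, k2⟩ := hs r hr
    -- Below the refuting value `c` no witness is left; from `c` on, `c` itself refutes.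
    rcases hG.trichotomy p c with hpc | rfl | hpc
    · exact ha ⟨p, (k2 p hpc).1 hp1⟩
    · exact hc (k1.1 (hp2 p ((hG.lt_succ _ _).2 (.inr rfl))))
    · exact hc (k1.1 (hp2 c (hle hpc)))

theorem basicAxioms_noSetQuant {χ : Formula} (h : χ ∈ basicAxioms) : χ.NoSetQuant := by
  simp only [basicAxioms, Set.mem_insert_iff, Set.mem_singleton_iff] at h
  rcases h with rfl | rfl | rfl | rfl | rfl | rfl | rfl | rfl <;>
    simp [NoSetQuant, Formula.neg, Formula.iff, Formula.and, Formula.or]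

theorem basicAxioms_freeSet {χ : Formula} (h : χ ∈ basicAxioms) : χ.freeSet = ∅ := by
  simp only [basicAxioms, Set.mem_insert_iff, Set.mem_singleton_iff] at h
  rcases h with rfl | rfl | rfl | rfl | rfl | rfl | rfl | rfl <;>
    simp [freeSet, Formula.neg, Formula.iff, Formula.and, Formula.or]

/-- Formulas without set quantifiers and set variables are transferred between structures with
the same numbers. -/
theorem true_withSets {𝒮 : Set (Set M.Num)} {h : 𝒮.Nonempty} (h1 : φ.NoSetQuant)
    (h2 : φ.freeSet = ∅) : φ.True (M.withSets 𝒮 h) ↔ φ.True M := by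
  have hV : ∀ (v : ℕ → M.Num) (V V' : ℕ → Set M.Num), φ.Sat M v V ↔ φ.Sat M v V' :=
    fun v V V' => sat_congr (fun _ _ => rfl) fun X hX => by simp [h2] at hX
  obtain ⟨A, hA⟩ := h
  obtain ⟨B, hB⟩ := M.sets_nonempty
  exact ⟨fun H v V _ => (hV _ _ _).1 ((h1.sat_withSets _ _).1 (H v (fun _ => A) fun _ => hA)),
    fun H v V _ => (h1.sat_withSets _ _).2 ((hV _ _ _).1 (H v (fun _ => B) fun _ => hB))⟩

/-- Adjoining the limits to a good model of `RCA₀` yields a model of `RCA₀`. -/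
theorem limModel_RCA0 (hG : M.Good) (hM : RCA0.HasModel M) (h : M.limSets.Nonempty) :
    RCA0.HasModel (M.limModel h) := by
  rintro χ ((hχ | hχ) | hχ)
  · exact (true_withSets (basicAxioms_noSetQuant hχ) (basicAxioms_freeSet hχ)).2
      (hM χ (.inl (.inl hχ)))
  · exact limModel_sigma01Induction hG hM h χ hχ
  · exact limModel_delta01Comprehension hG hM h χ hχ

/-- A set with a `Σ⁰₁` definition in `M` is a limit. -/
theorem sigma01_mem_limSets (hG : M.Good) (hM : RCA0.HasModel M) (hV : ∀ X, V X ∈ M.sets)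
    (hφ : φ.IsBounded) (v : ℕ → M.Num) {x w : ℕ} :
    {a | (exNum w φ).Sat M (Function.update v x a) V} ∈ M.limSets := by
  set t := max φ.bd (max (x + 1) (w + 1)) with ht
  have hwt : w ≠ t := by omega
  have hφt : t ∉ φ.freeNum := fun h => by have := freeNum_lt_bd h; omega
  obtain ⟨Z, hZ, hZφ⟩ := exists_coded_pair hG hM hV (i := x) (j := t) (φ := φ.bexLe w t)
    (.bexLe hwt hφ) v (by omega)
  have key : ∀ a r, M.pr a r ∈ Z ↔ ∃ b, M.lt b (M.add r M.one) ∧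
      φ.Sat M (Function.update (Function.update v x a) w b) V := fun a r => by
    simp only [hZφ, sat_bexLe hwt, Function.update_self, Function.update_comm hwt.symm,
      sat_update hφt]
  refine ⟨Z, hZ, fun a => ?_⟩
  simp only [Set.mem_ofPred_eq, sat_exNum, key]
  by_cases h : ∃ b, φ.Sat M (Function.update (Function.update v x a) w b) V
  · obtain ⟨b, hb⟩ := h
    exact ⟨b, fun r hr => iff_of_true ⟨b, (hG.lt_succ _ _).2 (.inl hr), hb⟩ ⟨b, hb⟩⟩
  · exact ⟨M.zero, fun r _ => iff_of_false (fun ⟨b, _, hb⟩ => h ⟨b, hb⟩) h⟩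

end Frac

namespace Frac

open Formula

/-! ### The systems -/

/-- The sentence that says that a structure is good in the sense of `Model2.Good`. -/
def goodSentence : Formula :=
  let x : Term := .var 0
  let y : Term := .var 1
  let s : Term := .var 2
  let t : Term := .var 3
  let conv (c : Term) : Formula := .iff (.mem (.pr x t) 0) (.mem (.pr x c) 0)
  let witnessed (a : Term) : Formula :=
    exNum 1 (exNum 2 (allNum 3 (imp (lt s t) (.mem (.pr (.pr a y) t) 0))))
  .and (allNum 0 (allNum 1 (allNum 2 (imp (lt x y) (imp (lt y s) (lt x s)))))) <|
  .and (allNum 0 (allNum 1 (.or (lt x y) (.or (eq x y) (lt y x))))) <|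
  .and (allNum 0 (allNum 1 (.iff (lt x (.add y .one)) (.or (lt x y) (eq x y))))) <|
  .and (allNum 0 (allNum 1 (allNum 2 (allNum 3 (imp (eq (.pr x y) (.pr s t))
    (.and (eq x s) (eq y t))))))) <|
  .and (allNum 0 (allNum 1 (lt x (.add (.pr x y) .one)))) <|
  .and (allNum 0 (allNum 1 (lt y (.add (.pr x y) .one)))) <|
  .and (allSet 0 (allNum 1 (imp
    (allNum 0 (imp (lt x y) (exNum 2 (allNum 3 (imp (lt s t) (conv s))))))
    (exNum 2 (allNum 0 (imp (lt x y) (allNum 3 (imp (lt s t) (conv s))))))))) <|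
  allSet 0 (imp (witnessed .zero)
    (imp (allNum 0 (imp (witnessed x) (witnessed (.add x .one)))) (allNum 0 (witnessed x))))

variable {M : Model2}

theorem sat_goodSentence (v : ℕ → M.Num) (V : ℕ → Set M.Num) :
    goodSentence.Sat M v V ↔ M.Good := by
  simp only [goodSentence, sat_and, sat_allNum, sat_imp, sat_lt, sat_or, sat_eq, sat_iff,
    sat_allSet, sat_exNum, sat_mem, Term.pr, Term.val, Function.update_self, ne_eq,
    OfNat.ofNat_ne_zero, OfNat.zero_ne_ofNat, OfNat.one_ne_ofNat, zero_ne_one,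
    one_ne_zero, not_false_eq_true, Function.update_of_ne, Nat.reduceEqDiff]
  exact ⟨fun ⟨h1, h2, h3, h4, h5, h6, h7, h8⟩ => ⟨h1, h2, h3, h4, h5, h6, h7, h8⟩,
    fun ⟨h1, h2, h3, h4, h5, h6, h7, h8⟩ => ⟨h1, h2, h3, h4, h5, h6, h7, h8⟩⟩

/-- `ψ` holds of the set `Y`; meant for `ψ` with the single free variable `Y₀`. -/
def Formula.HoldsOf (M : Model2) (ψ : Formula) (Y : Set M.Num) : Prop :=
  ψ.Sat M (fun _ => M.zero) (fun _ => Y)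

/-- The set of the numbers `x` with `δ(x, X)`; meant for `δ` with the free variables `x₀`
and `X₀` only. -/
def Model2.image (M : Model2) (δ : Formula) (X : Set M.Num) : Set M.Num :=
  {a | δ.Sat M (fun _ => a) (fun _ => X)}

/-- The formula has no free variable except possibly the set variable `0`. -/
def Formula.IsSetPred (ψ : Formula) : Prop := ψ.freeNum = ∅ ∧ ψ.freeSet ⊆ {0}

/-- The formula has no free variables except possibly the number and the set variable `0`. -/
def Formula.IsOperator (δ : Formula) : Prop := δ.freeNum ⊆ {0} ∧ δ.freeSet ⊆ {0}

theorem Formula.IsSetPred.sat_iff {ψ : Formula} (h : ψ.IsSetPred) (v : ℕ → M.Num)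
    (V : ℕ → Set M.Num) : ψ.Sat M v V ↔ ψ.HoldsOf M (V 0) :=
  sat_congr (fun i hi => by simp [h.1] at hi)
    fun X hX => by rw [Finset.mem_singleton.1 (h.2 hX)]

theorem Formula.IsOperator.sat_iff {δ : Formula} (h : δ.IsOperator) (v : ℕ → M.Num)
    (V : ℕ → Set M.Num) : δ.Sat M v V ↔ v 0 ∈ M.image δ (V 0) :=
  sat_congr (fun i hi => by rw [Finset.mem_singleton.1 (h.1 hi)])
    fun X hX => by rw [Finset.mem_singleton.1 (h.2 hX)]

/-- `Y₀ = Y₁`, for set variables. -/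
def setEq01 : Formula := allNum 0 (.iff (mem (.var 0) 1) (mem (.var 0) 0))

theorem sat_setEq01 (v : ℕ → M.Num) (V : ℕ → Set M.Num) :
    setEq01.Sat M v V ↔ V 1 = V 0 := by
  simp [setEq01, Term.val, Set.ext_iff]

/-- The formula saying that `Y₀ = {x | δ(x, X)}` for some `X` with `ψ(X)`. -/
def stepPred (ψ δ : Formula) : Formula :=
  exSet 1 (.and setEq01 (exSet 0 (.and ψ (allNum 0 (.iff (mem (.var 0) 1) δ)))))

theorem isSetPred_stepPred {ψ δ : Formula} (hψ : ψ.IsSetPred) (hδ : δ.IsOperator) :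
    (stepPred ψ δ).IsSetPred := by
  obtain ⟨h1, h2⟩ := hψ
  obtain ⟨h3, h4⟩ := hδ
  constructor
  · simp [stepPred, exSet, Formula.neg, Formula.and, Formula.iff, freeNum, setEq01, Term.vars, h1]
    rwa [Finset.erase_eq_empty_iff, ← Finset.subset_singleton_iff]
  · intro X hX
    simp only [stepPred, exSet, Formula.neg, Formula.and, Formula.iff, freeSet, setEq01,
      Finset.mem_erase, Finset.mem_union, Finset.mem_singleton, Finset.notMem_empty] at hX ⊢
    have := @h2 X
    have := @h4 X
    simp only [Finset.mem_singleton] at *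
    tauto

theorem holdsOf_stepPred {ψ δ : Formula} (hψ : ψ.IsSetPred) (hδ : δ.IsOperator) (Y : Set M.Num) :
    (stepPred ψ δ).HoldsOf M Y ↔
      Y ∈ M.sets ∧ ∃ X ∈ M.sets, ψ.HoldsOf M X ∧ Y = M.image δ X := by
  rw [Formula.HoldsOf]
  simp only [stepPred, sat_exSet, sat_and, sat_setEq01, hψ.sat_iff,
    sat_allNum, sat_iff, sat_mem, hδ.sat_iff, Term.val, Function.update_self, ne_eq,
    zero_ne_one, one_ne_zero, not_false_eq_true, Function.update_of_ne]
  constructor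
  · rintro ⟨A, hA, rfl, X, hX, h1, h2⟩
    exact ⟨hA, X, hX, h1, Set.ext h2⟩
  · rintro ⟨hA, X, hX, h1, h2⟩
    exact ⟨Y, hA, rfl, X, hX, h1, Set.ext_iff.1 h2⟩

/-- The formula saying that `Y₀` is the `n`-th jump of the empty set, `J` defining the jump. -/
def jumpPred (J : Formula) : ℕ → Formula
  | 0 => allNum 0 (neg (mem (.var 0) 0))
  | n + 1 => stepPred (jumpPred J n) J

/-- The `n`-th jump of the empty set exists, if the structure is good. -/
def jumpAxiom (J : Formula) (n : ℕ) : Formula := imp goodSentence (exSet 0 (jumpPred J n))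

/-- `RCA₀` together with the existence of the first `n` jumps of the empty set, under the
hypothesis that the structure is good. The jump number `0` is omitted, so that the system number `0`
is `RCA₀` itself. -/
def system (J : Formula) (n : ℕ) : Theory2 := RCA0 ∪ {χ | ∃ i < n, χ = jumpAxiom J (i + 1)}

theorem system_zero (J : Formula) : system J 0 = RCA0 := by simp [system]

/-- A `Σ⁰₁` formula that defines the Turing jump in all `ω`-structures. -/
structure IsJumpFormula (J : Formula) : Prop where
  sigma : ∃ θ, θ.IsBounded ∧ J = exNum 1 θ
  isOperator : J.IsOperator
  image_eq : ∀ (𝒮 : Set (Set ℕ)) (h : 𝒮.Nonempty) (X : Set ℕ),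
    (omegaModel 𝒮 h).image J X = jump X

variable {J : Formula}

theorem isSetPred_jumpPred (hJ : J.IsOperator) (n : ℕ) : (jumpPred J n).IsSetPred := by
  induction n with
  | zero => simp [jumpPred, IsSetPred, freeNum, freeSet, Formula.neg, Term.vars]
  | succ n ih => exact isSetPred_stepPred ih hJ

theorem holdsOf_jumpPred_zero (Y : Set M.Num) : (jumpPred J 0).HoldsOf M Y ↔ Y = ∅ := by
  simp [jumpPred, Formula.HoldsOf, Term.val, Set.eq_empty_iff_forall_notMem]

theorem empty_mem_sets (hM : RCA0.HasModel M) : ∅ ∈ M.sets := by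
  obtain ⟨A, hA⟩ := M.sets_nonempty
  simpa using bounded_comprehension hM (fun _ => hA) .fls (fun _ => M.zero) 0

theorem sat_jumpAxiom (hJ : J.IsOperator) (n : ℕ) (v : ℕ → M.Num) (V : ℕ → Set M.Num) :
    (jumpAxiom J n).Sat M v V ↔ (M.Good → ∃ Y ∈ M.sets, (jumpPred J n).HoldsOf M Y) := by
  simp only [jumpAxiom, sat_imp, sat_goodSentence, sat_exSet, (isSetPred_jumpPred hJ n).sat_iff,
    Function.update_self]

theorem system_hasModel_iff (hJ : J.IsOperator) (n : ℕ) :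
    (system J n).HasModel M ↔ RCA0.HasModel M ∧
      ∀ i ≤ n, M.Good → ∃ Y ∈ M.sets, (jumpPred J i).HoldsOf M Y := by
  obtain ⟨A, hA⟩ := M.sets_nonempty
  constructor
  · intro h
    have hR : RCA0.HasModel M := fun χ hχ => h χ (.inl hχ)
    refine ⟨hR, fun i hi => ?_⟩
    cases i with
    | zero => exact fun _ => ⟨∅, empty_mem_sets hR, (holdsOf_jumpPred_zero _).2 rfl⟩
    | succ i =>
      exact (sat_jumpAxiom hJ (i + 1) (fun _ => M.zero) fun _ => A).1
        (h _ (.inr ⟨i, hi, rfl⟩) _ _ fun _ => hA)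
  · rintro ⟨h1, h2⟩ χ (hχ | ⟨i, hi, rfl⟩)
    · exact h1 χ hχ
    · exact fun v V _ => (sat_jumpAxiom hJ (i + 1) v V).2 (h2 (i + 1) hi)

theorem image_withSets {δ : Formula} (hδ : δ.NoSetQuant) {𝒮 : Set (Set M.Num)} {h : 𝒮.Nonempty}
    (X : Set M.Num) : (M.withSets 𝒮 h).image δ X = M.image δ X :=
  Set.ext fun _ => hδ.sat_withSets _ _

/-- Being the `n`-th jump of the empty set is not affected by additional sets. -/
theorem holdsOf_jumpPred_mono (hJ : J.IsOperator) (hJ' : J.NoSetQuant) {𝒮 : Set (Set M.Num)}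
    {h : 𝒮.Nonempty} (h𝒮 : M.sets ⊆ 𝒮) {n : ℕ} {Y : Set M.Num}
    (hY : (jumpPred J n).HoldsOf M Y) : (jumpPred J n).HoldsOf (M.withSets 𝒮 h) Y := by
  induction n generalizing Y with
  | zero =>
    rw [holdsOf_jumpPred_zero] at hY
    exact (holdsOf_jumpPred_zero (M := M.withSets 𝒮 h) Y).2 hY
  | succ n ih =>
    obtain ⟨h1, X, hX, h2, h3⟩ := (holdsOf_stepPred (isSetPred_jumpPred hJ n) hJ Y).1 hY
    exact (holdsOf_stepPred (M := M.withSets 𝒮 h) (isSetPred_jumpPred hJ n) hJ Y).2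
      ⟨h𝒮 h1, X, h𝒮 hX, ih h2, by rw [image_withSets hJ', h3]⟩

theorem IsJumpFormula.noSetQuant (hJ : IsJumpFormula J) : J.NoSetQuant := by
  obtain ⟨θ, hθ, rfl⟩ := hJ.sigma
  exact ⟨⟨hθ.noSetQuant, trivial⟩, trivial⟩

/-- Each system is arithmetically conservative over the preceding one: a model of the former that
is good is expanded by the limits, which keeps its numbers, and any other is a model
of the latter already. -/
theorem system_conservative (hJ : IsJumpFormula J) (n : ℕ) :
    (system J n).IsArithConservativeExt (system J (n + 1)) := by
  refine ⟨Set.union_subset_union_right _ fun χ ⟨i, hi, h⟩ => ⟨i, by omega, h⟩, ?_⟩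
  rintro σ ⟨hσ1, hσ2, hσ3⟩ hσ M hM
  obtain ⟨hR, hjumps⟩ := (system_hasModel_iff hJ.isOperator n).1 hM
  by_cases hG : M.Good
  · have hsub := sets_subset_limSets hG hR
    have hne := M.sets_nonempty.mono hsub
    refine (true_withSets hσ1 hσ3).1 (hσ (M.limModel hne)
      ((system_hasModel_iff hJ.isOperator _).2 ⟨limModel_RCA0 hG hR hne, fun i hi _ => ?_⟩))
    have hmono : ∀ i ≤ n, ∃ Y ∈ M.sets, (jumpPred J i).HoldsOf (M.limModel hne) Y :=
      fun i hi => by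
        obtain ⟨Y, hY, h⟩ := hjumps i hi hG
        exact ⟨Y, hY, holdsOf_jumpPred_mono hJ.isOperator hJ.noSetQuant hsub h⟩
    rcases Nat.le_succ_iff.1 hi with hi | rfl
    · obtain ⟨Y, hY, h⟩ := hmono i hi
      exact ⟨Y, hsub hY, h⟩
    · obtain ⟨X, hX, h⟩ := hmono n le_rfl
      have hmem : M.image J X ∈ M.limSets := by
        obtain ⟨θ, hθ, hJθ⟩ := hJ.sigma
        convert sigma01_mem_limSets hG hR (V := fun _ => X) (fun _ => hX) hθ (fun _ => M.zero)
          (x := 0) (w := 1) using 1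
        ext a
        simp only [Set.mem_ofPred_eq, ← hJθ, hJ.isOperator.sat_iff, Function.update_self]
      exact ⟨_, hmem, (holdsOf_stepPred (M := M.limModel hne)
        (isSetPred_jumpPred hJ.isOperator n) hJ.isOperator _).2
        ⟨hmem, X, hsub hX, h, (image_withSets (h := hne) hJ.noSetQuant X).symm⟩⟩
  · exact hσ M ((system_hasModel_iff hJ.isOperator _).2 ⟨hR, fun _ _ h => (hG h).elim⟩)

/-! ### The systems in `ω`-structures -/

variable {𝒮 : Set (Set ℕ)} {h𝒮 : 𝒮.Nonempty}

theorem omegaModel_good : (omegaModel 𝒮 h𝒮).Good where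
  trans _ _ _ := Nat.lt_trans
  trichotomy := Nat.lt_trichotomy
  lt_succ _ _ := Nat.lt_succ_iff_lt_or_eq
  pr_inj := by
    have key : ∀ a b c d : ℕ, (a + b) * (a + b) + a = (c + d) * (c + d) + c → a = c ∧ b = d := by
      intro a b c d h
      have h1 : a + b = c + d := by
        rcases lt_trichotomy (a + b) (c + d) with h' | h' | h'
        · nlinarith
        · exact h'
        · nlinarith
      rw [h1] at h
      omega
    exact key
  left_lt := by
    have key : ∀ a b : ℕ, a < (a + b) * (a + b) + a + 1 := fun a b => by omega
    exact key
  right_lt := by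
    have key : ∀ a b : ℕ, b < (a + b) * (a + b) + a + 1 := fun a b => by
      have := Nat.le_mul_self (a + b)
      omega
    exact key
  stabilize Z _ b h := by
    change ∀ a, a < b → ∃ s, ∀ t, s < t → _ at h
    choose! s hs using h
    refine ⟨(Finset.range b).sup s, fun a ha t ht => ?_⟩
    have ha' : s a ≤ (Finset.range b).sup s := Finset.le_sup (Finset.mem_range.2 ha)
    rw [hs a ha t (ha'.trans_lt ht)]
    rcases ha'.eq_or_lt with h | h
    · rw [← h]
    · rw [hs a ha _ h]
  induct Z _ h0 hs x := Nat.rec h0 (fun x ih => hs x ih) x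

theorem holdsOf_jumpPred_omega (hJ : IsJumpFormula J) (n : ℕ) {Y : Set ℕ} (hY : Y ∈ 𝒮) :
    (jumpPred J n).HoldsOf (omegaModel 𝒮 h𝒮) Y ↔
      Y = emptyJump n ∧ ∀ i ≤ n, emptyJump i ∈ 𝒮 := by
  induction n generalizing Y with
  | zero =>
    refine (holdsOf_jumpPred_zero (M := omegaModel 𝒮 h𝒮) Y).trans
      ⟨fun h => ⟨h, fun i hi => ?_⟩, fun h => h.1⟩
    obtain rfl := Nat.le_zero.1 hi
    exact (show Y = emptyJump 0 from h) ▸ hY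
  | succ n ih =>
    rw [jumpPred, holdsOf_stepPred (isSetPred_jumpPred hJ.isOperator n) hJ.isOperator]
    simp only [hJ.image_eq]
    constructor
    · rintro ⟨-, X, hX, h, rfl⟩
      obtain ⟨rfl, h'⟩ := (ih hX).1 h
      refine ⟨rfl, fun i hi => ?_⟩
      rcases Nat.le_succ_iff.1 hi with hi | rfl
      · exact h' i hi
      · exact hY
    · rintro ⟨rfl, h⟩
      have hn := h n (Nat.le_succ n)
      exact ⟨hY, _, hn, (ih hn).2 ⟨rfl, fun i hi => h i (by omega)⟩, rfl⟩

/-- The `ω`-models of the `n`-th system are the `ω`-models of `RCA₀` that contain the first `n`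
jumps of the empty set. -/
theorem system_hasModel_omega (hJ : IsJumpFormula J) (n : ℕ) :
    (system J n).HasModel (omegaModel 𝒮 h𝒮) ↔
      RCA0.HasModel (omegaModel 𝒮 h𝒮) ∧ ∀ i ≤ n, emptyJump i ∈ 𝒮 := by
  rw [system_hasModel_iff hJ.isOperator]
  refine and_congr_right fun _ => ⟨fun h i hi => ?_, fun h i hi _ => ?_⟩
  · obtain ⟨Y, hY, hYi⟩ := h i hi omegaModel_good
    exact ((holdsOf_jumpPred_omega hJ i hY).1 hYi).2 i le_rfl
  · exact ⟨_, h i hi, (holdsOf_jumpPred_omega hJ i (h i hi)).2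
      ⟨rfl, fun j hj => h j (hj.trans hi)⟩⟩

/-! ### Definability within a system -/

variable {T : Theory2} {A : Set ℕ}

theorem mem_of_mem_defSets (hA : A ∈ T.DefSets) (hT : T.HasModel (omegaModel 𝒮 h𝒮)) : A ∈ 𝒮 := by
  obtain ⟨x, X, φ, -, h2, h3, h4⟩ := hA
  obtain ⟨B, hB⟩ := id h𝒮
  obtain ⟨C, hC, h⟩ := sat_comprehension.1 (h3 _ hT (fun _ => 0) (fun _ => B) fun _ => hB)
  have : A = C := by
    ext n
    rw [h4 𝒮 h𝒮 hT (fun _ => 0) (fun _ => B) (fun _ => hB) n, h, sat_updateSet (by simp [h2])]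
  exact this ▸ hC

/-- The formula saying that `x₀` belongs to the only set `Y` with `ψ(Y)`. -/
def memUnique (ψ : Formula) : Formula :=
  exSet 1 (.and (mem (.var 0) 1)
    (.and (exSet 0 (.and ψ setEq01)) (allSet 0 (imp ψ setEq01))))

theorem sat_memUnique {ψ : Formula} (hψ : ψ.IsSetPred) (v : ℕ → M.Num) (V : ℕ → Set M.Num) :
    (memUnique ψ).Sat M v V ↔
      ∃ Y ∈ M.sets, v 0 ∈ Y ∧ ψ.HoldsOf M Y ∧ ∀ Z ∈ M.sets, ψ.HoldsOf M Z → Y = Z := by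
  simp only [memUnique, sat_exSet, sat_and, sat_mem, Term.val, hψ.sat_iff, sat_setEq01,
    sat_allSet, sat_imp, Function.update_self, ne_eq,
    one_ne_zero, not_false_eq_true, Function.update_of_ne]
  constructor
  · rintro ⟨Y, hY, h1, ⟨X, hX, h2, rfl⟩, h3⟩
    exact ⟨Y, hY, h1, h2, h3⟩
  · rintro ⟨Y, hY, h1, h2, h3⟩
    exact ⟨Y, hY, h1, ⟨Y, hY, h2, rfl⟩, h3⟩

/-- If `A` is implicitly definable, by one formula, in all `ω`-models of an extension of `RCA₀`,
then it is definable within that extension: the comprehension axiom for `memUnique ψ` holds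
regardless of `ψ`, since the set in question is either the only set with `ψ` or empty. -/
theorem mem_defSets_of_unique {ψ : Formula} (hT : RCA0 ⊆ T) (hψ : ψ.IsSetPred)
    (h : ∀ (𝒮 : Set (Set ℕ)) (h𝒮 : 𝒮.Nonempty), T.HasModel (omegaModel 𝒮 h𝒮) →
      A ∈ 𝒮 ∧ ∀ Y ∈ 𝒮, ψ.HoldsOf (omegaModel 𝒮 h𝒮) Y ↔ Y = A) : A ∈ T.DefSets := by
  refine ⟨0, 0, memUnique ψ, ?_, ?_, ?_, ?_⟩
  · simp [memUnique, exSet, Formula.neg, Formula.and, Formula.iff, freeNum, setEq01, Term.vars,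
      hψ.1]
  · ext X
    have := @hψ.2 X
    simp only [memUnique, exSet, Formula.neg, Formula.and, Formula.iff, freeSet, setEq01,
      Finset.mem_erase, Finset.mem_union, Finset.mem_singleton, Finset.notMem_empty] at this ⊢
    tauto
  · intro M hM v V hV
    rw [sat_comprehension]
    simp only [sat_memUnique hψ, Function.update_self]
    by_cases hY : ∃ Y ∈ M.sets, ψ.HoldsOf M Y ∧ ∀ Z ∈ M.sets, ψ.HoldsOf M Z → Y = Z
    · obtain ⟨Y, hY, h1, h2⟩ := hY
      refine ⟨Y, hY, fun a => ⟨fun ha => ⟨Y, hY, ha, h1, h2⟩, ?_⟩⟩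
      rintro ⟨Z, hZ, ha, h3, -⟩
      rwa [h2 Z hZ h3]
    · exact ⟨∅, empty_mem_sets fun χ hχ => hM χ (hT hχ), fun a =>
        iff_of_false (Set.notMem_empty a) fun ⟨Y, hY', _, h⟩ => hY ⟨Y, hY', h⟩⟩
  · intro 𝒮 h𝒮 hM v V _ n
    obtain ⟨hA, hu⟩ := h 𝒮 h𝒮 hM
    rw [sat_memUnique hψ, Function.update_self]
    constructor
    · intro hn
      exact ⟨A, hA, hn, (hu A hA).2 rfl, fun Z hZ h => ((hu Z hZ).1 h).symm⟩
    · rintro ⟨Y, hY, hn, h1, -⟩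
      rwa [← (hu Y hY).1 h1]

end Frac

namespace Frac

open Formula

/-! ### Bounded definability in `ω`-structures -/

/-- A function of `n` variables given by a term; the arguments are the variables `0, …, n - 1`. -/
def TermDef {n : ℕ} (f : (Fin n → ℕ) → ℕ) : Prop :=
  ∃ t : Term, t.vars ⊆ Finset.range n ∧ ∀ (𝒮 : Set (Set ℕ)) (h : 𝒮.Nonempty) (v : ℕ → ℕ),
    t.val (omegaModel 𝒮 h) v = f fun i => v i

/-- A relation between `n` numbers and a set that is defined, in all `ω`-structures, by one bounded
formula; the numbers are the variables `0, …, n - 1` and the set is the set variable `0`. A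
quantifier over such a relation binds the variable `n`, so that no renaming is ever needed. -/
def BddDef {n : ℕ} (P : (Fin n → ℕ) → Set ℕ → Prop) : Prop :=
  ∃ φ : Formula, φ.IsBounded ∧ φ.freeNum ⊆ Finset.range n ∧ φ.freeSet ⊆ {0} ∧
    ∀ (𝒮 : Set (Set ℕ)) (h : 𝒮.Nonempty) (v : ℕ → ℕ) (V : ℕ → Set ℕ),
      φ.Sat (omegaModel 𝒮 h) v V ↔ P (fun i => v i) (V 0)

namespace TermDef

variable {n : ℕ} {f g : (Fin n → ℕ) → ℕ}

theorem var (i : Fin n) : TermDef fun v => v i :=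
  ⟨.var i, by simp [Term.vars], fun _ _ _ => rfl⟩

theorem add (hf : TermDef f) (hg : TermDef g) : TermDef fun v => f v + g v := by
  obtain ⟨t, ht, ht'⟩ := hf
  obtain ⟨s, hs, hs'⟩ := hg
  exact ⟨.add t s, Finset.union_subset ht hs, fun 𝒮 h v => by simp only [Term.val, ht', hs']⟩

theorem mul (hf : TermDef f) (hg : TermDef g) : TermDef fun v => f v * g v := by
  obtain ⟨t, ht, ht'⟩ := hf
  obtain ⟨s, hs, hs'⟩ := hg
  exact ⟨.mul t s, Finset.union_subset ht hs, fun 𝒮 h v => by simp only [Term.val, ht', hs']⟩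

theorem const (k : ℕ) : TermDef fun _ : Fin n → ℕ => k := by
  induction k with
  | zero => exact ⟨.zero, by simp [Term.vars], fun _ _ _ => rfl⟩
  | succ k ih => exact add ih ⟨.one, by simp [Term.vars], fun _ _ _ => rfl⟩

end TermDef

namespace BddDef

variable {n : ℕ} {f g h : (Fin n → ℕ) → ℕ} {P Q : (Fin n → ℕ) → Set ℕ → Prop}

theorem of_iff (hP : BddDef P) (hPQ : ∀ v B, Q v B ↔ P v B) : BddDef Q := by
  rwa [show Q = P from funext fun v => funext fun B => propext (hPQ v B)]

theorem eq (hf : TermDef f) (hg : TermDef g) : BddDef fun v _ => f v = g v := by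
  obtain ⟨t, ht, ht'⟩ := hf
  obtain ⟨s, hs, hs'⟩ := hg
  exact ⟨.eq t s, .eq t s, Finset.union_subset ht hs, by simp [freeSet],
    fun 𝒮 h v V => by rw [sat_eq, ht', hs']⟩

theorem lt (hf : TermDef f) (hg : TermDef g) : BddDef fun v _ => f v < g v := by
  obtain ⟨t, ht, ht'⟩ := hf
  obtain ⟨s, hs, hs'⟩ := hg
  exact ⟨.lt t s, .lt t s, Finset.union_subset ht hs, by simp [freeSet],
    fun 𝒮 h v V => by rw [sat_lt, ht', hs']⟩

theorem mem (hf : TermDef f) : BddDef fun v B => f v ∈ B := by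
  obtain ⟨t, ht, ht'⟩ := hf
  exact ⟨.mem t 0, .mem t 0, ht, by simp [freeSet], fun 𝒮 h v V => by rw [sat_mem, ht']⟩

theorem imp (hP : BddDef P) (hQ : BddDef Q) : BddDef fun v B => P v B → Q v B := by
  obtain ⟨φ, h1, h2, h3, h4⟩ := hP
  obtain ⟨ψ, k1, k2, k3, k4⟩ := hQ
  exact ⟨.imp φ ψ, .imp h1 k1, Finset.union_subset h2 k2, Finset.union_subset h3 k3,
    fun 𝒮 h v V => by rw [sat_imp, h4, k4]⟩

theorem not (hP : BddDef P) : BddDef fun v B => ¬ P v B := by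
  obtain ⟨φ, h1, h2, h3, h4⟩ := hP
  exact ⟨φ.neg, h1.neg, Finset.union_subset h2 (by simp [freeNum]),
    Finset.union_subset h3 (by simp [freeSet]), fun 𝒮 h v V => by rw [sat_neg, h4]⟩

theorem and (hP : BddDef P) (hQ : BddDef Q) : BddDef fun v B => P v B ∧ Q v B :=
  (hP.imp hQ.not).not.of_iff fun _ _ => by tauto

theorem or (hP : BddDef P) (hQ : BddDef Q) : BddDef fun v B => P v B ∨ Q v B :=
  (hP.not.imp hQ).of_iff fun _ _ => by tauto

theorem ball {Q : (Fin n → ℕ) → ℕ → Set ℕ → Prop} (hf : TermDef f)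
    (hQ : BddDef fun (w : Fin (n + 1) → ℕ) B => Q (fun i => w i.castSucc) (w (Fin.last n)) B) :
    BddDef fun v B => ∀ a, a < f v → Q v a B := by
  obtain ⟨t, ht, ht'⟩ := hf
  obtain ⟨φ, h1, h2, h3, h4⟩ := hQ
  have hn : n ∉ t.vars := fun h => by simpa using ht h
  refine ⟨allNum n (.imp (.lt (.var n) t) φ), .ball hn h1, ?_, ?_, fun 𝒮 h v V => ?_⟩
  · intro i hi
    have ha := @ht i
    have hb := @h2 i
    simp only [freeNum, Term.vars, Finset.mem_erase, Finset.mem_union, Finset.mem_singleton,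
      Finset.mem_range] at hi ha hb ⊢
    rcases hi with ⟨hi, (h | h) | h⟩
    · exact absurd h hi
    · exact ha h
    · have := hb h
      omega
  · simpa [freeSet] using h3
  · simp only [sat_allNum, sat_imp, sat_lt, Term.val, Function.update_self, Term.val_update hn,
      ht', h4]
    refine forall_congr' fun a => ?_
    have e : (fun i : Fin n => Function.update v n a i.castSucc) = fun i : Fin n => v i :=
      funext fun i => Function.update_of_ne (by simpa using i.2.ne) _ _
    have e' : Function.update v n a (Fin.last n) = a := by simp
    rw [e, e']

theorem bex {Q : (Fin n → ℕ) → ℕ → Set ℕ → Prop} (hf : TermDef f)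
    (hQ : BddDef fun (w : Fin (n + 1) → ℕ) B => Q (fun i => w i.castSucc) (w (Fin.last n)) B) :
    BddDef fun v B => ∃ a, a < f v ∧ Q v a B :=
  (ball (Q := fun v a B => ¬ Q v a B) hf hQ.not).not.of_iff fun _ _ => by push Not; rfl

/-- An existential quantifier whose witnesses obey a bound. -/
theorem ex {Q : (Fin n → ℕ) → ℕ → Set ℕ → Prop} (hf : TermDef f)
    (hb : ∀ v a B, Q v a B → a < f v)
    (hQ : BddDef fun (w : Fin (n + 1) → ℕ) B => Q (fun i => w i.castSucc) (w (Fin.last n)) B) :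
    BddDef fun v B => ∃ a, Q v a B :=
  (bex hf hQ).of_iff fun v B => exists_congr fun a => ⟨fun h => ⟨hb v a B h, h⟩, And.right⟩

theorem pair (hh : TermDef h) (hf : TermDef f) (hg : TermDef g) :
    BddDef fun v _ => h v = Nat.pair (f v) (g v) := by
  refine (((lt hf hg).and (eq hh ((hg.mul hg).add hf))).or
    ((lt hf hg).not.and (eq hh (((hf.mul hf).add hf).add hg)))).of_iff fun v _ => ?_
  rw [Nat.pair]
  split_ifs with hlt <;> simp [hlt]

theorem dvd (hi : TermDef f) {i : Fin n} : BddDef fun v _ => f v ∣ v i := by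
  obtain ⟨t, ht, ht'⟩ := hi
  have hf : TermDef fun w : Fin (n + 1) → ℕ => f fun i => w i.castSucc :=
    ⟨t, ht.trans (Finset.range_mono (Nat.le_succ n)), fun 𝒮 h v => ht' 𝒮 h v⟩
  refine (bex ((TermDef.var i).add (TermDef.const 1))
    (Q := fun v a _ => v i = f v * a) (eq (.var _) (hf.mul (.var _)))).of_iff fun v _ => ?_
  constructor
  · rintro ⟨a, ha⟩
    by_cases h0 : f v = 0
    · exact ⟨0, by omega, by rw [ha, h0]; simp⟩
    · refine ⟨a, ?_, ha⟩
      have := Nat.le_mul_of_pos_left a (Nat.pos_of_ne_zero h0)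
      omega
  · rintro ⟨a, -, ha⟩
    exact ⟨a, ha⟩

end BddDef

/-! ### Finite computations with an oracle -/

/-- The code of the statement that the program with index `e` has the value `m` at `n`. -/
def tri (e n m : ℕ) : ℕ := Nat.pair e (Nat.pair n m)

theorem tri_inj {e n m e' n' m' : ℕ} : tri e n m = tri e' n' m' ↔ e = e' ∧ n = n' ∧ m = m' := by
  simp [tri, Nat.pair_eq_pair]

theorem le_tri (e n m : ℕ) : e ≤ tri e n m ∧ n ≤ tri e n m ∧ m ≤ tri e n m :=
  ⟨Nat.left_le_pair _ _, (Nat.left_le_pair n m).trans (Nat.right_le_pair _ _),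
    (Nat.right_le_pair n m).trans (Nat.right_le_pair _ _)⟩

/-- With oracle `B`, the statement coded by `tri e n m` follows from statements with codes in `D`
by one of the defining clauses of `OCode.eval`. -/
def Follows (B D : Set ℕ) (e n m : ℕ) : Prop :=
  (e = 0 ∧ m = 0) ∨ (e = 1 ∧ m = n + 1) ∨ (e = 2 ∧ ∃ b, n = Nat.pair m b) ∨
  (e = 3 ∧ ∃ a, n = Nat.pair a m) ∨ (e = 4 ∧ ((n ∈ B ∧ m = 1) ∨ (¬ n ∈ B ∧ m = 0))) ∨
  (∃ c d p, p = Nat.pair c d ∧ e = 4 * p + 5 ∧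
    ∃ x y, m = Nat.pair x y ∧ tri c n x ∈ D ∧ tri d n y ∈ D) ∨
  (∃ c d p, p = Nat.pair c d ∧ e = 4 * p + 6 ∧ ∃ y, tri d n y ∈ D ∧ tri c y m ∈ D) ∨
  (∃ c d p, p = Nat.pair c d ∧ e = 4 * p + 7 ∧ ∃ a k, n = Nat.pair a k ∧
    ((k = 0 ∧ tri c a m ∈ D) ∨ ∃ j i q r s, k = j + 1 ∧ q = Nat.pair a j ∧ r = Nat.pair j i ∧
      s = Nat.pair a r ∧ tri e q i ∈ D ∧ tri d s m ∈ D)) ∨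
  (∃ c, e = 4 * c + 8 ∧ (∃ q, q = Nat.pair n m ∧ tri c q 0 ∈ D) ∧
    ∀ k, k < m → ∃ y q, q = Nat.pair n k ∧ tri c q (y + 1) ∈ D)

/-- Every statement with code in `D` follows from statements with codes in `D`. -/
def IsDerivation (B D : Set ℕ) : Prop :=
  ∀ u, u ∈ D → ∃ e p n m, u = Nat.pair e p ∧ p = Nat.pair n m ∧ Follows B D e n m

theorem IsDerivation.follows {B D : Set ℕ} (h : IsDerivation B D) {e n m : ℕ}
    (hD : tri e n m ∈ D) : Follows B D e n m := by
  obtain ⟨e', _, n', m', h1, rfl, h3⟩ := h _ hD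
  obtain ⟨rfl, rfl, rfl⟩ := tri_inj.1 h1
  exact h3

theorem Follows.mono {B D D' : Set ℕ} (hD : D ⊆ D') {e n m : ℕ} (h : Follows B D e n m) :
    Follows B D' e n m := by
  rcases h with h | h | h | h | h | ⟨c, d, p, h1, h2, x, y, h3, h4, h5⟩ |
    ⟨c, d, p, h1, h2, y, h3, h4⟩ | ⟨c, d, p, h1, h2, a, k, h3, h4⟩ | ⟨c, h1, ⟨q, h2, h3⟩, h4⟩
  · exact .inl h
  · exact .inr (.inl h)
  · exact .inr (.inr (.inl h))
  · exact .inr (.inr (.inr (.inl h)))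
  · exact .inr (.inr (.inr (.inr (.inl h))))
  · exact .inr (.inr (.inr (.inr (.inr (.inl ⟨c, d, p, h1, h2, x, y, h3, hD h4, hD h5⟩)))))
  · exact .inr (.inr (.inr (.inr (.inr (.inr (.inl ⟨c, d, p, h1, h2, y, hD h3, hD h4⟩))))))
  · refine .inr (.inr (.inr (.inr (.inr (.inr (.inr (.inl ⟨c, d, p, h1, h2, a, k, h3, ?_⟩)))))))
    rcases h4 with ⟨h4, h5⟩ | ⟨j, i, q, r, s, h4, h5, h6, h7, h8, h9⟩
    · exact .inl ⟨h4, hD h5⟩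
    · exact .inr ⟨j, i, q, r, s, h4, h5, h6, h7, hD h8, hD h9⟩
  · refine .inr (.inr (.inr (.inr (.inr (.inr (.inr (.inr ⟨c, h1, ⟨q, h2, hD h3⟩, ?_⟩)))))))
    intro k hk
    obtain ⟨y, q, h5, h6⟩ := h4 k hk
    exact ⟨y, q, h5, hD h6⟩

theorem OCode.mem_eval_pair {B : Set ℕ} {c d : OCode} {n m : ℕ} : m ∈ (pair c d).eval B n ↔
    ∃ x y, x ∈ c.eval B n ∧ y ∈ d.eval B n ∧ m = Nat.pair x y := by
  simp only [eval, Seq.seq, Part.mem_bind_iff, Part.map_eq_map, Part.mem_map_iff]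
  constructor
  · rintro ⟨_, ⟨x, hx, rfl⟩, y, hy, rfl⟩
    exact ⟨x, y, hx, hy, rfl⟩
  · rintro ⟨x, y, hx, hy, rfl⟩
    exact ⟨_, ⟨x, hx, rfl⟩, y, hy, rfl⟩

theorem OCode.mem_eval_comp {B : Set ℕ} {c d : OCode} {n m : ℕ} : m ∈ (comp c d).eval B n ↔
    ∃ y ∈ d.eval B n, m ∈ c.eval B y :=
  Part.mem_bind_iff

theorem OCode.mem_eval_prec_zero {B : Set ℕ} {c d : OCode} {a m : ℕ} :
    m ∈ (prec c d).eval B (Nat.pair a 0) ↔ m ∈ c.eval B a := by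
  simp [eval]

theorem OCode.mem_eval_prec_succ {B : Set ℕ} {c d : OCode} {a k m : ℕ} :
    m ∈ (prec c d).eval B (Nat.pair a (k + 1)) ↔ ∃ i ∈ (prec c d).eval B (Nat.pair a k),
      m ∈ d.eval B (Nat.pair a (Nat.pair k i)) := by
  simp only [eval, Nat.unpair_pair]
  exact Part.mem_bind_iff

theorem OCode.mem_eval_rfind {B : Set ℕ} {c : OCode} {n m : ℕ} : m ∈ (rfind c).eval B n ↔
    0 ∈ c.eval B (Nat.pair n m) ∧ ∀ k, k < m → ∃ y, y + 1 ∈ c.eval B (Nat.pair n k) := by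
  refine Nat.mem_rfind.trans (and_congr ?_ (forall₂_congr fun k _ => ?_))
  · simp
  · simp only [Part.map_eq_map, Part.mem_map_iff, decide_eq_false_iff_not]
    exact ⟨fun ⟨y, hy, h0⟩ => ⟨y - 1, by rwa [Nat.sub_add_cancel (Nat.pos_of_ne_zero h0)]⟩,
      fun ⟨y, hy⟩ => ⟨_, hy, Nat.succ_ne_zero y⟩⟩

theorem IsDerivation.eval {B D : Set ℕ} (h : IsDerivation B D) (c : OCode) {n m : ℕ}
    (hD : tri c.index n m ∈ D) : m ∈ c.eval B n := by
  have hinj : ∀ {c d c' d' : ℕ}, Nat.pair c d = Nat.pair c' d' → c' = c ∧ d' = d :=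
    fun h => by simpa [eq_comm] using Nat.pair_eq_pair.1 h
  induction c generalizing n m with
  | zero =>
    have hf := h.follows hD
    simp only [Follows, OCode.index] at hf
    simp only [OCode.eval, Part.mem_some_iff]
    rcases hf with h | h | h | h | h | ⟨_, _, p, _, h, _⟩ | ⟨_, _, p, _, h, _⟩ |
      ⟨_, _, p, _, h, _⟩ | ⟨c, h, _⟩ <;> omega
  | succ =>
    have hf := h.follows hD
    simp only [Follows, OCode.index] at hf
    simp only [OCode.eval, Part.mem_some_iff]
    rcases hf with h | h | h | h | h | ⟨_, _, p, _, h, _⟩ | ⟨_, _, p, _, h, _⟩ |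
      ⟨_, _, p, _, h, _⟩ | ⟨c, h, _⟩ <;> omega
  | left =>
    have hf := h.follows hD
    simp only [Follows, OCode.index] at hf
    simp only [OCode.eval, Part.mem_some_iff]
    rcases hf with h | h | ⟨-, b, h⟩ | h | h | ⟨_, _, p, _, h, _⟩ | ⟨_, _, p, _, h, _⟩ |
      ⟨_, _, p, _, h, _⟩ | ⟨c, h, _⟩
    on_goal 3 => simp [h]
    all_goals omega
  | right =>
    have hf := h.follows hD
    simp only [Follows, OCode.index] at hf
    simp only [OCode.eval, Part.mem_some_iff]
    rcases hf with h | h | h | ⟨-, b, h⟩ | h | ⟨_, _, p, _, h, _⟩ | ⟨_, _, p, _, h, _⟩ |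
      ⟨_, _, p, _, h, _⟩ | ⟨c, h, _⟩
    on_goal 4 => simp [h]
    all_goals omega
  | oracle =>
    have hf := h.follows hD
    simp only [Follows, OCode.index] at hf
    simp only [OCode.eval, charFun, Part.mem_some_iff]
    rcases hf with h | h | h | h | ⟨-, h⟩ | ⟨_, _, p, _, h, _⟩ | ⟨_, _, p, _, h, _⟩ |
      ⟨_, _, p, _, h, _⟩ | ⟨c, h, _⟩
    on_goal 5 => rcases h with ⟨h, rfl⟩ | ⟨h, rfl⟩ <;> simp [h]
    all_goals omega
  | pair c d ihc ihd =>
    have hf := h.follows hD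
    simp only [Follows, OCode.index] at hf
    rcases hf with h | h | h | h | h | ⟨c', d', p, hp, h, x, y, h1, h2, h3⟩ |
      ⟨_, _, p, _, h, _⟩ | ⟨_, _, p, _, h, _⟩ | ⟨c, h, _⟩
    on_goal 6 =>
      obtain rfl : Nat.pair c.index d.index = p := by omega
      obtain ⟨rfl, rfl⟩ := hinj hp
      exact OCode.mem_eval_pair.2 ⟨x, y, ihc h2, ihd h3, h1⟩
    all_goals omega
  | comp c d ihc ihd =>
    have hf := h.follows hD
    simp only [Follows, OCode.index] at hf
    rcases hf with h | h | h | h | h | ⟨_, _, p, _, h, _⟩ | ⟨c', d', p, hp, h, y, h1, h2⟩ |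
      ⟨_, _, p, _, h, _⟩ | ⟨c, h, _⟩
    on_goal 7 =>
      obtain rfl : Nat.pair c.index d.index = p := by omega
      obtain ⟨rfl, rfl⟩ := hinj hp
      exact OCode.mem_eval_comp.2 ⟨y, ihd h1, ihc h2⟩
    all_goals omega
  | prec c d ihc ihd =>
    have key : ∀ k a m, tri (OCode.prec c d).index (Nat.pair a k) m ∈ D →
        m ∈ (OCode.prec c d).eval B (Nat.pair a k) := by
      intro k
      induction k with
      | zero =>
        intro a m hD
        have hf := h.follows hD
        simp only [Follows, OCode.index] at hf
        rcases hf with h | h | h | h | h | ⟨_, _, p, _, h, _⟩ | ⟨_, _, p, _, h, _⟩ |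
          ⟨c', d', p, hp, h, a', k', hn, h1⟩ | ⟨c, h, _⟩
        on_goal 8 =>
          obtain rfl : Nat.pair c.index d.index = p := by omega
          obtain ⟨rfl, rfl⟩ := hinj hp
          obtain ⟨rfl, rfl⟩ := hinj hn
          rcases h1 with ⟨-, h1⟩ | ⟨j, i, q, r, s, h1, -⟩
          · exact OCode.mem_eval_prec_zero.2 (ihc h1)
        all_goals omega
      | succ k ih =>
        intro a m hD
        have hf := h.follows hD
        simp only [Follows, OCode.index] at hf
        rcases hf with h | h | h | h | h | ⟨_, _, p, _, h, _⟩ | ⟨_, _, p, _, h, _⟩ |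
          ⟨c', d', p, hp, h, a', k', hn, h1⟩ | ⟨c, h, _⟩
        on_goal 8 =>
          obtain rfl : Nat.pair c.index d.index = p := by omega
          obtain ⟨rfl, rfl⟩ := hinj hp
          obtain ⟨rfl, rfl⟩ := hinj hn
          rcases h1 with ⟨h1, -⟩ | ⟨j, i, q, r, s, h1, rfl, rfl, rfl, h2, h3⟩
          on_goal 2 =>
            obtain rfl : k = j := by omega
            exact OCode.mem_eval_prec_succ.2 ⟨i, ih _ _ h2, ihd h3⟩
        all_goals omega
    have := key n.unpair.2 n.unpair.1 m
    rw [Nat.pair_unpair] at this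
    exact this hD
  | rfind c ih =>
    have hf := h.follows hD
    simp only [Follows, OCode.index] at hf
    rcases hf with h | h | h | h | h | ⟨_, _, p, _, h, _⟩ | ⟨_, _, p, _, h, _⟩ |
      ⟨_, _, p, _, h, _⟩ | ⟨c', h, ⟨q, rfl, h2⟩, h3⟩
    on_goal 9 =>
      obtain rfl : c.index = c' := by omega
      refine OCode.mem_eval_rfind.2 ⟨ih h2, fun k hk => ?_⟩
      obtain ⟨y, _, rfl, h4⟩ := h3 k hk
      exact ⟨y, ih h4⟩
    all_goals omega

/-- The statement `tri e n m` belongs to a finite derivation. -/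
def Derivable (B : Set ℕ) (e n m : ℕ) : Prop :=
  ∃ D : Finset ℕ, IsDerivation B D ∧ tri e n m ∈ D

theorem derivable_of_follows {B : Set ℕ} {D : Finset ℕ} (hD : IsDerivation B D) {e n m : ℕ}
    (h : Follows B D e n m) : Derivable B e n m := by
  refine ⟨insert (tri e n m) D, ?_, by simp⟩
  have hsub : (D : Set ℕ) ⊆ (insert (tri e n m) D : Finset ℕ) := by simp
  intro u hu
  rcases Finset.mem_insert.1 (Finset.mem_coe.1 hu) with rfl | hu
  · exact ⟨e, _, n, m, rfl, rfl, h.mono hsub⟩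
  · obtain ⟨e', p', n', m', h1, h2, h3⟩ := hD u hu
    exact ⟨e', p', n', m', h1, h2, h3.mono hsub⟩

theorem IsDerivation.iUnion {ι : Type*} {B : Set ℕ} {D : ι → Set ℕ}
    (h : ∀ i, IsDerivation B (D i)) : IsDerivation B (⋃ i, D i) := by
  intro u hu
  obtain ⟨i, hi⟩ := Set.mem_iUnion.1 hu
  obtain ⟨e', p', n', m', h1, h2, h3⟩ := h i u hi
  exact ⟨e', p', n', m', h1, h2, h3.mono (Set.subset_iUnion D i)⟩

/-- Finitely many derivable statements have a common derivation. -/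
theorem exists_common_derivation {B : Set ℕ} (S : Finset ℕ)
    (h : ∀ u ∈ S, ∃ D : Finset ℕ, IsDerivation B D ∧ u ∈ D) :
    ∃ D : Finset ℕ, IsDerivation B D ∧ ∀ u ∈ S, u ∈ D := by
  choose! D hD hu using h
  refine ⟨S.biUnion D, ?_, fun u h => Finset.mem_biUnion.2 ⟨u, h, hu u h⟩⟩
  have : ((S.biUnion D : Finset ℕ) : Set ℕ) = ⋃ u : S, (D u : Set ℕ) := by
    ext; simp
  rw [this]
  exact IsDerivation.iUnion fun u => hD u u.2

theorem derivable_of_eval {B : Set ℕ} (c : OCode) {n m : ℕ} (h : m ∈ c.eval B n) :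
    Derivable B c.index n m := by
  have hempty : IsDerivation B (∅ : Finset ℕ) := fun u hu => by simp at hu
  induction c generalizing n m with
  | zero =>
    simp only [OCode.eval, Part.mem_some_iff] at h
    exact derivable_of_follows hempty (.inl ⟨rfl, h⟩)
  | succ =>
    simp only [OCode.eval, Part.mem_some_iff] at h
    exact derivable_of_follows hempty (.inr (.inl ⟨rfl, h⟩))
  | left =>
    simp only [OCode.eval, Part.mem_some_iff] at h
    exact derivable_of_follows hempty (.inr (.inr (.inl ⟨rfl, n.unpair.2, by simp [h]⟩)))
  | right =>
    simp only [OCode.eval, Part.mem_some_iff] at h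
    exact derivable_of_follows hempty (.inr (.inr (.inr (.inl ⟨rfl, n.unpair.1, by simp [h]⟩))))
  | oracle =>
    simp only [OCode.eval, charFun, Part.mem_some_iff] at h
    refine derivable_of_follows hempty (.inr (.inr (.inr (.inr (.inl ⟨rfl, ?_⟩)))))
    by_cases hn : n ∈ B <;> simpa [hn] using h
  | pair c d ihc ihd =>
    obtain ⟨x, y, hx, hy, rfl⟩ := OCode.mem_eval_pair.1 h
    obtain ⟨D, hD, hDm⟩ := exists_common_derivation {tri c.index n x, tri d.index n y} (by
      simpa [Derivable] using And.intro (ihc hx) (ihd hy))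
    exact derivable_of_follows hD (.inr (.inr (.inr (.inr (.inr (.inl
      ⟨_, _, _, rfl, rfl, x, y, rfl, hDm _ (by simp), hDm _ (by simp)⟩))))))
  | comp c d ihc ihd =>
    obtain ⟨y, hy, hm⟩ := OCode.mem_eval_comp.1 h
    obtain ⟨D, hD, hDm⟩ := exists_common_derivation {tri d.index n y, tri c.index y m} (by
      simpa [Derivable] using And.intro (ihd hy) (ihc hm))
    exact derivable_of_follows hD (.inr (.inr (.inr (.inr (.inr (.inr (.inl
      ⟨_, _, _, rfl, rfl, y, hDm _ (by simp), hDm _ (by simp)⟩)))))))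
  | prec c d ihc ihd =>
    have key : ∀ k a m, m ∈ (OCode.prec c d).eval B (Nat.pair a k) →
        Derivable B (OCode.prec c d).index (Nat.pair a k) m := by
      intro k
      induction k with
      | zero =>
        intro a m h
        obtain ⟨D, hD, hDm⟩ := ihc (n := a) (m := m) (OCode.mem_eval_prec_zero.1 h)
        exact derivable_of_follows hD (.inr (.inr (.inr (.inr (.inr (.inr (.inr (.inl
          ⟨_, _, _, rfl, rfl, a, 0, rfl, .inl ⟨rfl, hDm⟩⟩))))))))
      | succ k ih =>
        intro a m h
        obtain ⟨i, hi, hm⟩ := OCode.mem_eval_prec_succ.1 h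
        obtain ⟨D, hD, hDm⟩ := exists_common_derivation
          {tri (OCode.prec c d).index (Nat.pair a k) i,
            tri d.index (Nat.pair a (Nat.pair k i)) m} (by
          simpa [Derivable] using And.intro (ih a i hi) (ihd hm))
        exact derivable_of_follows hD (.inr (.inr (.inr (.inr (.inr (.inr (.inr (.inl
          ⟨_, _, _, rfl, rfl, a, k + 1, rfl, .inr ⟨k, i, _, _, _, rfl, rfl, rfl, rfl,
            hDm _ (by simp [OCode.index]), hDm _ (by simp)⟩⟩))))))))
    have := key n.unpair.2 n.unpair.1 m
    rw [Nat.pair_unpair] at this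
    exact this h
  | rfind c ih =>
    obtain ⟨hz, hlt⟩ := OCode.mem_eval_rfind.1 h
    choose! y hy using hlt
    obtain ⟨D, hD, hDm⟩ := exists_common_derivation
      (insert (tri c.index (Nat.pair n m) 0)
        ((Finset.range m).image fun k => tri c.index (Nat.pair n k) (y k + 1))) (by
      intro u hu
      rcases Finset.mem_insert.1 hu with rfl | hu
      · exact ih hz
      · obtain ⟨k, hk, rfl⟩ := Finset.mem_image.1 hu
        exact ih (hy k (Finset.mem_range.1 hk)))
    exact derivable_of_follows hD (.inr (.inr (.inr (.inr (.inr (.inr (.inr (.inr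
      ⟨_, rfl, ⟨_, rfl, hDm _ (by simp)⟩, fun k hk => ⟨y k, _, rfl,
        hDm _ (Finset.mem_insert_of_mem (Finset.mem_image.2 ⟨k, by simpa using hk, rfl⟩))⟩⟩))))))))

/-! ### Coding finite sets by divisibility -/

/-- The finite set with the code `a`, `b`, `K`: the numbers `u < K` such that the modulus
`(u + 1) * b + 1` divides `a`. -/
def codedSet (a b K : ℕ) : Set ℕ := {u | u < K ∧ (u + 1) * b + 1 ∣ a}

theorem coprime_moduli {K u w : ℕ} (hu : u < K) (hw : w < K) (h : u ≠ w) :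
    Nat.Coprime ((u + 1) * K.factorial + 1) ((w + 1) * K.factorial + 1) := by
  wlog hlt : u < w generalizing u w
  · exact (this hw hu h.symm (by omega)).symm
  refine Nat.coprime_of_dvd fun p hp h1 h2 => ?_
  have h3 : p ∣ (w - u) * K.factorial := by
    have := Nat.dvd_sub h2 h1
    have e : (w + 1) * K.factorial + 1 - ((u + 1) * K.factorial + 1) =
        (w - u) * K.factorial := by
      rw [Nat.add_sub_add_right, ← Nat.sub_mul, Nat.add_sub_add_right]
    rwa [e] at this
  have h4 : p ∣ K.factorial := by
    rcases hp.dvd_mul.1 h3 with h | h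
    · exact h.trans (Nat.dvd_factorial (by omega) (by omega))
    · exact h
  have h5 : p ∣ 1 := (Nat.dvd_add_right (h4.mul_left (u + 1))).1 h1
  exact hp.one_lt.ne' (Nat.dvd_one.1 h5)

theorem exists_codedSet_eq (D : Finset ℕ) : ∃ a b K, codedSet a b K = D := by
  set K := D.sup id + 1 with hK
  have hlt : ∀ u ∈ D, u < K := fun u hu => Nat.lt_succ_of_le (Finset.le_sup (f := id) hu)
  refine ⟨∏ u ∈ D, ((u + 1) * K.factorial + 1), K.factorial, K, Set.ext fun u => ?_⟩
  constructor
  · rintro ⟨huK, hu⟩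
    by_contra hD
    have hcop : Nat.Coprime ((u + 1) * K.factorial + 1) (∏ w ∈ D, ((w + 1) * K.factorial + 1)) :=
      Nat.Coprime.prod_right fun w hw => coprime_moduli huK (hlt w hw) fun h => hD (h ▸ hw)
    have h1 := Nat.Coprime.eq_one_of_dvd hcop hu
    exact (Nat.mul_pos (Nat.succ_pos u) K.factorial_pos).ne' (Nat.succ_injective h1)
  · intro hu
    exact ⟨hlt u hu, Finset.dvd_prod_of_mem (fun u => (u + 1) * K.factorial + 1) hu⟩

/-- A finite computation with code below `w` shows that the program with index `e` has the
value `m` at `n`. -/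
def Run (B : Set ℕ) (w e n m : ℕ) : Prop :=
  ∃ a, a < w ∧ ∃ b, b < w ∧ ∃ K, K < w ∧
    IsDerivation B (codedSet a b K) ∧ tri e n m ∈ codedSet a b K

/-- Kleene's normal form: values are the results of finite computations. -/
theorem mem_eval_iff_run {B : Set ℕ} (c : OCode) {n m : ℕ} :
    m ∈ c.eval B n ↔ ∃ w, Run B w c.index n m := by
  constructor
  · intro h
    obtain ⟨D, hD, hm⟩ := derivable_of_eval c h
    obtain ⟨a, b, K, hc⟩ := exists_codedSet_eq D
    rw [← hc] at hD
    exact ⟨a + b + K + 1, a, by omega, b, by omega, K, by omega, hD, hc ▸ hm⟩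
  · rintro ⟨w, a, -, b, -, K, -, hD, hm⟩
    exact hD.eval c hm

theorem OCode.index_surjective : Function.Surjective OCode.index := by
  intro n
  induction n using Nat.strong_induction_on with
  | _ n ih =>
    by_cases hn : n < 5
    · interval_cases n
      exacts [⟨.zero, rfl⟩, ⟨.succ, rfl⟩, ⟨.left, rfl⟩, ⟨.right, rfl⟩, ⟨.oracle, rfl⟩]
    · obtain ⟨k, hk⟩ : ∃ k, k = (n - 5) / 4 := ⟨_, rfl⟩
      have h1 := Nat.unpair_left_le k
      have h2 := Nat.unpair_right_le k
      obtain ⟨c, hc⟩ := ih k.unpair.1 (by omega)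
      obtain ⟨d, hd⟩ := ih k.unpair.2 (by omega)
      obtain ⟨c', hc'⟩ := ih k (by omega)
      have hp : Nat.pair c.index d.index = k := by rw [hc, hd, Nat.pair_unpair]
      have : n = 4 * k + 5 ∨ n = 4 * k + 6 ∨ n = 4 * k + 7 ∨ n = 4 * k + 8 := by omega
      rcases this with h | h | h | h
      · exact ⟨.pair c d, by rw [index, hp, h]⟩
      · exact ⟨.comp c d, by rw [index, hp, h]⟩
      · exact ⟨.prec c d, by rw [index, hp, h]⟩
      · exact ⟨.rfind c', by rw [index, hc', h]⟩

theorem mem_jump_iff {B : Set ℕ} {e : ℕ} : e ∈ jump B ↔ ∃ w m, Run B w e e m := by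
  constructor
  · rintro ⟨c, rfl, h⟩
    obtain ⟨m, hm⟩ := Part.dom_iff_mem.1 h
    obtain ⟨w, hw⟩ := (mem_eval_iff_run c).1 hm
    exact ⟨w, m, hw⟩
  · rintro ⟨w, m, h⟩
    obtain ⟨c, rfl⟩ := OCode.index_surjective e
    exact ⟨c, rfl, Part.dom_iff_mem.2 ⟨m, (mem_eval_iff_run c).2 ⟨w, h⟩⟩⟩

end Frac

namespace Frac

open Formula

/-! ### The jump formula -/

theorem TermDef.lift {n : ℕ} {f : (Fin n → ℕ) → ℕ} (hf : TermDef f) :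
    TermDef fun w : Fin (n + 1) → ℕ => f fun i => w i.castSucc := by
  obtain ⟨t, ht, ht'⟩ := hf
  exact ⟨t, ht.trans (Finset.range_mono (Nat.le_succ n)), fun 𝒮 h v => ht' 𝒮 h v⟩

theorem lt_of_tri_mem {e n m a b K : ℕ} (h : tri e n m ∈ codedSet a b K) :
    e < K ∧ n < K ∧ m < K := by
  have h1 := le_tri e n m
  have h2 : tri e n m < K := h.1
  omega

namespace BddDef

variable {n : ℕ} {f g h : (Fin n → ℕ) → ℕ}

theorem tri_mem (hf : TermDef f) (hg : TermDef g) (hh : TermDef h) (a b K : Fin n) :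
    BddDef fun v _ => tri (f v) (g v) (h v) ∈ codedSet (v a) (v b) (v K) := by
  have key : BddDef fun v _ => ∃ p u, p = Nat.pair (g v) (h v) ∧ u = Nat.pair (f v) p ∧
      u < v K ∧ (u + 1) * v b + 1 ∣ v a := by
    refine ex (f := fun v => v K) (.var _) ?_ (ex (f := fun v => v K.castSucc) (.var _) ?_
      (and (pair (.var _) hg.lift.lift hh.lift.lift) (and (pair (.var _) hf.lift.lift (.var _))
        (and (lt (.var _) (.var _))
          (dvd (.add (.mul (.add (.var _) (.const 1)) (.var _)) (.const 1)))))))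
    · rintro v p B ⟨u, -, rfl, hu, -⟩
      exact (Nat.right_le_pair _ _).trans_lt hu
    · rintro v u B ⟨-, -, hu, -⟩
      exact hu
  refine key.of_iff fun v B => ⟨fun h => ⟨_, _, rfl, rfl, h⟩, ?_⟩
  rintro ⟨_, _, rfl, rfl, h⟩
  exact h

theorem follows (e x m a b K : Fin n) : BddDef fun v B =>
    Follows B (codedSet (v a) (v b) (v K)) (v e) (v x) (v m) := by
  refine or (and (eq (.var _) (.const 0)) (eq (.var _) (.const 0)))
    (or (and (eq (.var _) (.const 1)) (eq (.var _) (.add (.var _) (.const 1))))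
    (or (and (eq (.var _) (.const 2)) ?_) (or (and (eq (.var _) (.const 3)) ?_)
    (or (and (eq (.var _) (.const 4)) (or (and (mem (.var _)) (eq (.var _) (.const 1)))
      (and (not (mem (.var _))) (eq (.var _) (.const 0))))) (or ?_ (or ?_ (or ?_ ?_)))))))
  · refine ex (f := fun v => v x + 1) (.add (.var _) (.const 1)) ?_
      (pair (.var _) (.var _) (.var _))
    intro v b B h
    exact Nat.lt_succ_of_le ((Nat.right_le_pair _ _).trans_eq h.symm)
  · refine ex (f := fun v => v x + 1) (.add (.var _) (.const 1)) ?_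
      (pair (.var _) (.var _) (.var _))
    intro v b B h
    exact Nat.lt_succ_of_le ((Nat.left_le_pair _ _).trans_eq h.symm)
  · refine ex (f := fun v => v e) (.var _) ?_ (ex (f := fun v => v e.castSucc) (.var _) ?_
      (ex (f := fun v => v e.castSucc.castSucc) (.var _) ?_
      (and (pair (.var _) (.var _) (.var _))
      (and (eq (.var _) (.add (.mul (.const 4) (.var _)) (.const 5)))
      (ex (f := fun v => v K.castSucc.castSucc.castSucc) (.var _) ?_
      (ex (f := fun v => v K.castSucc.castSucc.castSucc.castSucc) (.var _) ?_
      (and (pair (.var _) (.var _) (.var _))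
      (and (tri_mem (.var _) (.var _) (.var _) _ _ _)
        (tri_mem (.var _) (.var _) (.var _) _ _ _)))))))))
    · rintro v c B ⟨d, p, rfl, h, -⟩
      have := Nat.left_le_pair c d
      omega
    · rintro v d B ⟨p, rfl, h, -⟩
      have := Nat.right_le_pair (v (Fin.last n)) d
      dsimp only at h ⊢
      omega
    · rintro v p B ⟨-, h, -⟩
      dsimp only at h ⊢
      omega
    · rintro v y B ⟨_, -, h, -⟩
      exact (lt_of_tri_mem h).2.2
    · rintro v y B ⟨-, -, h⟩
      exact (lt_of_tri_mem h).2.2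
  · refine ex (f := fun v => v e) (.var _) ?_ (ex (f := fun v => v e.castSucc) (.var _) ?_
      (ex (f := fun v => v e.castSucc.castSucc) (.var _) ?_
      (and (pair (.var _) (.var _) (.var _))
      (and (eq (.var _) (.add (.mul (.const 4) (.var _)) (.const 6)))
      (ex (f := fun v => v K.castSucc.castSucc.castSucc) (.var _) ?_
      (and (tri_mem (.var _) (.var _) (.var _) _ _ _)
        (tri_mem (.var _) (.var _) (.var _) _ _ _)))))))
    · rintro v c B ⟨d, p, rfl, h, -⟩
      have := Nat.left_le_pair c d
      omega
    · rintro v d B ⟨p, rfl, h, -⟩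
      have := Nat.right_le_pair (v (Fin.last n)) d
      dsimp only at h ⊢
      omega
    · rintro v p B ⟨-, h, -⟩
      dsimp only at h ⊢
      omega
    · rintro v y B ⟨h, -⟩
      exact (lt_of_tri_mem h).2.2
  · refine ex (f := fun v => v e) (.var _) ?_ (ex (f := fun v => v e.castSucc) (.var _) ?_
      (ex (f := fun v => v e.castSucc.castSucc) (.var _) ?_
      (and (pair (.var _) (.var _) (.var _))
      (and (eq (.var _) (.add (.mul (.const 4) (.var _)) (.const 7)))
      (ex (f := fun v => v x.castSucc.castSucc.castSucc + 1) (.add (.var _) (.const 1)) ?_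
      (ex (f := fun v => v x.castSucc.castSucc.castSucc.castSucc + 1)
        (.add (.var _) (.const 1)) ?_
      (and (pair (.var _) (.var _) (.var _))
      (or (and (eq (.var _) (.const 0)) (tri_mem (.var _) (.var _) (.var _) _ _ _))
      (ex (f := fun v => v (Fin.last _)) (.var _) ?_
      (ex (f := fun v => v K.castSucc.castSucc.castSucc.castSucc.castSucc.castSucc) (.var _) ?_
      (ex (f := fun v => v K.castSucc.castSucc.castSucc.castSucc.castSucc.castSucc.castSucc)
        (.var _) ?_
      (ex (f := fun v => v
        K.castSucc.castSucc.castSucc.castSucc.castSucc.castSucc.castSucc.castSucc) (.var _) ?_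
      (ex (f := fun v => v
        K.castSucc.castSucc.castSucc.castSucc.castSucc.castSucc.castSucc.castSucc.castSucc)
        (.var _) ?_
      (and (eq (.var _) (.add (.var _) (.const 1)))
      (and (pair (.var _) (.var _) (.var _)) (and (pair (.var _) (.var _) (.var _))
      (and (pair (.var _) (.var _) (.var _)) (and (tri_mem (.var _) (.var _) (.var _) _ _ _)
        (tri_mem (.var _) (.var _) (.var _) _ _ _)))))))))))))))))))
    · rintro v c B ⟨d, p, rfl, h, -⟩
      have := Nat.left_le_pair c d
      omega
    · rintro v d B ⟨p, rfl, h, -⟩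
      have := Nat.right_le_pair (v (Fin.last n)) d
      dsimp only at h ⊢
      omega
    · rintro v p B ⟨-, h, -⟩
      dsimp only at h ⊢
      omega
    · rintro v a B ⟨k, h, -⟩
      exact Nat.lt_succ_of_le ((Nat.left_le_pair _ _).trans_eq h.symm)
    · rintro v k B ⟨h, -⟩
      exact Nat.lt_succ_of_le ((Nat.right_le_pair _ _).trans_eq h.symm)
    · rintro v j B ⟨i, q, r, s, h, -⟩
      exact (Nat.lt_succ_self j).trans_eq h.symm
    · rintro v i B ⟨q, r, s, -, -, -, -, h, -⟩
      exact (lt_of_tri_mem h).2.2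
    · rintro v q B ⟨r, s, -, -, -, -, h, -⟩
      exact (lt_of_tri_mem h).2.1
    · rintro v r B ⟨s, -, -, -, h, -, h'⟩
      have h'' := (lt_of_tri_mem h').2.1
      exact (h ▸ Nat.right_le_pair _ r : r ≤ s).trans_lt h''
    · rintro v s B ⟨-, -, -, -, -, h⟩
      exact (lt_of_tri_mem h).2.1
  · refine ex (f := fun v => v e) (.var _) ?_
      (and (eq (.var _) (.add (.mul (.const 4) (.var _)) (.const 8)))
      (and (ex (f := fun v => v K.castSucc) (.var _) ?_
        (and (pair (.var _) (.var _) (.var _)) (tri_mem (.var _) (.var _) (.const 0) _ _ _)))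
      (ball (.var _) (ex (f := fun v => v K.castSucc.castSucc) (.var _) ?_
        (ex (f := fun v => v K.castSucc.castSucc.castSucc) (.var _) ?_
        (and (pair (.var _) (.var _) (.var _))
          (tri_mem (.var _) (.var _) (.add (.var _) (.const 1)) _ _ _)))))))
    · rintro v c B ⟨h, -⟩
      omega
    · rintro v q B ⟨-, h⟩
      exact (lt_of_tri_mem h).2.1
    · rintro v y B ⟨q, -, h⟩
      exact (Nat.lt_succ_self y).trans (lt_of_tri_mem h).2.2
    · rintro v q B ⟨-, h⟩
      exact (lt_of_tri_mem h).2.1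

theorem isDerivation (a b K : Fin n) :
    BddDef fun v B => IsDerivation B (codedSet (v a) (v b) (v K)) := by
  have key : BddDef fun v B => ∀ u, u < v K → (u + 1) * v b + 1 ∣ v a → ∃ e p n m,
      u = Nat.pair e p ∧ p = Nat.pair n m ∧
        Follows B (codedSet (v a) (v b) (v K)) e n m := by
    refine ball (.var _) (imp (dvd (.add (.mul (.add (.var _) (.const 1)) (.var _)) (.const 1)))
      (ex (f := fun v => v (Fin.last _) + 1) (.add (.var _) (.const 1)) ?_
      (ex (f := fun v => v (Fin.last _).castSucc + 1) (.add (.var _) (.const 1)) ?_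
      (ex (f := fun v => v (Fin.last _) + 1) (.add (.var _) (.const 1)) ?_
      (ex (f := fun v => v (Fin.last _).castSucc + 1) (.add (.var _) (.const 1)) ?_
      (and (pair (.var _) (.var _) (.var _))
      (and (pair (.var _) (.var _) (.var _)) (follows _ _ _ _ _ _))))))))
    · rintro v e B ⟨p, n, m, h, -⟩
      exact Nat.lt_succ_of_le ((Nat.left_le_pair _ _).trans_eq h.symm)
    · rintro v p B ⟨n, m, h, -⟩
      exact Nat.lt_succ_of_le ((Nat.right_le_pair _ _).trans_eq h.symm)
    · rintro v n' B ⟨m, -, h, -⟩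
      exact Nat.lt_succ_of_le ((Nat.left_le_pair _ _).trans_eq h.symm)
    · rintro v m B ⟨-, h, -⟩
      exact Nat.lt_succ_of_le ((Nat.right_le_pair _ _).trans_eq h.symm)
  exact key.of_iff fun v B => ⟨fun h u h1 h2 => h u ⟨h1, h2⟩, fun h u hu => h u hu.1 hu.2⟩

theorem run (w : Fin n) (hf : TermDef f) (hg : TermDef g) (hh : TermDef h) :
    BddDef fun v B => Run B (v w) (f v) (g v) (h v) :=
  bex (.var _) (bex (.var _) (bex (.var _) (and (isDerivation _ _ _)
    (tri_mem hf.lift.lift.lift hg.lift.lift.lift hh.lift.lift.lift _ _ _))))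

end BddDef

/-- A relation with a bounded definition yields, by existential quantification over its second
variable, an operator in all `ω`-structures. -/
theorem BddDef.exists_operator {P : (Fin 2 → ℕ) → Set ℕ → Prop} (hP : BddDef P) :
    ∃ θ : Formula, θ.IsBounded ∧ (exNum 1 θ).IsOperator ∧ (allNum 1 θ).IsOperator ∧
      ∀ (𝒮 : Set (Set ℕ)) (h : 𝒮.Nonempty) (v : ℕ → ℕ) (V : ℕ → Set ℕ),
        θ.Sat (omegaModel 𝒮 h) v V ↔ P ![v 0, v 1] (V 0) := by
  obtain ⟨θ, h1, h2, h3, h4⟩ := hP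
  have hfree : θ.freeNum.erase 1 ⊆ {0} := fun i hi => by
    have := Finset.mem_erase.1 hi
    have := Finset.mem_range.1 (h2 this.2)
    rw [Finset.mem_singleton]
    omega
  refine ⟨θ, h1, ⟨?_, ?_⟩, ⟨hfree, h3⟩, fun 𝒮 h v V => ?_⟩
  · simpa [exNum, Formula.neg, freeNum] using hfree
  · simpa [exNum, Formula.neg, freeSet] using h3
  · rw [h4, show (fun i : Fin 2 => v i) = ![v 0, v 1] from by ext i; fin_cases i <;> rfl]

theorem exists_isJumpFormula : ∃ J, IsJumpFormula J := by
  have hP : BddDef fun (v : Fin 2 → ℕ) B => ∃ m, m < v 1 ∧ Run B (v 1) (v 0) (v 0) m :=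
    .bex (.var _) (.run _ (.var _) (.var _) (.var _))
  obtain ⟨θ, h1, h2, -, h3⟩ := hP.exists_operator
  refine ⟨exNum 1 θ, ⟨θ, h1, rfl⟩, h2, fun 𝒮 h X => Set.ext fun x => ?_⟩
  rw [mem_jump_iff]
  refine Iff.trans (b := ∃ w m, m < w ∧ Run X w x x m) ?_ (exists_congr fun w => exists_congr
    fun m => ⟨And.right, fun h' => ⟨?_, h'⟩⟩)
  · change (exNum 1 θ).Sat (omegaModel 𝒮 h) (fun _ => x) (fun _ => X) ↔ _
    rw [sat_exNum]
    refine exists_congr fun w => ?_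
    rw [h3]
    simp
  · obtain ⟨a, -, b, -, K, hK, -, h⟩ := h'
    exact (lt_of_tri_mem h).2.2.trans hK

/-- Every set recursive in `B` is defined from `B`, in all `ω`-structures, by a `Σ⁰₁` and by a
`Π⁰₁` formula. -/
theorem exists_delta01 {A B : Set ℕ} (h : RecIn A B) : ∃ θ η : Formula, θ.IsBounded ∧
    η.IsBounded ∧ (exNum 1 θ).IsOperator ∧ (allNum 1 η).IsOperator ∧
    ∀ (𝒮 : Set (Set ℕ)) (h : 𝒮.Nonempty), (omegaModel 𝒮 h).image (exNum 1 θ) B = A ∧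
      (omegaModel 𝒮 h).image (allNum 1 η) B = A := by
  obtain ⟨c, hc⟩ := (OCode.exists_eval_iff _ _).2 h
  have hev : ∀ n m, (∃ w, Run B w c.index n m) ↔ m ∈ charFun A n := fun n m => by
    rw [← mem_eval_iff_run, hc]
  obtain ⟨θ, h1, h2, -, h3⟩ := (BddDef.run (n := 2) 1 (.const c.index) (.var 0)
    (.const 1)).exists_operator
  obtain ⟨η, k1, -, k2, k3⟩ := (BddDef.run (n := 2) 1 (.const c.index) (.var 0)
    (.const 0)).not.exists_operator
  refine ⟨θ, η, h1, k1, h2, k2, fun 𝒮 h => ⟨Set.ext fun x => ?_, Set.ext fun x => ?_⟩⟩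
  · change (exNum 1 θ).Sat (omegaModel 𝒮 h) (fun _ => x) (fun _ => B) ↔ _
    rw [sat_exNum]
    simp only [h3]
    refine (hev x 1).trans ?_
    by_cases hx : x ∈ A <;> simp [charFun, hx]
  · change (allNum 1 η).Sat (omegaModel 𝒮 h) (fun _ => x) (fun _ => B) ↔ _
    rw [sat_allNum]
    simp only [k3]
    refine (not_exists.symm.trans (not_congr (hev x 0))).trans ?_
    by_cases hx : x ∈ A <;> simp [charFun, hx]

/-- The `ω`-models of `RCA₀` are closed under relative recursiveness. -/
theorem mem_of_recIn {𝒮 : Set (Set ℕ)} {h𝒮 : 𝒮.Nonempty}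
    (hM : RCA0.HasModel (omegaModel 𝒮 h𝒮)) {A B : Set ℕ} (hB : B ∈ 𝒮) (h : RecIn A B) :
    A ∈ 𝒮 := by
  obtain ⟨θ, η, h1, h2, h3, h4, h5⟩ := exists_delta01 h
  obtain ⟨h6, h7⟩ := h5 𝒮 h𝒮
  have hX : 1 ∉ (exNum 1 θ).freeSet := fun h => by simpa using h3.2 h
  have key := hM _ (.inr ⟨0, 1, exNum 1 θ, allNum 1 η, ⟨1, θ, h1, rfl⟩, ⟨1, η, h2, rfl⟩, hX, rfl⟩)
    (fun _ => 0) (fun _ => B) fun _ => hB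
  simp only [sat_imp, sat_comprehension, sat_updateSet hX] at key
  rw [sat_allNum] at key
  simp only [sat_iff, h3.sat_iff, h4.sat_iff, h6, h7, Function.update_self] at key
  obtain ⟨C, hC, h⟩ := key fun _ => trivial
  rwa [show A = C from Set.ext fun x => (h x).symm]

/-- In every `ω`-model of the `n`-th system the `n`-th jump is the only set with `jumpPred J n`, so a
set recursive in that jump is implicitly definable through its `Σ⁰₁` definition from it. -/
theorem mem_defSets_of_recIn {J : Formula} (hJ : IsJumpFormula J) {n : ℕ} {A : Set ℕ}
    (hA : RecIn A (emptyJump n)) : A ∈ (system J n).DefSets := by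
  obtain ⟨θ, η, -, -, h3, -, h5⟩ := exists_delta01 hA
  have hn := isSetPred_jumpPred hJ.isOperator n
  refine mem_defSets_of_unique (ψ := stepPred (jumpPred J n) (exNum 1 θ))
    Set.subset_union_left (isSetPred_stepPred hn h3) fun 𝒮 h𝒮 hM => ?_
  obtain ⟨hR, hjumps⟩ := (system_hasModel_omega hJ n).1 hM
  have hAS := mem_of_recIn hR (hjumps n le_rfl) hA
  refine ⟨hAS, fun Y hY => ?_⟩
  rw [holdsOf_stepPred hn h3]
  constructor
  · rintro ⟨-, X, hX, h1, rfl⟩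
    obtain ⟨rfl, -⟩ := (holdsOf_jumpPred_omega hJ n hX).1 h1
    exact (h5 𝒮 h𝒮).1
  · rintro rfl
    exact ⟨hY, _, hjumps n le_rfl,
      (holdsOf_jumpPred_omega hJ n (hjumps n le_rfl)).2 ⟨rfl, hjumps⟩, (h5 𝒮 h𝒮).1.symm⟩

end Frac

namespace Frac

open Formula

/-! ### Relative recursiveness -/

/-- The total function `f` is recursive in `B`. -/
def FunRecIn (B : Set ℕ) (f : ℕ → ℕ) : Prop :=
  Nat.RecursiveIn {charFun B} fun n => Part.some (f n)

open Classical in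
/-- The characteristic function of a predicate. -/
noncomputable def ind (P : ℕ → Prop) (n : ℕ) : ℕ := if P n then 1 else 0

theorem ind_pos {P : ℕ → Prop} {n : ℕ} (h : P n) : ind P n = 1 := if_pos h

theorem ind_neg {P : ℕ → Prop} {n : ℕ} (h : ¬ P n) : ind P n = 0 := if_neg h

variable {A B C : Set ℕ} {f g : ℕ → ℕ} {P Q : ℕ → Prop}

theorem recIn_iff : RecIn {n | P n} B ↔ FunRecIn B (ind P) := Iff.rfl

theorem RecIn.refl (A : Set ℕ) : RecIn A A := .oracle _ rfl

theorem RecIn.trans (h : RecIn A B) (k : RecIn B C) : RecIn A C :=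
  Nat.RecursiveIn.subst h fun _ hg => hg ▸ k

namespace FunRecIn

theorem of_natPrimrec (h : Nat.Primrec f) : FunRecIn B f := h.recursiveIn

theorem of_primrec (h : Primrec f) : FunRecIn B f := of_natPrimrec (Primrec.nat_iff.1 h)

theorem comp (hf : FunRecIn B f) (hg : FunRecIn B g) : FunRecIn B fun n => f (g n) :=
  (Nat.RecursiveIn.comp hf hg).of_eq fun n => by simp

theorem pair (hf : FunRecIn B f) (hg : FunRecIn B g) : FunRecIn B fun n => Nat.pair (f n) (g n) :=
  (Nat.RecursiveIn.pair hf hg).of_eq fun n => by simp [Seq.seq]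

theorem comp₂ {h : ℕ → ℕ → ℕ} (hh : Primrec₂ h) (hf : FunRecIn B f) (hg : FunRecIn B g) :
    FunRecIn B fun n => h (f n) (g n) := by
  have : FunRecIn B (Nat.unpaired h) := of_natPrimrec (Primrec₂.unpaired'.2 hh)
  simpa [Nat.unpaired] using this.comp (hf.pair hg)

theorem prec (hf : FunRecIn B f) (hg : FunRecIn B g) : FunRecIn B fun p =>
    Nat.rec (motive := fun _ => ℕ) (f p.unpair.1)
      (fun y i => g (Nat.pair p.unpair.1 (Nat.pair y i))) p.unpair.2 := by
  refine (Nat.RecursiveIn.prec hf hg).of_eq fun p => ?_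
  dsimp only
  induction p.unpair.2 with
  | zero => rfl
  | succ k ih => simp only [ih]; simp

theorem left : FunRecIn B fun n => n.unpair.1 :=
  of_primrec (Primrec.fst.comp Primrec.unpair)

theorem right : FunRecIn B fun n => n.unpair.2 :=
  of_primrec (Primrec.snd.comp Primrec.unpair)

protected theorem id : FunRecIn B fun n => n := of_primrec Primrec.id

theorem const (k : ℕ) : FunRecIn B fun _ => k := of_primrec (Primrec.const k)

end FunRecIn

namespace RecIn

theorem comp (hP : RecIn {n | P n} B) (hf : FunRecIn B f) : RecIn {n | P (f n)} B :=
  FunRecIn.comp (f := ind P) hP hf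

theorem not (hP : RecIn {n | P n} B) : RecIn {n | ¬ P n} B := by
  rw [recIn_iff] at *
  convert FunRecIn.comp₂ Primrec.nat_sub (FunRecIn.const 1) hP using 2 with n
  by_cases h : P n <;> simp [ind, h]

theorem and (hP : RecIn {n | P n} B) (hQ : RecIn {n | Q n} B) : RecIn {n | P n ∧ Q n} B := by
  rw [recIn_iff] at *
  convert FunRecIn.comp₂ Primrec.nat_mul hP hQ using 2 with n
  by_cases h : P n <;> by_cases h' : Q n <;> simp [ind, h, h']

theorem imp (hP : RecIn {n | P n} B) (hQ : RecIn {n | Q n} B) : RecIn {n | P n → Q n} B := by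
  have := (hP.and hQ.not).not
  simpa only [not_and, not_not] using this

theorem of_primrecRel {R : ℕ → ℕ → Prop} (hR : PrimrecRel R) (hf : FunRecIn B f)
    (hg : FunRecIn B g) : RecIn {n | R (f n) (g n)} B := by
  classical
  rw [recIn_iff]
  have h : Primrec₂ fun a b => if R a b then 1 else 0 :=
    (Primrec.ite (c := fun p : ℕ × ℕ => R p.1 p.2) hR (Primrec.const 1)
      (Primrec.const 0)).to₂
  convert FunRecIn.comp₂ h hf hg using 2 with n
  simp only [ind]

/-- Bounded universal quantifiers preserve relative recursiveness. -/
theorem ball (hP : RecIn {n | P n} B) (hf : FunRecIn B f) :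
    RecIn {n | ∀ a, a < f n → P (Nat.pair a n)} B := by
  rw [recIn_iff] at *
  have h := FunRecIn.prec (f := fun _ => 1)
    (g := fun q => q.unpair.2.unpair.2 * ind P (Nat.pair q.unpair.2.unpair.1 q.unpair.1))
    (.const 1) (FunRecIn.comp₂ (B := B) Primrec.nat_mul (.comp .right .right)
      (hP.comp (.pair (.comp .left .right) .left)))
  have key : ∀ n k, ind (fun n => ∀ a, a < k → P (Nat.pair a n)) n =
      Nat.rec (motive := fun _ => ℕ) 1 (fun y i => i * ind P (Nat.pair y n)) k := by
    intro n k
    induction k with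
    | zero => exact ind_pos (by simp)
    | succ k ih =>
      dsimp only
      rw [← ih]
      by_cases h1 : ∀ a, a < k → P (Nat.pair a n)
      · by_cases h2 : P (Nat.pair k n)
        · rw [ind_pos (P := fun n => ∀ a, a < k → P (Nat.pair a n)) h1, ind_pos h2, ind_pos]
          intro a ha
          rcases Nat.lt_succ_iff_lt_or_eq.1 ha with ha | rfl
          exacts [h1 a ha, h2]
        · rw [ind_neg h2, mul_zero, ind_neg]
          exact fun h => h2 (h k (Nat.lt_succ_self k))
      · rw [ind_neg (P := fun n => ∀ a, a < k → P (Nat.pair a n)) h1, zero_mul, ind_neg]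
        exact fun h => h1 fun a ha => h a (ha.trans (Nat.lt_succ_self k))
  convert h.comp (FunRecIn.pair .id hf) using 2 with n
  simp only [Nat.unpair_pair]
  exact key n (f n)

/-- The least solution of a solvable recursive condition is found by unbounded search. -/
theorem exists_search (hP : RecIn {n | P n} B) (h : ∀ n, ∃ b, P (Nat.pair n b)) :
    ∃ f, FunRecIn B f ∧ ∀ n, P (Nat.pair n (f n)) := by
  classical
  refine ⟨fun n => Nat.find (h n), ?_, fun n => Nat.find_spec (h n)⟩
  refine (Nat.RecursiveIn.rfind (recIn_iff.1 hP.not)).of_eq fun n => ?_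
  refine Part.eq_some_iff.2 (Nat.mem_rfind.2 ⟨?_, fun {m} hm => ?_⟩)
  · simp [ind_neg (P := fun n => ¬ P n) (not_not.2 (Nat.find_spec (h n)))]
  · simp [ind_pos (P := fun n => ¬ P n) (Nat.find_min (h n) hm)]

end RecIn

/-! ### Turing ideals are models of `RCA₀` -/

/-- The `i`-th component of the infinite sequence of numbers coded by `e`. -/
def envGet (e : ℕ) : ℕ → ℕ
  | 0 => e.unpair.1
  | i + 1 => envGet e.unpair.2 i

/-- The code of the sequence that results from replacing the `x`-th component. -/
def envSet (a : ℕ) : ℕ → ℕ → ℕ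
  | 0, e => Nat.pair a e.unpair.2
  | x + 1, e => Nat.pair e.unpair.1 (envSet a x e.unpair.2)

theorem envGet_envSet (a x e : ℕ) :
    envGet (envSet a x e) = Function.update (envGet e) x a := by
  induction x generalizing e with
  | zero =>
    ext i
    cases i <;> simp [envGet, envSet]
  | succ x ih =>
    ext i
    cases i with
    | zero => simp [envGet, envSet]
    | succ i => simp [envGet, envSet, ih, Function.update_apply]

theorem exists_envGet_eq (v : ℕ → ℕ) (n : ℕ) : ∃ e, ∀ i < n, envGet e i = v i := by
  induction n with
  | zero => exact ⟨0, fun i hi => by omega⟩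
  | succ n ih =>
    obtain ⟨e, he⟩ := ih
    refine ⟨envSet (v n) n e, fun i hi => ?_⟩
    rw [envGet_envSet, Function.update_apply]
    split_ifs with h
    · rw [h]
    · exact he i (by omega)

theorem funRecIn_envGet (i : ℕ) (hf : FunRecIn B f) : FunRecIn B fun n => envGet (f n) i := by
  induction i generalizing f with
  | zero => exact .comp .left hf
  | succ i ih => exact ih (.comp .right hf)

theorem funRecIn_envSet (x : ℕ) (hf : FunRecIn B f) (hg : FunRecIn B g) :
    FunRecIn B fun n => envSet (f n) x (g n) := by
  induction x generalizing g with
  | zero => exact .pair hf (.comp .right hg)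
  | succ x ih => exact .pair (.comp .left hg) (ih (.comp .right hg))

variable {𝒮 : Set (Set ℕ)} {h𝒮 : 𝒮.Nonempty}

theorem funRecIn_val (t : Term) : FunRecIn B fun e => t.val (omegaModel 𝒮 h𝒮) (envGet e) := by
  induction t with
  | zero => exact .const 0
  | one => exact .const 1
  | var i => exact funRecIn_envGet i .id
  | add t s iht ihs => exact FunRecIn.comp₂ Primrec.nat_add iht ihs
  | mul t s iht ihs => exact FunRecIn.comp₂ Primrec.nat_mul iht ihs

/-- Bounded formulas whose set parameters are recursive in `B` define relations recursive
in `B`. -/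
theorem recIn_sat_of_isBounded {φ : Formula} (hφ : φ.IsBounded) {V : ℕ → Set ℕ}
    (hV : ∀ X ∈ φ.freeSet, RecIn (V X) B) :
    RecIn {e | φ.Sat (omegaModel 𝒮 h𝒮) (envGet e) V} B := by
  induction hφ with
  | fls =>
    refine (recIn_iff (P := fun _ => False)).2 ?_
    convert FunRecIn.const 0 using 2 with n
    exact ind_neg not_false
  | eq t s => exact RecIn.of_primrecRel Primrec.eq (funRecIn_val t) (funRecIn_val s)
  | lt t s => exact RecIn.of_primrecRel Primrec.nat_lt (funRecIn_val t) (funRecIn_val s)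
  | mem t X =>
    exact RecIn.comp (P := (· ∈ V X)) (hV X (by simp [freeSet])) (funRecIn_val t)
  | imp _ _ h1 h2 =>
    exact (h1 fun X hX => hV X (Finset.mem_union_left _ hX)).imp
      (h2 fun X hX => hV X (Finset.mem_union_right _ hX))
  | @ball x t φ hx _ ih =>
    have h1 := ih fun X hX => hV X (by simpa [freeSet] using hX)
    have h2 := (h1.comp (funRecIn_envSet x .left .right)).ball (funRecIn_val (𝒮 := 𝒮)
      (h𝒮 := h𝒮) t)
    convert h2 using 2 with e
    simp only [sat_allNum, sat_imp, sat_lt, Term.val, Function.update_self, Term.val_update hx,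
      Nat.unpair_pair, envGet_envSet]

/-- A Turing ideal is the set part of an `ω`-model of `RCA₀`. -/
theorem RCA0_hasModel_omega (hdown : ∀ A B, B ∈ 𝒮 → RecIn A B → A ∈ 𝒮)
    (hjoin : ∀ V : ℕ → Set ℕ, (∀ X, V X ∈ 𝒮) → ∀ n, ∃ B ∈ 𝒮, ∀ X < n, RecIn (V X) B) :
    RCA0.HasModel (omegaModel 𝒮 h𝒮) := by
  rintro χ ((hχ | hχ) | hχ)
  · intro v V _
    simp only [basicAxioms, Set.mem_insert_iff, Set.mem_singleton_iff] at hχ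
    rcases hχ with rfl | rfl | rfl | rfl | rfl | rfl | rfl | rfl
    · exact Nat.succ_ne_zero (v 0)
    · exact fun h => Nat.succ_injective h
    · exact Nat.add_zero (v 0)
    · exact (Nat.add_assoc (v 0) (v 1) 1).symm
    · exact Nat.mul_zero (v 0)
    · exact Nat.mul_succ (v 0) (v 1)
    · exact Nat.not_lt_zero (v 0)
    · rw [sat_iff, sat_or]
      exact Nat.lt_succ_iff_lt_or_eq
  · obtain ⟨x, y, φ, -, hyx, hy, rfl⟩ := hχ
    intro v V _
    rw [sat_induction hyx hy]
    exact fun h0 hs a => Nat.rec h0 (fun a => hs a) a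
  · obtain ⟨x, X, _, _, ⟨w, θ, hθ, rfl⟩, ⟨z, η, hη, rfl⟩, hX, rfl⟩ := hχ
    intro v V hV
    rw [sat_imp, sat_comprehension]
    simp only [sat_allNum, sat_iff, sat_updateSet hX, sat_exNum]
    intro heq
    obtain ⟨B, hB, hVB⟩ := hjoin V hV (max θ.bd η.bd)
    obtain ⟨e, he⟩ := exists_envGet_eq v (max θ.bd η.bd)
    -- Evaluation of a matrix at `x = a` and at the value `b` of the quantified variable.
    have hrec : ∀ {ψ : Formula}, ψ.IsBounded → ψ.bd ≤ max θ.bd η.bd → ∀ w,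
        RecIn {n | ψ.Sat (omegaModel 𝒮 h𝒮)
          (Function.update (Function.update v x n.unpair.1) w n.unpair.2) V} B := by
      intro ψ hψ hbd w
      have h1 := recIn_sat_of_isBounded (𝒮 := 𝒮) (h𝒮 := h𝒮) hψ (V := V) (B := B)
        fun Y hY => hVB Y ((freeSet_lt_bd hY).trans_le hbd)
      have h2 := h1.comp (funRecIn_envSet w .right (funRecIn_envSet x .left (.const e)))
      convert h2 using 2
      refine funext fun n => propext (sat_congr (fun i hi => ?_) fun _ _ => rfl)
      simp only [envGet_envSet, Function.update_apply, he i ((freeNum_lt_bd hi).trans_le hbd)]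
    have hθ' := hrec hθ (le_max_left _ _) w
    have hη' := hrec hη (le_max_right _ _) z
    -- Search for a witness of the `Σ⁰₁` definition or a counterexample to the `Π⁰₁` definition.
    obtain ⟨f, hf, hf'⟩ := (hθ'.not.and hη').not.exists_search fun a => by
      by_contra! h
      simp only [Nat.unpair_pair] at h
      obtain ⟨b, hb⟩ := (heq a).2 fun b => (h b).2
      exact (h b).1 hb
    refine ⟨_, hdown _ B hB (hθ'.comp (FunRecIn.pair .id hf)), fun a => ?_⟩
    have h1 := hf' a
    simp only [Nat.unpair_pair] at h1
    change θ.Sat _ (Function.update (Function.update v x (Nat.pair a (f a)).unpair.1) w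
      (Nat.pair a (f a)).unpair.2) V ↔ _
    rw [Nat.unpair_pair]
    refine ⟨fun h => ⟨_, h⟩, fun h => ?_⟩
    by_contra hn
    exact h1 ⟨hn, (heq a).1 h (f a)⟩

/-! ### The jumps of the empty set -/

/-- A program with the constant value `x`. -/
def OCode.constCode : ℕ → OCode
  | 0 => .zero
  | x + 1 => .comp .succ (constCode x)

theorem OCode.eval_constCode (B : Set ℕ) (x n : ℕ) : (constCode x).eval B n = Part.some x := by
  induction x with
  | zero => rfl
  | succ x ih => simp [constCode, eval, ih]

theorem recIn_jump (B : Set ℕ) : RecIn B (jump B) := by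
  set c : ℕ → OCode := fun x => .rfind (.comp .oracle (.constCode x)) with hc
  have hjump : ∀ x, x ∈ B ↔ ¬ (c x).index ∈ jump B := by
    intro x
    have h1 : (c x).index ∈ jump B ↔ ∃ m, m ∈ (c x).eval B (c x).index :=
      ⟨fun ⟨d, hd, h⟩ => Part.dom_iff_mem.1 (OCode.index_injective hd ▸ h),
        fun h => ⟨_, rfl, Part.dom_iff_mem.2 h⟩⟩
    have h2 : ∀ n m, m ∈ (OCode.comp .oracle (.constCode x)).eval B n ↔ m = ind (· ∈ B) x := by
      intro n m
      simp only [OCode.mem_eval_comp, OCode.eval_constCode, Part.mem_some_iff, exists_eq_left]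
      exact Part.mem_some_iff
    rw [h1]
    simp only [hc, OCode.mem_eval_rfind, h2, not_exists]
    constructor
    · intro hx m hm
      have := hm.1
      rw [ind_pos hx] at this
      omega
    · intro h
      by_contra hx
      exact h 0 ⟨(ind_neg hx).symm, fun k hk => by omega⟩
  have hprim : Primrec fun x => (c x).index := by
    have h1 : Primrec fun x => (OCode.constCode x).index := by
      refine (Primrec.nat_rec₁ 0 (f := fun _ i => 4 * Nat.pair 1 i + 6) ?_).of_eq fun x => ?_
      · exact Primrec.nat_add.comp (Primrec.nat_mul.comp (.const 4)
          (Primrec₂.natPair.comp (.const 1) .snd)) (.const 6)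
      · induction x with
        | zero => rfl
        | succ x ih => simp [OCode.constCode, OCode.index, ← ih]
    exact Primrec.nat_add.comp (Primrec.nat_mul.comp (.const 4) (Primrec.nat_add.comp
      (Primrec.nat_mul.comp (.const 4) (Primrec₂.natPair.comp (.const 4) h1)) (.const 6)))
      (.const 8)
  have := (RecIn.comp (P := (· ∈ jump B)) (RecIn.refl _) (.of_primrec hprim)).not
  convert this using 1
  · exact Set.ext hjump
  · rfl

/-- The diagonal argument for the halting problem. -/
theorem not_recIn_jump (B : Set ℕ) : ¬ RecIn (jump B) B := by
  intro h
  have h1 : FunRecIn B fun p => ind (· ∈ jump B) p.unpair.1 :=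
    FunRecIn.comp (f := ind (· ∈ jump B)) h .left
  obtain ⟨c, hc⟩ := (OCode.exists_eval_iff B _).2 (Nat.RecursiveIn.rfind h1)
  have h2 : c.index ∈ jump B ↔ (c.eval B c.index).Dom :=
    ⟨fun ⟨d, hd, h⟩ => OCode.index_injective hd ▸ h, fun h => ⟨_, rfl, h⟩⟩
  rw [hc, Part.dom_iff_mem] at h2
  by_cases hj : c.index ∈ jump B
  · obtain ⟨m, hm⟩ := h2.1 hj
    have := Nat.rfind_spec hm
    simp [ind_pos (P := (· ∈ jump B)) hj] at this
  · refine hj (h2.2 ⟨0, Nat.mem_rfind.2 ⟨?_, fun hm => by omega⟩⟩)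
    simp [ind_neg (P := (· ∈ jump B)) hj]

theorem recIn_emptyJump_of_le {i n : ℕ} (h : i ≤ n) : RecIn (emptyJump i) (emptyJump n) := by
  induction h with
  | refl => exact RecIn.refl _
  | step _ ih => exact ih.trans (recIn_jump _)

/-- The sets recursive in the `n`-th jump of the empty set. -/
def jumpIdeal (n : ℕ) : Set (Set ℕ) := {A | RecIn A (emptyJump n)}

theorem jumpIdeal_nonempty (n : ℕ) : (jumpIdeal n).Nonempty := ⟨_, RecIn.refl _⟩

theorem jumpIdeal_mono : Monotone jumpIdeal := fun _ _ h _ hA => RecIn.trans hA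
  (recIn_emptyJump_of_le h)

variable {J : Formula}

theorem system_hasModel_jumpIdeal (hJ : IsJumpFormula J) (n : ℕ) :
    (system J n).HasModel (omegaModel (jumpIdeal n) (jumpIdeal_nonempty n)) :=
  (system_hasModel_omega hJ n).2 ⟨RCA0_hasModel_omega (fun _ _ hB hA => RecIn.trans hA hB)
    fun _ hV _ => ⟨_, RecIn.refl _, fun X _ => hV X⟩, fun _ hi => recIn_emptyJump_of_le hi⟩

theorem defSets_system (hJ : IsJumpFormula J) (n : ℕ) : (system J n).DefSets = jumpIdeal n :=
  Set.Subset.antisymm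
    (fun _ hA => mem_of_mem_defSets hA (system_hasModel_jumpIdeal hJ n))
    fun _ hA => mem_defSets_of_recIn hJ hA

/-- The arithmetical sets form an `ω`-model of the union of the systems. -/
theorem exists_recIn_of_mem_defSets_iUnion (hJ : IsJumpFormula J)
    (hA : A ∈ Theory2.DefSets (⋃ n, system J n)) : ∃ n, RecIn A (emptyJump n) := by
  have hne : (⋃ n, jumpIdeal n).Nonempty := (jumpIdeal_nonempty 0).mono (Set.subset_iUnion _ 0)
  have hR : RCA0.HasModel (omegaModel (⋃ n, jumpIdeal n) hne) := by
    refine RCA0_hasModel_omega (fun A B hB hA => ?_) fun V hV m => ?_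
    · obtain ⟨n, hn⟩ := Set.mem_iUnion.1 hB
      exact Set.mem_iUnion.2 ⟨n, RecIn.trans hA hn⟩
    · choose k hk using fun X => Set.mem_iUnion.1 (hV X)
      refine ⟨emptyJump ((Finset.range m).sup k), Set.mem_iUnion.2 ⟨_, RecIn.refl _⟩,
        fun X hX => jumpIdeal_mono ?_ (hk X)⟩
      exact Finset.le_sup (f := k) (Finset.mem_range.2 hX)
  suffices A ∈ ⋃ n, jumpIdeal n by
    obtain ⟨n, hn⟩ := Set.mem_iUnion.1 this
    exact ⟨n, hn⟩
  refine mem_of_mem_defSets (h𝒮 := hne) hA fun χ hχ => ?_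
  obtain ⟨n, hn⟩ := Set.mem_iUnion.1 hχ
  exact (system_hasModel_omega hJ n).2
    ⟨hR, fun i _ => Set.mem_iUnion.2 ⟨i, RecIn.refl _⟩⟩ χ hn

/-- The `n`-th system has an `ω`-model without the `(n + 1)`-st jump, whose existence is an
instance of `Π¹₁` comprehension with the `n`-th jump as a parameter. -/
theorem system_not_pi11 (hJ : IsJumpFormula J) (n : ℕ) :
    ¬ ∀ χ ∈ pi11Comprehension, (system J n).Proves χ := by
  intro h
  have hX : 1 ∉ J.freeSet := fun h => by simpa using hJ.isOperator.2 h
  have key := h ((allSet 1 J).comprehension 0 1)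
    ⟨0, 1, _, ⟨1, J, hJ.noSetQuant, rfl⟩, by simp [freeSet], rfl⟩ _
    (system_hasModel_jumpIdeal hJ n) (fun _ => 0) (fun _ => emptyJump n)
    fun _ => RecIn.refl _
  rw [sat_comprehension] at key
  obtain ⟨A, hA, h⟩ := key
  refine not_recIn_jump (emptyJump n) ?_
  suffices A = jump (emptyJump n) from this ▸ hA
  ext a
  rw [h, sat_allSet]
  simp only [hJ.isOperator.sat_iff, Function.update_self, ne_eq, zero_ne_one, not_false_eq_true,
    Function.update_of_ne, hJ.image_eq]
  exact ⟨fun h => h _ hA, fun h _ _ => h⟩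

end Frac

namespace Frac

/-! ### The systems are recursively axiomatized -/

theorem Term.code_surjective : Function.Surjective Term.code := by
  intro n
  induction n using Nat.strong_induction_on with
  | _ n ih =>
    by_cases hn : n < 2
    · interval_cases n
      exacts [⟨.zero, rfl⟩, ⟨.one, rfl⟩]
    · obtain ⟨k, hk⟩ : ∃ k, k = (n - 2) / 3 := ⟨_, rfl⟩
      have : n = 3 * k + 2 ∨ n = 3 * k + 3 ∨ n = 3 * k + 4 := by omega
      have h1 := Nat.unpair_left_le k
      have h2 := Nat.unpair_right_le k
      rcases this with h | h
      · exact ⟨.var k, h.symm⟩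
      · obtain ⟨t, ht⟩ := ih k.unpair.1 (by omega)
        obtain ⟨s, hs⟩ := ih k.unpair.2 (by omega)
        have hp : Nat.pair t.code s.code = k := by rw [ht, hs, Nat.pair_unpair]
        rcases h with h | h
        · exact ⟨.add t s, by rw [code, hp, h]⟩
        · exact ⟨.mul t s, by rw [code, hp, h]⟩

theorem Formula.code_surjective : Function.Surjective Formula.code := by
  intro n
  induction n using Nat.strong_induction_on with
  | _ n ih =>
    by_cases hn : n = 0
    · exact ⟨.fls, hn.symm⟩
    · obtain ⟨k, hk⟩ : ∃ k, k = (n - 1) / 6 := ⟨_, rfl⟩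
      have : n = 6 * k + 1 ∨ n = 6 * k + 2 ∨ n = 6 * k + 3 ∨ n = 6 * k + 4 ∨ n = 6 * k + 5 ∨
        n = 6 * k + 6 := by omega
      have h1 := Nat.unpair_left_le k
      have h2 := Nat.unpair_right_le k
      obtain ⟨t, ht⟩ := Term.code_surjective k.unpair.1
      obtain ⟨s, hs⟩ := Term.code_surjective k.unpair.2
      have hp : Nat.pair t.code s.code = k := by rw [ht, hs, Nat.pair_unpair]
      have hp' : Nat.pair t.code k.unpair.2 = k := by rw [ht, Nat.pair_unpair]
      obtain ⟨φ, hφ⟩ := ih k.unpair.1 (by omega)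
      obtain ⟨ψ, hψ⟩ := ih k.unpair.2 (by omega)
      have hf : Nat.pair φ.code ψ.code = k := by rw [hφ, hψ, Nat.pair_unpair]
      have hf' : Nat.pair k.unpair.1 ψ.code = k := by rw [hψ, Nat.pair_unpair]
      rcases this with h | h | h | h | h | h
      · exact ⟨.eq t s, by rw [code, hp, h]⟩
      · exact ⟨.lt t s, by rw [code, hp, h]⟩
      · exact ⟨.mem t _, by rw [code, hp', h]⟩
      · exact ⟨.imp φ ψ, by rw [code, hf, h]⟩
      · exact ⟨.allNum _ ψ, by rw [code, hf', h]⟩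
      · exact ⟨.allSet _ ψ, by rw [code, hf', h]⟩

/-- Course-of-values recursion for relations with a parameter. -/
theorem primrecRel_of_strong_rec {R : ℕ → ℕ → Prop} [DecidableRel R] {G : ℕ × List Bool → Prop}
    (hG : PrimrecPred G)
    (H : ∀ y n, G (y, (List.range n).map fun k => decide (R y k)) ↔ R y n) :
    PrimrecRel R := by
  classical
  have h : Primrec₂ fun y n => decide (R y n) := by
    refine Primrec.nat_strong_rec _ (g := fun y l => some (decide (G (y, l))))
      (Primrec.option_some.comp hG.decide).to₂ fun y n => ?_
    simp only [H]
  exact Primrec.primrecPred h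

/-- The entry of the list `l` at position `a` is `true`. -/
def Marked (l : List Bool) (a : ℕ) : Prop := l[a]? = some true

theorem marked_map_range {P : ℕ → Prop} [DecidablePred P] {n a : ℕ} :
    Marked ((List.range n).map fun k => decide (P k)) a ↔ a < n ∧ P a := by
  simp only [Marked, List.getElem?_map, Option.map_eq_some_iff, decide_eq_true_eq]
  constructor
  · rintro ⟨k, hk, h⟩
    rw [List.getElem?_eq_some_iff] at hk
    obtain ⟨h1, h2⟩ := hk
    rw [List.getElem_range] at h2
    rw [List.length_range] at h1
    exact ⟨h1, h2 ▸ h⟩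
  · rintro ⟨h1, h2⟩
    exact ⟨a, List.getElem?_range h1, h2⟩

section

variable {α : Type*} [Primcodable α] {f g : α → ℕ} {l : α → List Bool} {k : ℕ}

theorem primrecPred_marked (hl : Primrec l) (hf : Primrec f) :
    PrimrecPred fun a => Marked (l a) (f a) :=
  Primrec.eq.comp (Primrec.list_getElem?.comp hl hf) (Primrec.const _)

theorem primrecPred_eq_const (hf : Primrec f) : PrimrecPred fun a => f a = k :=
  Primrec.eq.comp hf (Primrec.const k)

theorem primrecPred_eq (hf : Primrec f) (hg : Primrec g) : PrimrecPred fun a => f a = g a :=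
  Primrec.eq.comp hf hg

theorem primrec_unpair_left (hf : Primrec f) : Primrec fun a => (f a).unpair.1 :=
  Primrec.fst.comp (Primrec.unpair.comp hf)

theorem primrec_unpair_right (hf : Primrec f) : Primrec fun a => (f a).unpair.2 :=
  Primrec.snd.comp (Primrec.unpair.comp hf)

theorem primrec_sub_div (c d : ℕ) (hf : Primrec f) : Primrec fun a => (f a - c) / d :=
  Primrec.nat_div.comp (Primrec.nat_sub.comp hf (Primrec.const c)) (Primrec.const d)

theorem primrec_sub_mod (c d : ℕ) (hf : Primrec f) : Primrec fun a => (f a - c) % d :=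
  Primrec.nat_mod.comp (Primrec.nat_sub.comp hf (Primrec.const c)) (Primrec.const d)

theorem primrec_mul_add (c d : ℕ) (hf : Primrec f) : Primrec fun a => c * f a + d :=
  Primrec.nat_add.comp (Primrec.nat_mul.comp (Primrec.const c) hf) (Primrec.const d)

end

/-- `y` is a variable of the term with code `n`. -/
def VarOfCode (y n : ℕ) : Prop := ∃ t : Term, t.code = n ∧ y ∈ t.vars

theorem varOfCode_code {y : ℕ} {t : Term} : VarOfCode y t.code ↔ y ∈ t.vars :=
  ⟨fun ⟨_, h, h'⟩ => Term.code_injective h ▸ h', fun h => ⟨t, rfl, h⟩⟩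

theorem primrecRel_varOfCode : PrimrecRel VarOfCode := by
  classical
  have hn : Primrec fun p : ℕ × List Bool => p.2.length := Primrec.list_length.comp Primrec.snd
  have hq := primrec_sub_div 2 3 hn
  have hr := primrec_sub_mod 2 3 hn
  refine primrecRel_of_strong_rec (G := fun p => 2 ≤ p.2.length ∧
    (((p.2.length - 2) % 3 = 0 ∧ p.1 = (p.2.length - 2) / 3) ∨
      (¬ (p.2.length - 2) % 3 = 0 ∧ (Marked p.2 ((p.2.length - 2) / 3).unpair.1 ∨
        Marked p.2 ((p.2.length - 2) / 3).unpair.2))))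
    (.and (Primrec.nat_le.comp (Primrec.const 2) hn)
      (.or (.and (primrecPred_eq_const hr) (primrecPred_eq Primrec.fst hq))
        (.and (.not (primrecPred_eq_const hr)) (.or (primrecPred_marked Primrec.snd (primrec_unpair_left hq))
          (primrecPred_marked Primrec.snd (primrec_unpair_right hq)))))) fun y n => ?_
  obtain ⟨t, rfl⟩ := Term.code_surjective n
  simp only [List.length_map, List.length_range, marked_map_range, varOfCode_code]
  cases t with
  | zero => simp [Term.code, Term.vars]
  | one => simp [Term.code, Term.vars]
  | var i => simp [Term.code, Term.vars]
  | add t s =>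
    have h1 : (3 * Nat.pair t.code s.code + 3 - 2) % 3 = 1 := by omega
    have h2 : (3 * Nat.pair t.code s.code + 3 - 2) / 3 = Nat.pair t.code s.code := by omega
    have h3 := Nat.left_le_pair t.code s.code
    have h4 := Nat.right_le_pair t.code s.code
    have h5 : t.code < 3 * Nat.pair t.code s.code + 3 := by omega
    have h6 : s.code < 3 * Nat.pair t.code s.code + 3 := by omega
    simp only [Term.code, Term.vars, h1, h2, h5, h6, Nat.unpair_pair, varOfCode_code,
      Finset.mem_union]
    simp
  | mul t s =>
    have h1 : (3 * Nat.pair t.code s.code + 4 - 2) % 3 = 2 := by omega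
    have h2 : (3 * Nat.pair t.code s.code + 4 - 2) / 3 = Nat.pair t.code s.code := by omega
    have h3 := Nat.left_le_pair t.code s.code
    have h4 := Nat.right_le_pair t.code s.code
    have h5 : t.code < 3 * Nat.pair t.code s.code + 4 := by omega
    have h6 : s.code < 3 * Nat.pair t.code s.code + 4 := by omega
    simp only [Term.code, Term.vars, h1, h2, h5, h6, Nat.unpair_pair, varOfCode_code,
      Finset.mem_union]
    simp

/-- The formula with a given code. -/
noncomputable def Formula.ofCode : ℕ → Formula := Function.surjInv Formula.code_surjective

@[simp] theorem Formula.code_ofCode (n : ℕ) : (ofCode n).code = n :=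
  Function.surjInv_eq Formula.code_surjective n

@[simp] theorem Formula.ofCode_code (φ : Formula) : ofCode φ.code = φ :=
  code_injective (code_ofCode _)

/-- A relation between a number and a formula is primitive recursive on codes if each of the
constructors reduces it primitive recursively to the subformulas. Here `G r y a b l` decides the
case of the constructor number `r` with arguments of codes `a` and `b`, the list `l` containing the
answers for smaller codes. -/
theorem primrecRel_ofCode {R : ℕ → Formula → Prop}
    {G : ℕ → ℕ → ℕ → ℕ → List Bool → Prop} (h0 : ∀ y, ¬ R y .fls)
    (hG : ∀ r < 6, PrimrecPred fun p : ℕ × List Bool =>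
      G r p.1 ((p.2.length - 1) / 6).unpair.1 ((p.2.length - 1) / 6).unpair.2 p.2)
    (H : ∀ r < 6, ∀ y a b, ∀ φ : Formula, φ.code = 6 * Nat.pair a b + r + 1 →
      ∀ l : List Bool, (∀ ψ : Formula, ψ.code < φ.code → (Marked l ψ.code ↔ R y ψ)) →
        (G r y a b l ↔ R y φ)) :
    PrimrecRel fun y n => R y (Formula.ofCode n) := by
  classical
  have hn : Primrec fun p : ℕ × List Bool => p.2.length := Primrec.list_length.comp Primrec.snd
  have hr := primrec_sub_mod 1 6 hn
  have hc : ∀ r < 6, PrimrecPred fun p : ℕ × List Bool => (p.2.length - 1) % 6 = r ∧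
      G r p.1 ((p.2.length - 1) / 6).unpair.1 ((p.2.length - 1) / 6).unpair.2 p.2 :=
    fun r hr' => .and (primrecPred_eq_const hr) (hG r hr')
  refine primrecRel_of_strong_rec (.and (.not (primrecPred_eq_const (k := 0) hn))
    (.or (hc 0 (by decide)) (.or (hc 1 (by decide)) (.or (hc 2 (by decide)) (.or (hc 3 (by decide))
      (.or (hc 4 (by decide)) (hc 5 (by decide)))))))) fun y n => ?_
  simp only [List.length_map, List.length_range]
  obtain ⟨φ, rfl⟩ := Formula.code_surjective n
  rw [Formula.ofCode_code]
  by_cases hφ : φ.code = 0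
  · have : φ = .fls := Formula.code_injective hφ
    subst this
    simp [hφ, h0]
  · obtain ⟨k, hk⟩ : ∃ k, k = (φ.code - 1) / 6 := ⟨_, rfl⟩
    obtain ⟨r, hr⟩ : ∃ r, r = (φ.code - 1) % 6 := ⟨_, rfl⟩
    have hr6 : r < 6 := by omega
    have key := H r hr6 y k.unpair.1 k.unpair.2 φ (by rw [Nat.pair_unpair]; omega)
      ((List.range φ.code).map fun n => decide (R y (Formula.ofCode n))) fun ψ hψ => by
        rw [marked_map_range, Formula.ofCode_code]
        exact and_iff_right hψ
    rw [← hk, ← hr]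
    interval_cases r <;> simpa [hφ] using key

theorem primrecRel_mem_freeNum : PrimrecRel fun y n => y ∈ (Formula.ofCode n).freeNum := by
  have hn : Primrec fun p : ℕ × List Bool => p.2.length := Primrec.list_length.comp Primrec.snd
  have hq := primrec_sub_div 1 6 hn
  have ha := (primrec_unpair_left hq)
  have hb := (primrec_unpair_right hq)
  refine primrecRel_ofCode (R := fun y φ => y ∈ φ.freeNum)
    (G := fun r y a b l => if r < 2 then VarOfCode y a ∨ VarOfCode y b else
      if r = 2 then VarOfCode y a else if r = 3 then Marked l a ∨ Marked l b else
      if r = 4 then ¬ y = a ∧ Marked l b else Marked l b)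
    (by simp [Formula.freeNum]) (fun r hr => ?_) fun r hr y a b φ hφ l hl => ?_
  · have h1 := primrecRel_varOfCode.comp Primrec.fst ha
    have h2 := primrecRel_varOfCode.comp Primrec.fst hb
    have h3 := primrecPred_marked Primrec.snd ha
    have h4 := primrecPred_marked Primrec.snd hb
    interval_cases r
    exacts [h1.or h2, h1.or h2, h1, h3.or h4, (primrecPred_eq Primrec.fst ha).not.and h4, h4]
  · have hab := Nat.left_le_pair a b
    have hba := Nat.right_le_pair a b
    cases φ with
    | fls => simp only [Formula.code] at hφ; omega
    | eq t s =>
      simp only [Formula.code] at hφ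
      obtain rfl : r = 0 := by omega
      obtain ⟨rfl, rfl⟩ := Nat.pair_eq_pair.1 (show Nat.pair a b = Nat.pair t.code s.code by omega)
      simp [Formula.freeNum, varOfCode_code]
    | lt t s =>
      simp only [Formula.code] at hφ
      obtain rfl : r = 1 := by omega
      obtain ⟨rfl, rfl⟩ := Nat.pair_eq_pair.1 (show Nat.pair a b = Nat.pair t.code s.code by omega)
      simp [Formula.freeNum, varOfCode_code]
    | mem t X =>
      simp only [Formula.code] at hφ
      obtain rfl : r = 2 := by omega
      obtain ⟨rfl, rfl⟩ := Nat.pair_eq_pair.1 (show Nat.pair a b = Nat.pair t.code X by omega)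
      simp [Formula.freeNum, varOfCode_code]
    | imp φ ψ =>
      simp only [Formula.code] at hφ hl
      obtain rfl : r = 3 := by omega
      obtain ⟨rfl, rfl⟩ := Nat.pair_eq_pair.1 (show Nat.pair a b = Nat.pair φ.code ψ.code by omega)
      simp [Formula.freeNum, hl φ (by omega), hl ψ (by omega)]
    | allNum x φ =>
      simp only [Formula.code] at hφ hl
      obtain rfl : r = 4 := by omega
      obtain ⟨rfl, rfl⟩ := Nat.pair_eq_pair.1 (show Nat.pair a b = Nat.pair x φ.code by omega)
      simp [Formula.freeNum, hl φ (by omega)]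
    | allSet X φ =>
      simp only [Formula.code] at hφ hl
      obtain rfl : r = 5 := by omega
      obtain ⟨rfl, rfl⟩ := Nat.pair_eq_pair.1 (show Nat.pair a b = Nat.pair X φ.code by omega)
      simp [Formula.freeNum, hl φ (by omega)]

theorem primrecRel_mem_freeSet : PrimrecRel fun y n => y ∈ (Formula.ofCode n).freeSet := by
  have hn : Primrec fun p : ℕ × List Bool => p.2.length := Primrec.list_length.comp Primrec.snd
  have hq := primrec_sub_div 1 6 hn
  have ha := (primrec_unpair_left hq)
  have hb := (primrec_unpair_right hq)
  refine primrecRel_ofCode (R := fun y φ => y ∈ φ.freeSet)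
    (G := fun r y a b l => if r < 2 then False else
      if r = 2 then y = b else if r = 3 then Marked l a ∨ Marked l b else
      if r = 4 then Marked l b else ¬ y = a ∧ Marked l b)
    (by simp [Formula.freeSet]) (fun r hr => ?_) fun r hr y a b φ hφ l hl => ?_
  · have h3 := primrecPred_marked Primrec.snd ha
    have h4 := primrecPred_marked Primrec.snd hb
    have hF : PrimrecPred fun _ : ℕ × List Bool => False :=
      (primrecPred_eq_const (k := 1) (Primrec.const 0)).of_eq fun _ => by simp
    interval_cases r
    exacts [hF, hF, primrecPred_eq Primrec.fst hb, h3.or h4, h4,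
      (primrecPred_eq Primrec.fst ha).not.and h4]
  · have hab := Nat.left_le_pair a b
    have hba := Nat.right_le_pair a b
    cases φ with
    | fls => simp only [Formula.code] at hφ; omega
    | eq t s =>
      simp only [Formula.code] at hφ
      obtain rfl : r = 0 := by omega
      simp [Formula.freeSet]
    | lt t s =>
      simp only [Formula.code] at hφ
      obtain rfl : r = 1 := by omega
      simp [Formula.freeSet]
    | mem t X =>
      simp only [Formula.code] at hφ
      obtain rfl : r = 2 := by omega
      obtain ⟨rfl, rfl⟩ := Nat.pair_eq_pair.1 (show Nat.pair a b = Nat.pair t.code X by omega)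
      simp [Formula.freeSet]
    | imp φ ψ =>
      simp only [Formula.code] at hφ hl
      obtain rfl : r = 3 := by omega
      obtain ⟨rfl, rfl⟩ := Nat.pair_eq_pair.1 (show Nat.pair a b = Nat.pair φ.code ψ.code by omega)
      simp [Formula.freeSet, hl φ (by omega), hl ψ (by omega)]
    | allNum x φ =>
      simp only [Formula.code] at hφ hl
      obtain rfl : r = 4 := by omega
      obtain ⟨rfl, rfl⟩ := Nat.pair_eq_pair.1 (show Nat.pair a b = Nat.pair x φ.code by omega)
      simp [Formula.freeSet, hl φ (by omega)]
    | allSet X φ =>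
      simp only [Formula.code] at hφ hl
      obtain rfl : r = 5 := by omega
      obtain ⟨rfl, rfl⟩ := Nat.pair_eq_pair.1 (show Nat.pair a b = Nat.pair X φ.code by omega)
      simp [Formula.freeSet, hl φ (by omega)]

/-- The code `b` belongs to a formula of the form `x < t → φ`, where `x` is the variable with
index `a` and does not occur in `t`, and the code of `φ` is not marked in `l`. -/
def BoundedMatrix (a b : ℕ) (l : List Bool) : Prop :=
  b = 6 * Nat.pair (6 * Nat.pair (3 * a + 2) ((((b - 1) / 6).unpair.1 - 1) / 6).unpair.2 + 2)
    ((b - 1) / 6).unpair.2 + 4 ∧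
  ¬ VarOfCode a ((((b - 1) / 6).unpair.1 - 1) / 6).unpair.2 ∧ ¬ Marked l ((b - 1) / 6).unpair.2

theorem boundedMatrix_iff {a b : ℕ} {l : List Bool} : BoundedMatrix a b l ↔
    ∃ (t : Term) (φ : Formula), b = (Formula.imp (.lt (.var a) t) φ).code ∧ a ∉ t.vars ∧
      ¬ Marked l φ.code := by
  constructor
  · rintro ⟨h1, h2, h3⟩
    obtain ⟨t, ht⟩ := Term.code_surjective ((((b - 1) / 6).unpair.1 - 1) / 6).unpair.2
    obtain ⟨φ, hφ⟩ := Formula.code_surjective ((b - 1) / 6).unpair.2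
    rw [← ht, ← hφ] at h1
    rw [← ht, varOfCode_code] at h2
    exact ⟨t, φ, h1, h2, hφ ▸ h3⟩
  · rintro ⟨t, φ, h1, h2, h3⟩
    have e1 : (b - 1) / 6 = Nat.pair (Formula.lt (.var a) t).code φ.code := by
      rw [Formula.code] at h1
      omega
    have e2 : ((Formula.lt (.var a) t).code - 1) / 6 = Nat.pair (3 * a + 2) t.code := by
      simp only [Formula.code, Term.code]
      omega
    simp only [BoundedMatrix, e1, e2, Nat.unpair_pair, varOfCode_code]
    exact ⟨h1, h2, h3⟩

theorem Formula.isBounded_imp_iff {φ ψ : Formula} :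
    (imp φ ψ).IsBounded ↔ φ.IsBounded ∧ ψ.IsBounded :=
  ⟨fun h => by cases h; exact ⟨‹_›, ‹_›⟩, fun h => .imp h.1 h.2⟩

theorem Formula.isBounded_allNum_iff {x : ℕ} {φ : Formula} : (allNum x φ).IsBounded ↔
    ∃ t ψ, φ = imp (lt (.var x) t) ψ ∧ x ∉ t.vars ∧ ψ.IsBounded :=
  ⟨fun h => by cases h; exact ⟨_, _, rfl, ‹_›, ‹_›⟩, fun ⟨_, _, h, h1, h2⟩ => h ▸ .ball h1 h2⟩

theorem primrecPred_isBounded : PrimrecPred fun n => (Formula.ofCode n).IsBounded := by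
  have hn : Primrec fun p : ℕ × List Bool => p.2.length := Primrec.list_length.comp Primrec.snd
  have hq := primrec_sub_div 1 6 hn
  have ha := primrec_unpair_left hq
  have hb := primrec_unpair_right hq
  -- Since the contradictory formula is bounded, the recursion decides unboundedness.
  have key : PrimrecRel fun (_ n : ℕ) => ¬ (Formula.ofCode n).IsBounded := by
    refine primrecRel_ofCode (R := fun _ φ => ¬ φ.IsBounded)
      (G := fun r _ a b l => if r < 3 then False else if r = 3 then Marked l a ∨ Marked l b else
        if r = 4 then ¬ BoundedMatrix a b l else True)
      (fun _ h => h .fls) (fun r hr => ?_) fun r hr y a b φ hφ l hl => ?_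
    · have h1 := primrecPred_marked Primrec.snd ha
      have h2 := primrecPred_marked Primrec.snd hb
      have hF : PrimrecPred fun _ : ℕ × List Bool => False :=
        (primrecPred_eq_const (k := 1) (Primrec.const 0)).of_eq fun _ => by simp
      have hT : PrimrecPred fun _ : ℕ × List Bool => True := hF.not.of_eq fun _ => by simp
      have hc := primrec_sub_div 1 6 hb
      have ht := primrec_unpair_right (primrec_sub_div 1 6 (primrec_unpair_left hc))
      have hd := primrec_unpair_right hc
      have hB : PrimrecPred fun p : ℕ × List Bool => BoundedMatrix
          ((p.2.length - 1) / 6).unpair.1 ((p.2.length - 1) / 6).unpair.2 p.2 :=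
        .and (primrecPred_eq hb (primrec_mul_add 6 4 (Primrec₂.natPair.comp
          (primrec_mul_add 6 2 (Primrec₂.natPair.comp (primrec_mul_add 3 2 ha) ht)) hd)))
          (.and (primrecRel_varOfCode.comp ha ht).not (primrecPred_marked Primrec.snd hd).not)
      interval_cases r
      exacts [hF, hF, hF, h1.or h2, hB.not, hT]
    · have hab := Nat.left_le_pair a b
      have hba := Nat.right_le_pair a b
      cases φ with
      | fls => simp only [Formula.code] at hφ; omega
      | eq t s =>
        simp only [Formula.code] at hφ
        obtain rfl : r = 0 := by omega
        simp [Formula.IsBounded.eq]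
      | lt t s =>
        simp only [Formula.code] at hφ
        obtain rfl : r = 1 := by omega
        simp [Formula.IsBounded.lt]
      | mem t X =>
        simp only [Formula.code] at hφ
        obtain rfl : r = 2 := by omega
        simp [Formula.IsBounded.mem]
      | imp φ ψ =>
        simp only [Formula.code] at hφ hl
        obtain rfl : r = 3 := by omega
        obtain ⟨rfl, rfl⟩ :=
          Nat.pair_eq_pair.1 (show Nat.pair a b = Nat.pair φ.code ψ.code by omega)
        simp [Formula.isBounded_imp_iff, hl φ (by omega), hl ψ (by omega)]
        tauto
      | allNum x φ =>
        simp only [Formula.code] at hφ hl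
        obtain rfl : r = 4 := by omega
        obtain ⟨rfl, rfl⟩ := Nat.pair_eq_pair.1 (show Nat.pair a b = Nat.pair x φ.code by omega)
        simp only [Nat.reduceLT, if_false, Nat.reduceEqDiff, if_true, boundedMatrix_iff,
          Formula.isBounded_allNum_iff]
        refine not_congr (exists₂_congr fun t ψ => ?_)
        refine (and_congr_left' Formula.code_injective.eq_iff).trans (and_congr_right fun h => ?_)
        have h1 : ψ.code < φ.code := by
          rw [h, Formula.code]
          have := Nat.right_le_pair (Formula.lt (.var a) t).code ψ.code
          omega
        rw [hl ψ (by omega), not_not]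
      | allSet X φ =>
        simp only [Formula.code] at hφ hl
        obtain rfl : r = 5 := by omega
        simp only [Nat.reduceLT, if_false, Nat.reduceEqDiff, true_iff]
        intro h
        cases h
  exact ((key.comp (Primrec.const 0) Primrec.id).not).of_eq fun n => by simp

/-! #### Primitive recursive families of formulas -/

/-- The codes of the terms `t k` depend primitive recursively on `k`. -/
def PrimrecTerm (t : ℕ → Term) : Prop := Primrec fun k => (t k).code

/-- The codes of the formulas `φ k` depend primitive recursively on `k`. -/
def PrimrecFormula (φ : ℕ → Formula) : Prop := Primrec fun k => (φ k).code

section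

variable {t s : ℕ → Term} {φ ψ : ℕ → Formula} {x y X : ℕ → ℕ}

theorem PrimrecTerm.const (t : Term) : PrimrecTerm fun _ => t := Primrec.const _

theorem PrimrecTerm.var (hx : Primrec x) : PrimrecTerm fun k => .var (x k) :=
  primrec_mul_add 3 2 hx

theorem PrimrecTerm.add (ht : PrimrecTerm t) (hs : PrimrecTerm s) :
    PrimrecTerm fun k => .add (t k) (s k) :=
  primrec_mul_add 3 3 (Primrec₂.natPair.comp ht hs)

namespace PrimrecFormula

theorem const (φ : Formula) : PrimrecFormula fun _ => φ := Primrec.const _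

theorem ofCode (hx : Primrec x) : PrimrecFormula fun k => Formula.ofCode (x k) := by
  simpa [PrimrecFormula] using hx

theorem eq (ht : PrimrecTerm t) (hs : PrimrecTerm s) : PrimrecFormula fun k => .eq (t k) (s k) :=
  primrec_mul_add 6 1 (Primrec₂.natPair.comp ht hs)

theorem mem (ht : PrimrecTerm t) (hX : Primrec X) : PrimrecFormula fun k => .mem (t k) (X k) :=
  primrec_mul_add 6 3 (Primrec₂.natPair.comp ht hX)

theorem imp (hφ : PrimrecFormula φ) (hψ : PrimrecFormula ψ) :
    PrimrecFormula fun k => .imp (φ k) (ψ k) :=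
  primrec_mul_add 6 4 (Primrec₂.natPair.comp hφ hψ)

theorem allNum (hx : Primrec x) (hφ : PrimrecFormula φ) :
    PrimrecFormula fun k => .allNum (x k) (φ k) :=
  primrec_mul_add 6 5 (Primrec₂.natPair.comp hx hφ)

theorem allSet (hX : Primrec X) (hφ : PrimrecFormula φ) :
    PrimrecFormula fun k => .allSet (X k) (φ k) :=
  primrec_mul_add 6 6 (Primrec₂.natPair.comp hX hφ)

theorem neg (hφ : PrimrecFormula φ) : PrimrecFormula fun k => (φ k).neg := hφ.imp (const _)

theorem and (hφ : PrimrecFormula φ) (hψ : PrimrecFormula ψ) :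
    PrimrecFormula fun k => (φ k).and (ψ k) := neg (hφ.imp hψ.neg)

theorem iff (hφ : PrimrecFormula φ) (hψ : PrimrecFormula ψ) :
    PrimrecFormula fun k => (φ k).iff (ψ k) := and (hφ.imp hψ) (hψ.imp hφ)

theorem exNum (hx : Primrec x) (hφ : PrimrecFormula φ) :
    PrimrecFormula fun k => .exNum (x k) (φ k) := neg (allNum hx hφ.neg)

theorem exSet (hX : Primrec X) (hφ : PrimrecFormula φ) :
    PrimrecFormula fun k => .exSet (X k) (φ k) := neg (allSet hX hφ.neg)

theorem comprehension (hx : Primrec x) (hX : Primrec X) (hφ : PrimrecFormula φ) :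
    PrimrecFormula fun k => (φ k).comprehension (x k) (X k) :=
  exSet hX (allNum hx (iff (mem (.var hx) hX) hφ))

theorem induction (hx : Primrec x) (hy : Primrec y) (hφ : PrimrecFormula φ) :
    PrimrecFormula fun k => (φ k).induction (x k) (y k) :=
  imp (and (allNum hx (imp (eq (.var hx) (.const _)) hφ))
    (allNum hx (imp hφ (allNum hy (imp (eq (.var hy) (.add (.var hx) (.const _)))
      (allNum hx (imp (eq (.var hx) (.var hy)) hφ)))))))
    (allNum hx hφ)

end PrimrecFormula

end

/-- The theory is enumerated by a primitive recursive family restricted to a primitive recursive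
set of indices. -/
def Theory2.IsPrimrecEnum (T : Theory2) : Prop :=
  ∃ (P : ℕ → Prop) (φ : ℕ → Formula), PrimrecPred P ∧ PrimrecFormula φ ∧
    ∀ χ, χ ∈ T ↔ ∃ k, P k ∧ χ = φ k

namespace Theory2.IsPrimrecEnum

variable {T T' : Theory2}

theorem isRE (h : T.IsPrimrecEnum) : T.IsRE := by
  classical
  obtain ⟨P, φ, hP, hφ, hT⟩ := h
  have hR : PrimrecRel fun n k : ℕ => P k ∧ (φ k).code = n :=
    .and (hP.comp Primrec.snd) (Primrec.eq.comp (hφ.comp Primrec.snd) Primrec.fst)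
  have hf : Partrec fun n : ℕ => Nat.rfind fun k => Part.some (decide (P k ∧ (φ k).code = n)) :=
    Partrec.rfind (Primrec.to_comp hR.decide).partrec.to₂
  refine hf.dom_re.of_eq fun n => ?_
  refine Nat.rfind_dom.trans ⟨?_, ?_⟩
  · rintro ⟨k, hk, -⟩
    obtain ⟨h1, h2⟩ : P k ∧ (φ k).code = n := by simpa using hk
    exact ⟨φ k, (hT _).2 ⟨k, h1, rfl⟩, h2⟩
  · rintro ⟨χ, hχ, h⟩
    obtain ⟨k, hk, rfl⟩ := (hT χ).1 hχ
    exact ⟨k, by simpa using ⟨hk, h⟩, fun _ => trivial⟩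

theorem empty : IsPrimrecEnum ∅ :=
  ⟨fun _ => False, fun _ => .fls, (primrecPred_eq_const (k := 1) (Primrec.const 0)).of_eq
    fun _ => by simp, .const _, by simp⟩

theorem union (h : T.IsPrimrecEnum) (h' : T'.IsPrimrecEnum) : IsPrimrecEnum (T ∪ T') := by
  classical
  obtain ⟨P, φ, hP, hφ, hT⟩ := h
  obtain ⟨P', φ', hP', hφ', hT'⟩ := h'
  have hl : Primrec fun k : ℕ => k.unpair.1 := primrec_unpair_left Primrec.id
  have hr : Primrec fun k : ℕ => k.unpair.2 := primrec_unpair_right Primrec.id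
  have h0 := primrecPred_eq_const (k := 0) hl
  refine ⟨fun k => (k.unpair.1 = 0 ∧ P k.unpair.2) ∨ (¬ k.unpair.1 = 0 ∧ P' k.unpair.2),
    fun k => if k.unpair.1 = 0 then φ k.unpair.2 else φ' k.unpair.2,
    .or (.and h0 (hP.comp hr)) (.and h0.not (hP'.comp hr)), ?_, fun χ => ?_⟩
  · exact (Primrec.ite h0 (hφ.comp hr) (hφ'.comp hr)).of_eq fun k => by
      by_cases h : k.unpair.1 = 0 <;> simp [h]
  · rw [Set.mem_union, hT, hT']
    constructor
    · rintro (⟨k, hk, rfl⟩ | ⟨k, hk, rfl⟩)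
      · exact ⟨Nat.pair 0 k, by simpa using hk, by simp⟩
      · exact ⟨Nat.pair 1 k, by simpa using hk, by simp⟩
    · rintro ⟨k, ⟨h1, h2⟩ | ⟨h1, h2⟩, rfl⟩
      · exact .inl ⟨_, h2, if_pos h1⟩
      · exact .inr ⟨_, h2, if_neg h1⟩

theorem of_finite (h : T.Finite) : T.IsPrimrecEnum := by
  induction T, h using Set.Finite.induction_on with
  | empty => exact empty
  | @insert χ T _ _ ih =>
    have h1 : IsPrimrecEnum {χ} :=
      ⟨fun _ => True, fun _ => χ, (primrecPred_eq_const (k := 0) (Primrec.const 0)).of_eq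
        fun _ => by simp, .const _, by simp⟩
    exact h1.union ih

end Theory2.IsPrimrecEnum

theorem isPrimrecEnum_sigma01Induction : Theory2.IsPrimrecEnum sigma01Induction := by
  have h1 : Primrec fun k : ℕ => k.unpair.1 := primrec_unpair_left Primrec.id
  have hr : Primrec fun k : ℕ => k.unpair.2 := primrec_unpair_right Primrec.id
  have h2 := primrec_unpair_left hr
  have h3 := primrec_unpair_left (primrec_unpair_right hr)
  have h4 := primrec_unpair_right (primrec_unpair_right hr)
  have hφ : PrimrecFormula fun k : ℕ => Formula.exNum k.unpair.2.unpair.2.unpair.1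
      (Formula.ofCode k.unpair.2.unpair.2.unpair.2) := .exNum h3 (.ofCode h4)
  refine ⟨fun k => (Formula.ofCode k.unpair.2.unpair.2.unpair.2).IsBounded ∧
    ¬ k.unpair.2.unpair.1 = k.unpair.1 ∧ ¬ k.unpair.2.unpair.1 ∈ (Formula.ofCode (Formula.exNum
      k.unpair.2.unpair.2.unpair.1 (Formula.ofCode k.unpair.2.unpair.2.unpair.2)).code).freeNum,
    _, .and (primrecPred_isBounded.comp h4) (.and (primrecPred_eq h2 h1).not
      (primrecRel_mem_freeNum.comp h2 hφ).not), .induction h1 h2 hφ, fun χ => ?_⟩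
  simp only [Formula.ofCode_code]
  constructor
  · rintro ⟨x, y, _, ⟨w, θ, hθ, rfl⟩, hyx, hy, rfl⟩
    exact ⟨Nat.pair x (Nat.pair y (Nat.pair w θ.code)), by simpa using ⟨hθ, hyx, hy⟩, by simp⟩
  · rintro ⟨k, ⟨k1, k2, k3⟩, rfl⟩
    exact ⟨_, _, _, ⟨_, _, k1, rfl⟩, k2, k3, rfl⟩

theorem isPrimrecEnum_delta01Comprehension : Theory2.IsPrimrecEnum delta01Comprehension := by
  have h1 : Primrec fun k : ℕ => k.unpair.1 := primrec_unpair_left Primrec.id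
  have hr : Primrec fun k : ℕ => k.unpair.2 := primrec_unpair_right Primrec.id
  have h2 := primrec_unpair_left hr
  have hr2 := primrec_unpair_right hr
  have h3 := primrec_unpair_left hr2
  have hr3 := primrec_unpair_right hr2
  have h4 := primrec_unpair_left hr3
  have hr4 := primrec_unpair_right hr3
  have h5 := primrec_unpair_left hr4
  have h6 := primrec_unpair_right hr4
  have hφ : PrimrecFormula fun k : ℕ => Formula.exNum k.unpair.2.unpair.2.unpair.1
      (Formula.ofCode k.unpair.2.unpair.2.unpair.2.unpair.1) := .exNum h3 (.ofCode h4)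
  refine ⟨fun k => (Formula.ofCode k.unpair.2.unpair.2.unpair.2.unpair.1).IsBounded ∧
    (Formula.ofCode k.unpair.2.unpair.2.unpair.2.unpair.2.unpair.2).IsBounded ∧
    ¬ k.unpair.2.unpair.1 ∈ (Formula.ofCode (Formula.exNum k.unpair.2.unpair.2.unpair.1
      (Formula.ofCode k.unpair.2.unpair.2.unpair.2.unpair.1)).code).freeSet, _,
    .and (primrecPred_isBounded.comp h4) (.and (primrecPred_isBounded.comp h6)
      (primrecRel_mem_freeSet.comp h2 hφ).not),
    .imp (.allNum h1 (.iff hφ (.allNum h5 (.ofCode h6)))) (.comprehension h1 h2 hφ), fun χ => ?_⟩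
  simp only [Formula.ofCode_code]
  constructor
  · rintro ⟨x, X, _, _, ⟨w, θ, hθ, rfl⟩, ⟨z, η, hη, rfl⟩, hX, rfl⟩
    exact ⟨Nat.pair x (Nat.pair X (Nat.pair w (Nat.pair θ.code (Nat.pair z η.code)))),
      by simpa using ⟨hθ, hη, hX⟩, by simp⟩
  · rintro ⟨k, ⟨k1, k2, k3⟩, rfl⟩
    exact ⟨_, _, _, _, ⟨_, _, k1, rfl⟩, ⟨_, _, k2, rfl⟩, k3, rfl⟩

/-- The axioms are the values of a primitive recursive family on a primitive recursive set of
indices, since membership in each scheme is decided by the components of an instance. -/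
theorem isRE_system (J : Formula) (n : ℕ) : (system J n).IsRE := by
  have h1 : Theory2.IsPrimrecEnum basicAxioms := .of_finite (by simp [basicAxioms])
  have h2 : Theory2.IsPrimrecEnum {χ | ∃ i < n, χ = jumpAxiom J (i + 1)} :=
    .of_finite <| by
    refine ((Set.finite_Iio n).image fun i => jumpAxiom J (i + 1)).subset ?_
    rintro _ ⟨i, hi, rfl⟩
    exact ⟨i, hi, rfl⟩
  exact (((h1.union isPrimrecEnum_sigma01Induction).union
    isPrimrecEnum_delta01Comprehension).union h2).isRE

end Frac

namespace Frac

/-! ### Binary expansions -/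

theorem countable_setOf_recIn (B : Set ℕ) : {A | RecIn A B}.Countable := by
  have : Countable OCode := OCode.index_injective.countable
  choose c hc using fun A : {A | RecIn A B} => (OCode.exists_eval_iff B _).2 A.2
  refine Set.countable_coe_iff.1 (Function.Injective.countable (f := c) fun A A' h => ?_)
  have h' : charFun A.1 = charFun A'.1 := by rw [← hc, ← hc, h]
  refine Subtype.ext (Set.ext fun n => ?_)
  have hn := Part.some_inj.1 (congrFun h' n)
  by_cases h1 : n ∈ A.1 <;> by_cases h2 : n ∈ A'.1 <;> simp_all

/-- A real is determined by its integral part and its binary expansion. -/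
theorem eq_of_binaryExpansion_eq {x y : ℝ} (h0 : ⌊x⌋ = ⌊y⌋)
    (h : binaryExpansion x = binaryExpansion y) : x = y := by
  have hfloor : ∀ n : ℕ, ⌊x * 2 ^ n⌋ = ⌊y * 2 ^ n⌋ := by
    intro n
    induction n with
    | zero => simpa using h0
    | succ n ih =>
      have hodd : Odd ⌊x * 2 ^ (n + 1)⌋ ↔ Odd ⌊y * 2 ^ (n + 1)⌋ := Set.ext_iff.1 h n
      have key : ∀ z : ℝ, 2 * ⌊z * 2 ^ n⌋ ≤ ⌊z * 2 ^ (n + 1)⌋ ∧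
          ⌊z * 2 ^ (n + 1)⌋ < 2 * ⌊z * 2 ^ n⌋ + 2 := by
        intro z
        have h1 := Int.floor_le (z * 2 ^ n)
        have h2 := Int.lt_floor_add_one (z * 2 ^ n)
        rw [Int.le_floor, Int.floor_lt]
        push_cast
        rw [pow_succ]
        constructor <;> linarith
      have hx := key x
      have hy := key y
      rw [ih] at hx
      rw [Int.odd_iff, Int.odd_iff] at hodd
      omega
  by_contra hxy
  have hpos : 0 < |x - y| := abs_pos.2 (sub_ne_zero.2 hxy)
  obtain ⟨n, hn⟩ := pow_unbounded_of_one_lt (|x - y|)⁻¹ (one_lt_two (α := ℝ))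
  have h1 := Int.abs_sub_lt_one_of_floor_eq_floor (hfloor n)
  rw [← sub_mul, abs_mul, abs_of_pos (by positivity : (0 : ℝ) < 2 ^ n)] at h1
  rw [inv_lt_iff_one_lt_mul₀ hpos] at hn
  linarith [mul_comm |x - y| (2 ^ n)]

theorem countable_realsRecInJump (n : ℕ) : (realsRecInJump n).Countable := by
  have : Countable {A | RecIn A (emptyJump n)} := (countable_setOf_recIn _).to_subtype
  refine Set.countable_coe_iff.1 (Function.Injective.countable
    (f := fun x : realsRecInJump n =>
      (⌊x.1⌋, (⟨binaryExpansion x.1, x.2⟩ : {A | RecIn A (emptyJump n)}))) fun x y h => ?_)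
  rw [Prod.mk.injEq] at h
  exact Subtype.ext (eq_of_binaryExpansion_eq h.1 (congrArg Subtype.val h.2))

/-- A sequence of bits is written at the even positions of the binary expansion of a real `x`, with
zeros between them: `X i / 4 ^ i` are the truncations of `x`. The zeros keep the tail of the
expansion below `2 / 3` of its first bit, so that every expansion of this form is the one chosen
by `binaryExpansion`. -/
theorem exists_real_of_bits {b X : ℕ → ℕ} (hb : ∀ i, b i ≤ 1)
    (hX : ∀ i, X (i + 1) = 4 * X i + 2 * b i) :
    ∃ x : ℝ, (∀ i, (X i : ℝ) ≤ x * 4 ^ i ∧ x * 4 ^ i ≤ X i + 2 / 3) ∧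
      binaryExpansion x = {n | n % 2 = 0 ∧ b (n / 2) = 1} := by
  have hX' : ∀ i, (X (i + 1) : ℝ) = 4 * X i + 2 * b i := fun i => by
    rw [hX]
    push_cast
    ring
  have hb' : ∀ i, (b i : ℝ) ≤ 1 := fun i => by exact_mod_cast hb i
  have hpow : ∀ i, (0 : ℝ) < 4 ^ i := fun i => by positivity
  have hmono : Monotone fun i => (X i : ℝ) / 4 ^ i := monotone_nat_of_le_succ fun i => by
    rw [div_le_div_iff₀ (hpow _) (hpow _), hX', pow_succ]
    nlinarith [hpow i, (b i).cast_nonneg (α := ℝ)]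
  have hanti : Antitone fun i => ((X i : ℝ) + 2 / 3) / 4 ^ i := antitone_nat_of_succ_le fun i => by
    rw [div_le_div_iff₀ (hpow _) (hpow _), hX', pow_succ]
    nlinarith [hpow i, hb' i]
  have hmem := Monotone.ciSup_mem_iInter_Icc_of_antitone hmono hanti fun i =>
    div_le_div_of_nonneg_right (by linarith) (hpow i).le
  generalize (⨆ i, (X i : ℝ) / 4 ^ i) = x at hmem
  have hx : ∀ i, (X i : ℝ) ≤ x * 4 ^ i ∧ x * 4 ^ i ≤ X i + 2 / 3 := fun i => by
    obtain ⟨h1, h2⟩ := Set.mem_iInter.1 hmem i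
    exact ⟨(div_le_iff₀ (hpow i)).1 h1, (le_div_iff₀ (hpow i)).1 h2⟩
  refine ⟨x, hx, Set.ext fun n => ?_⟩
  obtain ⟨h1, h2⟩ := hx (n / 2 + 1)
  rw [hX', pow_succ] at h1 h2
  have h3 := hb (n / 2)
  simp only [binaryExpansion, Set.mem_ofPred_eq]
  rcases Nat.mod_two_eq_zero_or_one n with h | h
  · have hn : x * 2 ^ (n + 1) = x * 4 ^ (n / 2) * 2 := by
      conv_lhs => rw [show n = 2 * (n / 2) by omega, pow_succ, pow_mul]
      norm_num
      ring
    have : ⌊x * 2 ^ (n + 1)⌋ = 2 * (X (n / 2) : ℤ) + b (n / 2) := by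
      rw [Int.floor_eq_iff, hn]
      push_cast
      constructor <;> linarith
    rw [this, Int.odd_iff]
    omega
  · have hn : x * 2 ^ (n + 1) = x * 4 ^ (n / 2) * 4 := by
      conv_lhs => rw [show n + 1 = 2 * (n / 2 + 1) by omega, pow_mul, pow_succ]
      norm_num
      ring
    have : ⌊x * 2 ^ (n + 1)⌋ = 4 * (X (n / 2) : ℤ) + 2 * b (n / 2) := by
      rw [Int.floor_eq_iff, hn]
      push_cast
      constructor <;> linarith
    rw [this, Int.odd_iff]
    omega

theorem recIn_bits {B : Set ℕ} {b : ℕ → ℕ} (hb : FunRecIn B b) :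
    RecIn {n | n % 2 = 0 ∧ b (n / 2) = 1} B :=
  .and (.of_primrecRel Primrec.eq
      (.of_primrec (Primrec.nat_mod.comp Primrec.id (Primrec.const 2))) (.const 0))
    (.of_primrecRel Primrec.eq
      (hb.comp (.of_primrec (Primrec.nat_div.comp Primrec.id (Primrec.const 2)))) (.const 1))

/-- The `(k + 1)`-st jump, written as bits of a real, separates consecutive stages. -/
theorem exists_not_mem_realsRecInJump (k : ℕ) :
    ∃ x ∈ realsRecInJump (k + 1), x ∉ realsRecInJump k := by
  set b := ind (· ∈ emptyJump (k + 1)) with hb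
  have hb1 : ∀ i, b i ≤ 1 := fun i => by
    by_cases h : i ∈ emptyJump (k + 1) <;> simp [hb, ind, h]
  obtain ⟨x, -, hx⟩ := exists_real_of_bits (b := b)
    (X := fun i => Nat.rec 0 (fun i X => 4 * X + 2 * b i) i) hb1 fun i => rfl
  refine ⟨x, ?_, fun h => not_recIn_jump (emptyJump k) ?_⟩
  · rw [realsRecInJump, Set.mem_ofPred_eq, hx]
    exact recIn_bits (RecIn.refl (emptyJump (k + 1)))
  · rw [realsRecInJump, Set.mem_ofPred_eq, hx] at h
    have := RecIn.comp h (f := fun n => 2 * n)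
      (.of_primrec (Primrec.nat_mul.comp (Primrec.const 2) Primrec.id))
    convert this using 1
    ext n
    by_cases h : n ∈ jump (emptyJump k) <;> simp [hb, emptyJump, ind, h]

/-! ### Diagonalization -/

/-- The comparison of a rational code with `(16 * X + 5) / 4 ^ (i + 2)`, cleared of denominators. -/
theorem ratOfCode_lt_iff (m i X : ℕ) : (ratOfCode m : ℝ) * 4 ^ (i + 2) < 16 * X + 5 ↔
    m.unpair.1 * 4 ^ (i + 2) <
      (16 * X + 5) * (m.unpair.2.unpair.2 + 1) + m.unpair.2.unpair.1 * 4 ^ (i + 2) := by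
  have hpos : (0 : ℝ) < m.unpair.2.unpair.2 + 1 := by positivity
  rw [ratOfCode]
  push_cast
  rw [div_mul_eq_mul_div, div_lt_iff₀ hpos, ← Nat.cast_lt (α := ℝ)]
  push_cast
  rw [sub_mul]
  constructor <;> intro h <;> linarith

/-- A sequence of reals given by approximations recursive in `B` omits a real whose binary
expansion is recursive in `B`: with `X i / 4 ^ i` the truncation of that real, its `i`-th bit is
`1`, moving it by `2` units of size `4 ^ (-(i + 1))`, just if the approximation of the `i`-th real
to within half a unit lies less than `5 / 4` units above the truncation. -/
theorem exists_real_not_mem_range {B : Set ℕ} {r : ℕ → ℝ} {g : ℕ → ℕ → ℕ}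
    (hr : ∀ i k, |r i - (ratOfCode (g i k) : ℝ)| ≤ (1 / 2) ^ k)
    (hg : RecIn {m | ∃ i k, m = Nat.pair (Nat.pair i k) (g i k)} B) :
    ∃ x : ℝ, RecIn (binaryExpansion x) B ∧ x ∉ Set.range r := by
  obtain ⟨f, hf, hfg⟩ := RecIn.exists_search hg fun n =>
    ⟨g n.unpair.1 n.unpair.2, n.unpair.1, n.unpair.2, by simp⟩
  have hfg' : ∀ i k, f (Nat.pair i k) = g i k := by
    intro i k
    obtain ⟨i', k', h⟩ := hfg (Nat.pair i k)
    obtain ⟨h1, h2⟩ := Nat.pair_eq_pair.1 h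
    obtain ⟨rfl, rfl⟩ := Nat.pair_eq_pair.1 h1
    exact h2
  -- `bit` takes the code of `i` and `X i` to the `i`-th bit
  set code : ℕ → ℕ := fun q => f (Nat.pair q.unpair.1 (2 * q.unpair.1 + 3)) with hcode
  set bit : ℕ → ℕ := ind fun q => (code q).unpair.1 * 4 ^ (q.unpair.1 + 2) <
    (16 * q.unpair.2 + 5) * ((code q).unpair.2.unpair.2 + 1) +
      (code q).unpair.2.unpair.1 * 4 ^ (q.unpair.1 + 2) with hbit
  have hpow : Primrec₂ fun a b : ℕ => a ^ b := Primrec₂.unpaired'.1 Nat.Primrec.pow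
  have hcodeRec : FunRecIn B code := hf.comp (.pair .left
    (.comp₂ Primrec.nat_add (.comp₂ Primrec.nat_mul (.const 2) .left) (.const 3)))
  have hpowRec : FunRecIn B fun q => 4 ^ (q.unpair.1 + 2) :=
    .comp₂ hpow (.const 4) (.comp₂ Primrec.nat_add .left (.const 2))
  have hbitRec : FunRecIn B bit := recIn_iff.1 <| .of_primrecRel Primrec.nat_lt
    (.comp₂ Primrec.nat_mul (.comp .left hcodeRec) hpowRec)
    (.comp₂ Primrec.nat_add
      (.comp₂ Primrec.nat_mul
        (.comp₂ Primrec.nat_add (.comp₂ Primrec.nat_mul (.const 16) .right) (.const 5))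
        (.comp₂ Primrec.nat_add (.comp .right (.comp .right hcodeRec)) (.const 1)))
      (.comp₂ Primrec.nat_mul (.comp .left (.comp .right hcodeRec)) hpowRec))
  set X : ℕ → ℕ := fun i =>
    Nat.rec (motive := fun _ => ℕ) 0 (fun i x => 4 * x + 2 * bit (Nat.pair i x)) i with hX
  have hXRec : FunRecIn B X := by
    have h := FunRecIn.prec (B := B) (f := fun _ => 0)
      (g := fun q => 4 * q.unpair.2.unpair.2 + 2 * bit q.unpair.2) (.const 0)
      (.comp₂ Primrec.nat_add (.comp₂ Primrec.nat_mul (.const 4) (.comp .right .right))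
        (.comp₂ Primrec.nat_mul (.const 2) (hbitRec.comp .right)))
    simpa using h.comp (.pair (.const 0) .id)
  have hb : ∀ i, bit (Nat.pair i (X i)) ≤ 1 := fun i => by
    simp only [hbit, ind]
    split_ifs <;> simp
  obtain ⟨x, hx, hxb⟩ := exists_real_of_bits (b := fun i => bit (Nat.pair i (X i))) (X := X) hb
    fun i => rfl
  refine ⟨x, hxb ▸ recIn_bits (hbitRec.comp (.pair .id hXRec)), ?_⟩
  rintro ⟨i, rfl⟩
  have h1 := abs_le.1 (hr i (2 * i + 3))
  obtain ⟨h2, h3⟩ := hx (i + 1)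
  have hXi : X (i + 1) = 4 * X i + 2 * bit (Nat.pair i (X i)) := rfl
  have hpos : (0 : ℝ) < 4 ^ (i + 2) := by positivity
  have hhalf : (1 / 2 : ℝ) ^ (2 * i + 3) * 4 ^ (i + 2) = 2 := by
    rw [pow_add, pow_mul, pow_add (4 : ℝ), mul_mul_mul_comm, ← mul_pow]
    norm_num
  have h4 : r i * 4 ^ (i + 2) = r i * 4 ^ (i + 1) * 4 := by ring
  have h5 := mul_le_mul_of_nonneg_right h1.1 hpos.le
  have h6 := mul_le_mul_of_nonneg_right h1.2 hpos.le
  rw [neg_mul, hhalf, sub_mul] at h5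
  rw [hhalf, sub_mul] at h6
  by_cases hlt : (ratOfCode (g i (2 * i + 3)) : ℝ) * 4 ^ (i + 2) < 16 * X i + 5
  · have hbit1 : bit (Nat.pair i (X i)) = 1 := by
      rw [hbit, ind_pos]
      simpa [hcode, hfg'] using (ratOfCode_lt_iff _ _ _).1 hlt
    rw [hXi, hbit1] at h2
    push_cast at h2
    linarith
  · have hbit0 : bit (Nat.pair i (X i)) = 0 := by
      rw [hbit, ind_neg]
      simpa [hcode, hfg'] using fun h => hlt ((ratOfCode_lt_iff _ _ _).2 h)
    rw [hXi, hbit0] at h3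
    push_cast at h3
    linarith

/-- No theory defines only arithmetical sets and enumerates all the reals with arithmetical
expansions: the oracle of the enumeration computes a real that it omits. -/
theorem not_enumerates {T : Theory2} (hT : ∀ A ∈ T.DefSets, ∃ k, RecIn A (emptyJump k)) :
    ¬ T.Enumerates (⋃ n, realsRecInJump n) := by
  rintro ⟨r, g, hr, hg, hS⟩
  obtain ⟨k, hk⟩ := hT _ hg
  obtain ⟨x, hx, hxr⟩ := exists_real_not_mem_range hr hk
  exact hxr (hS ▸ Set.mem_iUnion.2 ⟨k, hx⟩)

end Frac

open Frac in
theorem mainTheorem5 :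
    ∃ (F : ℕ → Theory2) (St : ℕ → Set ℝ) (Sinf : Set ℝ),
      IsFractallyCountableVia RCA0 F St Sinf ∧
      (∀ n, St n = realsRecInJump n) ∧
      (∀ k, ¬ (F k).Enumerates Sinf) ∧
      ¬ Theory2.Enumerates (⋃ n, F n) Sinf := by
  obtain ⟨J, hJ⟩ := exists_isJumpFormula
  have hDef : ∀ n, (system J n).DefReals = realsRecInJump n := fun n => by
    rw [Theory2.DefReals, defSets_system hJ]
    rfl
  have hnot : ∀ k, ¬ (system J k).Enumerates (⋃ n, realsRecInJump n) := fun k =>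
    not_enumerates fun A hA => ⟨k, (defSets_system hJ k ▸ hA : A ∈ jumpIdeal k)⟩
  refine ⟨system J, realsRecInJump, ⋃ n, realsRecInJump n,
    { base := system_zero J
      conservative := system_conservative hJ
      stage := fun n => (hDef n).symm
      stage_countable := countable_realsRecInJump
      union := rfl
      not_definable := fun k h => ?_
      not_enumerable := hnot
      constructive := fun n => ⟨isRE_system J n, system_not_pi11 hJ n⟩ },
    fun _ => rfl, hnot, not_enumerates fun _ => exists_recIn_of_mem_defSets_iUnion hJ⟩
  obtain ⟨x, hx, hx'⟩ := exists_not_mem_realsRecInJump k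
  exact hx' (hDef k ▸ h (Set.mem_iUnion.2 ⟨k + 1, hx⟩))
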